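/- **Setting.** Let $d,N,p,T,B\ge 1$ be integers. Let $\ell_{i,t}:\mathbb{R}^d\to\mathbb{R}$ ($1\le i\le N$, $1\le t\le T$) be fixed (non-random) loss functions and $c_1,\dots,c_p:\mathbb{R}^d\to\mathbb{R}$ constraint functions, all convex; put $\mathcal X=\{x\in\mathbb{R}^d: c_s(x)\le 0,\ s=1,\dots,p\}$ and $\mathcal B=\{x:\|x\|\le R\}$ with $R>0$ (Euclidean norm). Assume: 1. $0\in\mathcal X\subseteq\mathcal B$. 2. All $\ell_{i,t}$ and $c_s$ are differentiable at every point of $\mathcal B$, with $\|\nabla\ell_{i,t}(x)\|\le G_\ell$ and $\|\nabla c_s(x)\|\le G_c$ for all $x\in\mathcal B$; let $G=\max\{G_\ell,G_c\}>0$. 3. $|\ell_{i,t}(x)|\le C$ for all $x\in\mathcal B$ and all $i,t$. 4. $\mathcal G_t=(\{1,\dots,N\},\mathcal E_t)$, $t\ge 1$, are directed graphs such that for every $k\ge 0$ the graph with edge set $\mathcal E_{kB+1}\cup\dots\cup\mathcal E_{(k+1)B}$ is strongly connected. 5. $A(t)$, $t\ge 1$, are doubly stochastic $N\times N$ matrices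 and $\zeta>0$ is such that $[A(t)]_{ii}\ge\zeta$ for all $i$ and, for $j\ne i$, $[A(t)]_{ij}\ge\zeta$ if $(j,i)\in\mathcal E_t$ and $[A(t)]_{ij}=0$ otherwise. **Algorithm (DOCO-LTC with one-point bandit feedback).** Let $c\in(0,1)$, $a>1$ and, for all $t$, $$\eta_t=\frac1{T^c},\qquad \beta_t=\frac1{a\,p\,G^2T^c},\qquad \varepsilon_t=\frac1{T^{c/3}},\qquad \pi=\frac1{R\,T^{c/3}},$$ and suppose $\pi\le 1$. Let $u_i(t)$ be independent random vectors (over all $i,t$), each uniformly distributed on the unit sphere of $\mathbb{R}^d$. Write $[r]_+=\max\{0,r\}$, and let $\partial[c_s(x)]_+$ be $\nabla c_s(x)$ if $c_s(x)>0$ and $0$ otherwise. Start from $x_i(1)=0\in\mathbb{R}^d$, $\lambda_i(1)=0\in\mathbb{R}^p$ and, for $t=1,\dots,T$ and all $i$, set $$\tilde\nabla\ell_{i,t}(x_i(t))=\frac d{\varepsilon_t}\,\ell_{i,t}\big(x_i(t)+\varepsilon_tu_i(t)\big)\,u_i(t),\qquad y_i(t)=x_i(t)-\beta_t\Big[\tilde\nabla\ell_{i,t}(x_i(t))+\sum_{s=1}^p[\lambda_i(t)]_s\,\partial[c_s(x_i(t))]_+\Big],$$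 let $x_i(t+1)$ be the Euclidean projection of $\sum_{j=1}^N[A(t)]_{ij}\,y_j(t)$ onto the shrunken ball $(1-\pi)\mathcal B$, and let $\lambda_i(t+1)$ be the maximizer over $\lambda\in\mathbb{R}^p_+$ of $$\tilde\ell_{i,t}(x_i(t+1))+\sum_{s=1}^p[\lambda]_s[c_s(x_i(t+1))]_+-\frac{\eta_t}2\|\lambda\|^2 ,$$ where $\tilde\ell_{i,t}(x)=\mathbb{E}_v[\ell_{i,t}(x+\varepsilon_tv)]$ with $v$ uniform on the unit ball. **Theorem.** Let $x^\star$ be a minimizer of $\sum_{t=1}^T\sum_{j=1}^N\ell_{j,t}$ over $\mathcal X$ and put $\mathsf{Reg}(i,T)=\sum_{t=1}^T\sum_{j=1}^N\ell_{j,t}(x_i(t))-\sum_{t=1}^T\sum_{j=1}^N\ell_{j,t}(x^\star)$. Then all the expectations below are of integrable random variables, and $$\max_{1\le i\le N}\mathbb{E}[\mathsf{Reg}(i,T)]\le \tilde C\,T^{\max\{1-c/3,\;c\}},\qquad \sum_{t=1}^T\sum_{i=1}^N\sum_{s=1}^p\mathbb{E}\big[[c_s(x_i(t))]_+\big]\le\bar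 C\,T^{1-c/2},$$ where $$\tilde C=3NG+\frac{NC\hat Cd}{apG}+\frac{NC^2d^2}{apG^2}+\frac12apNG^2R^2+\frac{N\hat C^2}{4a(a-1)p},\qquad \bar C=\sqrt{\frac{N^2}{a-1}\Big(\frac{C^2d^2}{G^2}+2apGR+\frac12a^2p^2G^2R^2\Big)},$$ $$\hat C=2N\Big(\frac{3N}{\psi^{2+1/B}(1-\psi^{1/B})}+4\Big),\qquad \psi=1-\frac{\zeta}{4N^2}.$$ -/

import Mathlib

open MeasureTheory ProbabilityTheory

noncomputable section

namespace DOCO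

/-- The decision space `ℝ^d` with its Euclidean norm. -/
abbrev Vec (d : ℕ) : Type := EuclideanSpace ℝ (Fin d)

/-! ### The communication network -/

/-- For every `k ≥ 0`, the union of the directed graphs at times `kB + 1, …, (k+1)B` is strongly
connected: any node can be reached from any node along edges of the union. -/
def JointlyConnected {N : ℕ} (graph : ℕ → Digraph (Fin N)) (B : ℕ) : Prop :=
  ∀ k : ℕ, ∀ i j : Fin N,
    Relation.ReflTransGen
      (fun v w => ∃ t ∈ Finset.Icc (k * B + 1) ((k + 1) * B), (graph t).Adj v w) i j

/-- A weight matrix for a directed graph: doubly stochastic, diagonal entries at least `ζ`,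
and `A i j ≥ ζ` on the edges `(j, i)` and `A i j = 0` off the edges (for `j ≠ i`). -/
structure IsWeightMatrix {N : ℕ} (graph : Digraph (Fin N)) (ζ : ℝ)
    (A : Matrix (Fin N) (Fin N) ℝ) : Prop where
  doubly_stochastic : A ∈ doublyStochastic ℝ (Fin N)
  diag : ∀ i, ζ ≤ A i i
  edge : ∀ i j, i ≠ j → graph.Adj j i → ζ ≤ A i j
  non_edge : ∀ i j, i ≠ j → ¬ graph.Adj j i → A i j = 0

/-! ### The uniform laws -/

/-- The uniform probability law on the unit sphere (normalised surface measure). -/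
def uniformSphere (d : ℕ) : Measure (Metric.sphere (0 : Vec d) 1) :=
  ((volume : Measure (Vec d)).toSphere Set.univ)⁻¹ • (volume : Measure (Vec d)).toSphere

/-- The uniform probability law on the closed unit ball (normalised Lebesgue measure). -/
def uniformBall (d : ℕ) : Measure (Vec d) :=
  ProbabilityTheory.cond volume (Metric.closedBall (0 : Vec d) 1)

/-! ### The algorithm -/

/-- The feasible set `{x | c_s(x) ≤ 0 for all s}`. -/
def feasible {d p : ℕ} (con : Fin p → Vec d → ℝ) : Set (Vec d) :=
  {x | ∀ s, con s x ≤ 0}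

/-- The subgradient of `[f]_+` that the algorithm uses: `∇ f(x)` where `f(x) > 0`, else `0`. -/
def posPartGrad {d : ℕ} (f : Vec d → ℝ) (x : Vec d) : Vec d :=
  open Classical in if 0 < f x then gradient f x else 0

/-- The one-point gradient estimator `(d/ε) f(x + ε u) u`. -/
def onePointEstimator {d : ℕ} (f : Vec d → ℝ) (ε : ℝ) (x u : Vec d) : Vec d :=
  ((d : ℝ) / ε * f (x + ε • u)) • u

/-- The smoothed loss `E_v [f(x + ε v)]`, where `v` is uniform on the unit ball. -/
def smoothed {d : ℕ} (f : Vec d → ℝ) (ε : ℝ) (x : Vec d) : ℝ :=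
  ∫ v, f (x + ε • v) ∂(uniformBall d)

/-- The smoothed augmented Lagrangian
`E_v [f(x + ε v)] + ∑_s λ_s [c_s(x)]_+ - (η/2) ‖λ‖²`. -/
def smoothedLagrangian {d p : ℕ} (f : Vec d → ℝ) (con : Fin p → Vec d → ℝ) (ε η : ℝ)
    (x : Vec d) (lam : Vec p) : ℝ :=
  smoothed f ε x + (∑ s, lam s * max 0 (con s x)) - η / 2 * ‖lam‖ ^ 2

/-- `z` is the Euclidean projection of `q` onto `S`: a point of `S` nearest to `q`. -/
def IsProjection {d : ℕ} (S : Set (Vec d)) (q z : Vec d) : Prop :=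
  z ∈ S ∧ IsMinOn (fun w => dist q w) S z

/-- The vector `y_i(t)` that a unit sends out, computed from its current decision `x`, its
dual variable `lam` and its exploration direction `u`. -/
def primalStep {d p : ℕ} (f : Vec d → ℝ) (con : Fin p → Vec d → ℝ) (β ε : ℝ)
    (x : Vec d) (lam : Vec p) (u : Vec d) : Vec d :=
  x - β • (onePointEstimator f ε x u + ∑ s, lam s • posPartGrad (con s) x)

/-- `x i t` and `lam i t` (`1 ≤ t ≤ T + 1`) are the decisions and dual variables produced over
the time-steps `1, …, T` by the algorithm with one-point bandit feedback, when the exploration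
directions are `u i t`. The decisions are projected onto the ball of radius `(1 - shrink) R`. -/
structure IsBanditRun {d N p : ℕ} (T : ℕ) (loss : Fin N → ℕ → Vec d → ℝ)
    (con : Fin p → Vec d → ℝ) (R : ℝ) (A : ℕ → Matrix (Fin N) (Fin N) ℝ)
    (η β ε : ℕ → ℝ) (shrink : ℝ) (u : Fin N → ℕ → Vec d)
    (x : Fin N → ℕ → Vec d) (lam : Fin N → ℕ → Vec p) : Prop where
  init_x : ∀ i, x i 1 = 0
  init_lam : ∀ i, lam i 1 = 0
  update_x : ∀ t ∈ Finset.Icc 1 T, ∀ i,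
    IsProjection (Metric.closedBall 0 ((1 - shrink) * R))
      (∑ j, A t i j • primalStep (loss j t) con (β t) (ε t) (x j t) (lam j t) (u j t))
      (x i (t + 1))
  update_lam : ∀ t ∈ Finset.Icc 1 T, ∀ i,
    (∀ s, 0 ≤ lam i (t + 1) s) ∧
      IsMaxOn (fun l : Vec p => smoothedLagrangian (loss i t) con (ε t) (η t) (x i (t + 1)) l)
        {l : Vec p | ∀ s, 0 ≤ l s} (lam i (t + 1))

/-! ### Performance measures -/

/-- The system-wide loss accumulated up to time `T` by the fixed decision `z`. -/
def totalLoss {d N : ℕ} (T : ℕ) (loss : Fin N → ℕ → Vec d → ℝ) (z : Vec d) : ℝ :=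
  ∑ t ∈ Finset.Icc 1 T, ∑ j, loss j t z

/-- The regret of a unit with decisions `xi t` against the fixed decision `xstar`. -/
def regret {d N : ℕ} (T : ℕ) (loss : Fin N → ℕ → Vec d → ℝ) (xstar : Vec d)
    (xi : ℕ → Vec d) : ℝ :=
  (∑ t ∈ Finset.Icc 1 T, ∑ j, loss j t (xi t)) - totalLoss T loss xstar

/-- The expected system-level regret `max_i E[Reg(i,T)]`. -/
def expectedSystemRegret {Ω : Type*} [MeasurableSpace Ω] (μ : Measure Ω) {d N : ℕ} (T : ℕ)
    (loss : Fin N → ℕ → Vec d → ℝ) (xstar : Vec d) (x : Fin N → ℕ → Ω → Vec d) : ℝ :=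
  ⨆ i : Fin N, ∫ ω, regret T loss xstar (fun t => x i t ω) ∂μ

/-- The expected cumulative absolute constraint violation
`∑_t ∑_i ∑_s E[[c_s(x_i(t))]_+]`. -/
def expectedViolation {Ω : Type*} [MeasurableSpace Ω] (μ : Measure Ω) {d N p : ℕ} (T : ℕ)
    (con : Fin p → Vec d → ℝ) (x : Fin N → ℕ → Ω → Vec d) : ℝ :=
  ∑ t ∈ Finset.Icc 1 T, ∑ i, ∑ s, ∫ ω, max 0 (con s (x i t ω)) ∂μ

/-! ### The constants -/

/-- `ψ = 1 - ζ / (4 N²)`. -/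
def psiConst (N : ℕ) (ζ : ℝ) : ℝ := 1 - ζ / (4 * (N : ℝ) ^ 2)

/-- `Ĉ = 2N (3N / (ψ^(2 + 1/B) (1 - ψ^(1/B))) + 4)`. -/
def hatC (N B : ℕ) (ζ : ℝ) : ℝ :=
  2 * N * (3 * N / (psiConst N ζ ^ (2 + 1 / (B : ℝ)) * (1 - psiConst N ζ ^ (1 / (B : ℝ)))) + 4)

/-- The constant of the regret bound. -/
def regretConst (d N p B : ℕ) (R G C a ζ : ℝ) : ℝ :=
  3 * N * G + N * C * hatC N B ζ * d / (a * p * G) + N * C ^ 2 * (d : ℝ) ^ 2 / (a * p * G ^ 2)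
    + 1 / 2 * a * p * N * G ^ 2 * R ^ 2 + N * hatC N B ζ ^ 2 / (4 * a * (a - 1) * p)

/-- The constant of the constraint violation bound. -/
def violationConst (d N p : ℕ) (R G C a : ℝ) : ℝ :=
  Real.sqrt ((N : ℝ) ^ 2 / (a - 1) *
    (C ^ 2 * (d : ℝ) ^ 2 / G ^ 2 + 2 * a * p * G * R + 1 / 2 * a ^ 2 * (p : ℝ) ^ 2 * G ^ 2 * R ^ 2))

end DOCO

end

/-! The dual variable is not an accumulated multiplier. Maximizing the regularized Lagrangian gives
`λ_s = K [c_s(x)]_+` with `K = T^c` (`eq_div_of_isMaxOn_smoothedLagrangian`, `IsBanditRun.lam_eq`),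
so the algorithm is averaged, projected descent on the losses plus the penalty `(K/2) Σ_s [c_s]_+²`.
Testing the descent inequality `sum_inner_le` against a feasible point `z`, convexity yields a gain
`K Σ [c_s]_+²`. The squared steps cost `K/a` times the same sum, plus the estimator noise `β
(dC/ε)²` per unit and time. Since `a > 1`, the fraction `(a-1)/a` of the gain survives.

The estimator can be replaced by smoothed losses in expectation: the divergence theorem on the unit
ball (`setIntegral_lineDeriv_ball`), combined with the gradient inequality at every perturbed point
`x + εv`, shows that it averages to a subgradient of the smoothed loss
(`smoothed_sub_le_integral_onePointEstimator`), and the current direction is independent of the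
current decision. This gives the central inequality `integral_sum_smoothed_sub_add_le`.

Both bounds follow from it. For the regret of unit `i`, the losses at `x_i` are moved to the `x_j`
at the price of the disagreement. That price is linear in the violations and is absorbed by the
surviving quadratic term by completing the square; the comparator is the shrunken point `(1-π) x⋆`.
For the violation, the smoothed losses are bounded below trivially, and Cauchy-Schwarz passes from
the sum of squares to the sum.

The disagreement (`sum_norm_sub_le_hatC`) is governed by the mixing of products of weight matrices.
Over each window of `B` steps the energy `Σ y_i²` of a mean-zero vector shrinks by the factor `1 -
ζ/(2N²)`: sort the entries, and charge each gap between consecutive values to the first time an edge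
crosses it (`energy_window_of_monotone`). -/

noncomputable section

namespace DOCO

/-! ### Averaging over jointly connected networks -/

/-- A doubly stochastic matrix whose diagonal entries and nonzero entries are at least `ζ`. -/
structure IsFloorStochastic {N : ℕ} (ζ : ℝ) (M : Matrix (Fin N) (Fin N) ℝ) : Prop where
  mem : M ∈ doublyStochastic ℝ (Fin N)
  diag : ∀ i, ζ ≤ M i i
  entry : ∀ i j, M i j ≠ 0 → ζ ≤ M i j

theorem IsWeightMatrix.isFloorStochastic {N : ℕ} {graph : Digraph (Fin N)} {ζ : ℝ}
    {A : Matrix (Fin N) (Fin N) ℝ} (h : IsWeightMatrix graph ζ A) : IsFloorStochastic ζ A where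
  mem := h.doubly_stochastic
  diag := h.diag
  entry i j hij := by
    rcases eq_or_ne i j with rfl | hne
    · exact h.diag i
    · by_cases hadj : graph.Adj j i
      · exact h.edge i j hne hadj
      · exact absurd (h.non_edge i j hne hadj) hij

theorem IsFloorStochastic.submatrix {N : ℕ} {ζ : ℝ} {M : Matrix (Fin N) (Fin N) ℝ}
    (h : IsFloorStochastic ζ M) (σ : Equiv.Perm (Fin N)) :
    IsFloorStochastic ζ (M.submatrix σ σ) where
  mem := by
    rw [mem_doublyStochastic_iff_sum]
    obtain ⟨h0, h1, h2⟩ := mem_doublyStochastic_iff_sum.1 h.mem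
    refine ⟨fun i j => h0 _ _, fun i => ?_, fun j => ?_⟩
    · simpa using (Equiv.sum_comp σ (fun j => M (σ i) j)).trans (h1 _)
    · simpa using (Equiv.sum_comp σ (fun i => M i (σ j))).trans (h2 _)
  diag i := h.diag _
  entry i j := h.entry _ _

/-- This is the Laplacian form of `yᵀ(I - MᵀM)y`: `MᵀM` is symmetric with unit row sums. It makes
the energy loss a sum of nonnegative pair terms. -/
theorem sq_sum_sub_sq_mulVec {N : ℕ} {M : Matrix (Fin N) (Fin N) ℝ}
    (hM : M ∈ doublyStochastic ℝ (Fin N)) (y : Fin N → ℝ) :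
    ∑ i, y i ^ 2 - ∑ i, (M.mulVec y i) ^ 2
      = 1 / 2 * ∑ i, ∑ j, (∑ k, M k i * M k j) * (y j - y i) ^ 2 := by
  obtain ⟨-, h1, h2⟩ := mem_doublyStochastic_iff_sum.1 hM
  have row : ∀ k, ∑ i, ∑ j, M k i * M k j * (y j - y i) ^ 2
      = 2 * (∑ j, M k j * y j ^ 2) - 2 * (M.mulVec y k) ^ 2 := by
    intro k
    have e1 : ∑ i, ∑ j, M k i * M k j * (y j - y i) ^ 2
        = ∑ i, ∑ j, (M k i * (M k j * y j ^ 2) + (M k i * y i ^ 2) * M k j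
            - 2 * ((M k i * y i) * (M k j * y j))) := by
      refine Finset.sum_congr rfl fun i _ => Finset.sum_congr rfl fun j _ => by ring
    rw [e1]
    simp only [Finset.sum_add_distrib, Finset.sum_sub_distrib, ← Finset.mul_sum,
      ← Finset.sum_mul, h1]
    simp only [Matrix.mulVec, dotProduct]
    ring
  have e2 : ∑ i, ∑ j, (∑ k, M k i * M k j) * (y j - y i) ^ 2
      = ∑ k, ∑ i, ∑ j, M k i * M k j * (y j - y i) ^ 2 := by
    rw [Finset.sum_comm' (t' := Finset.univ) (s' := fun _ => Finset.univ) (by simp)]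
    simp only [Finset.sum_mul]
    rw [Finset.sum_comm]
    rw [Finset.sum_congr rfl fun i _ => Finset.sum_comm]
    rw [Finset.sum_comm]
  have e3 : ∑ k, ∑ j, M k j * y j ^ 2 = ∑ j, y j ^ 2 := by
    rw [Finset.sum_comm]
    refine Finset.sum_congr rfl fun j _ => ?_
    rw [← Finset.sum_mul, h2, one_mul]
  rw [e2, Finset.sum_congr rfl fun k _ => row k, Finset.sum_sub_distrib, ← Finset.mul_sum,
    ← Finset.mul_sum, e3]
  ring

/-- A matrix has a nonzero entry joining the index sets `{i ≤ d}` and `{i > d}`. -/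
def Crosses {N : ℕ} (M : Matrix (Fin N) (Fin N) ℝ) (d : ℕ) : Prop :=
  ∃ i j : Fin N, i.val ≤ d ∧ d < j.val ∧ (M i j ≠ 0 ∨ M j i ≠ 0)

/-- The weight of `MᵀM` across the cut is `Σ_k p_k q_k`, where row `k` puts mass `p_k` below the cut
and `q_k = 1 - p_k` above. A crossing entry, together with the diagonal entry of its row, gives a
row with `p_k, q_k ≥ ζ`; the larger of the two is at least `1/2`. -/
theorem Crosses.half_le {N : ℕ} {ζ : ℝ} (hζ : 0 ≤ ζ) {M : Matrix (Fin N) (Fin N) ℝ}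
    (hM : IsFloorStochastic ζ M) {d : ℕ} (h : Crosses M d) :
    ζ / 2 ≤ ∑ i, ∑ j, (∑ k, M k i * M k j) * (if i.val ≤ d ∧ d < j.val then 1 else 0) := by
  obtain ⟨h0, h1, -⟩ := mem_doublyStochastic_iff_sum.1 hM.mem
  have e : ∑ i, ∑ j, (∑ k, M k i * M k j) * (if i.val ≤ d ∧ d < j.val then (1 : ℝ) else 0)
      = ∑ k, (∑ i, if i.val ≤ d then M k i else 0) * (∑ j, if d < j.val then M k j else 0) := by
    simp only [Finset.sum_mul]
    rw [Finset.sum_congr rfl fun i _ => Finset.sum_comm]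
    rw [Finset.sum_comm]
    refine Finset.sum_congr rfl fun k _ => Finset.sum_congr rfl fun i _ => ?_
    rw [Finset.mul_sum]
    refine Finset.sum_congr rfl fun j _ => ?_
    by_cases hi : i.val ≤ d <;> by_cases hj : d < j.val <;> simp [hi, hj]
  rw [e]
  have hlo : ∀ k i, (0 : ℝ) ≤ if (i : Fin N).val ≤ d then M k i else 0 := by
    intro k i; split_ifs <;> simp [h0]
  have hhi : ∀ k i, (0 : ℝ) ≤ if d < (i : Fin N).val then M k i else 0 := by
    intro k i; split_ifs <;> simp [h0]
  have hnn : ∀ k, 0 ≤ (∑ i, if i.val ≤ d then M k i else 0) *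
      (∑ j, if d < j.val then M k j else 0) := fun k =>
    mul_nonneg (Finset.sum_nonneg fun i _ => hlo k i) (Finset.sum_nonneg fun i _ => hhi k i)
  have hsum : ∀ k, (∑ i, if i.val ≤ d then M k i else 0) +
      (∑ j, if d < j.val then M k j else 0) = 1 := by
    intro k
    rw [← Finset.sum_add_distrib, ← h1 k]
    refine Finset.sum_congr rfl fun i _ => ?_
    by_cases hi : i.val ≤ d
    · simp [hi]
    · simp [hi, not_le.1 hi]
  have key : ∀ k, (∃ i : Fin N, i.val ≤ d ∧ ζ ≤ M k i) → (∃ j : Fin N, d < j.val ∧ ζ ≤ M k j) →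
      ζ / 2 ≤ ∑ k, (∑ i, if i.val ≤ d then M k i else 0) *
        (∑ j, if d < j.val then M k j else 0) := by
    rintro k ⟨i, hi, hi'⟩ ⟨j, hj, hj'⟩
    have a1 : ζ ≤ ∑ i, if i.val ≤ d then M k i else 0 := by
      refine le_trans ?_ (Finset.single_le_sum (fun i _ => hlo k i) (Finset.mem_univ i))
      simpa [hi] using hi'
    have a2 : ζ ≤ ∑ j, if d < j.val then M k j else 0 := by
      refine le_trans ?_ (Finset.single_le_sum (fun i _ => hhi k i) (Finset.mem_univ j))
      simpa [hj] using hj'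
    refine le_trans ?_ (Finset.single_le_sum (fun k _ => hnn k) (Finset.mem_univ k))
    have := hsum k
    set p := ∑ i, if i.val ≤ d then M k i else 0
    set q := ∑ j, if d < j.val then M k j else 0
    rcases le_total p q with hpq | hpq <;> nlinarith
  obtain ⟨i, j, hi, hj, hij | hij⟩ := h
  · exact key i ⟨i, hi, hM.diag i⟩ ⟨j, hj, hM.entry _ _ hij⟩
  · exact key j ⟨i, hi, hM.entry _ _ hij⟩ ⟨j, hj, hM.diag j⟩

/-- A sum of squares of nonnegative gaps is at most the square of their sum, which telescopes. The
bounds on `u` and `v` are required only at cuts in `D`, because only those cuts are known to be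
still unmixed when this is used. -/
theorem sum_gap_sq_le {b : ℕ → ℝ} (hb : Monotone b) (D : Finset ℕ) {i j : ℕ} {u v : ℝ}
    (hu : ∀ d ∈ D, i ≤ d → u ≤ b d) (hv : ∀ d ∈ D, d < j → b (d + 1) ≤ v) :
    ∑ d ∈ D, (if i ≤ d ∧ d < j then 1 else 0) * (b (d + 1) - b d) ^ 2 ≤ (v - u) ^ 2 := by
  have hg : ∀ d, 0 ≤ b (d + 1) - b d := fun d => sub_nonneg.2 (hb d.le_succ)
  have e : ∑ d ∈ D, (if i ≤ d ∧ d < j then 1 else 0) * (b (d + 1) - b d) ^ 2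
      = ∑ d ∈ D with i ≤ d ∧ d < j, (b (d + 1) - b d) ^ 2 := by
    rw [Finset.sum_filter]
    refine Finset.sum_congr rfl fun d _ => by split_ifs <;> simp
  rw [e]
  set F := D.filter fun d => i ≤ d ∧ d < j with hF
  rcases F.eq_empty_or_nonempty with h | h
  · rw [h]; simpa using sq_nonneg _
  · have m1 := Finset.mem_filter.1 (F.min'_mem h)
    have m2 := Finset.mem_filter.1 (F.max'_mem h)
    have hle : F.min' h ≤ F.max' h := F.min'_le_max' h
    have hsub : F ⊆ Finset.Ico (F.min' h) (F.max' h + 1) := fun d hd =>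
      Finset.mem_Ico.2 ⟨F.min'_le d hd, Nat.lt_succ_of_le (F.le_max' d hd)⟩
    have h1 : ∑ d ∈ F, (b (d + 1) - b d) ≤ v - u :=
      calc ∑ d ∈ F, (b (d + 1) - b d)
          ≤ ∑ d ∈ Finset.Ico (F.min' h) (F.max' h + 1), (b (d + 1) - b d) :=
            Finset.sum_le_sum_of_subset_of_nonneg hsub fun d _ _ => hg d
        _ = b (F.max' h + 1) - b (F.min' h) := Finset.sum_Ico_sub b (by omega)
        _ ≤ v - u := sub_le_sub (hv _ m2.1 m2.2.2) (hu _ m1.1 m1.2.1)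
    exact (Finset.sum_sq_le_sq_sum_of_nonneg fun d _ => hg d).trans
      (pow_le_pow_left₀ (Finset.sum_nonneg fun d _ => hg d) h1 2)

/-- In the Laplacian form each pair `(i, j)` pays for the squared gaps of all cuts of `D` between
`i` and `j`. After exchanging sums, each cut collects its crossing weight; counting both orders of a
pair cancels the factor `1/2`. -/
theorem half_gap_sq_le_energy_drop {N : ℕ} {ζ : ℝ} (hζ : 0 ≤ ζ) {M : Matrix (Fin N) (Fin N) ℝ}
    (hM : IsFloorStochastic ζ M) {b : ℕ → ℝ} (hb : Monotone b) (y : Fin N → ℝ) (D : Finset ℕ)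
    (hlo : ∀ d ∈ D, ∀ i : Fin N, i.val ≤ d → y i ≤ b d)
    (hhi : ∀ d ∈ D, ∀ i : Fin N, d < i.val → b (d + 1) ≤ y i)
    (hD : ∀ d ∈ D, Crosses M d) :
    ζ / 2 * ∑ d ∈ D, (b (d + 1) - b d) ^ 2 ≤ ∑ i, y i ^ 2 - ∑ i, (M.mulVec y i) ^ 2 := by
  have h0 := (mem_doublyStochastic_iff_sum.1 hM.mem).1
  have hw : ∀ i j, 0 ≤ ∑ k, M k i * M k j := fun i j =>
    Finset.sum_nonneg fun k _ => mul_nonneg (h0 _ _) (h0 _ _)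
  have hwc : ∀ i j, ∑ k, M k i * M k j = ∑ k, M k j * M k i := fun i j =>
    Finset.sum_congr rfl fun k _ => mul_comm _ _
  have pair : ∀ i j : Fin N,
      ∑ d ∈ D, ((if i.val ≤ d ∧ d < j.val then 1 else 0) +
        (if j.val ≤ d ∧ d < i.val then 1 else 0)) * (b (d + 1) - b d) ^ 2
      ≤ (y j - y i) ^ 2 := by
    intro i j
    rcases le_total i.val j.val with h | h
    · refine le_trans (le_of_eq ?_) (sum_gap_sq_le hb D (i := i.val) (j := j.val)
        (fun d hd hi => hlo d hd i hi) (fun d hd hj => hhi d hd j hj))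
      refine Finset.sum_congr rfl fun d _ => ?_
      rw [if_neg (c := j.val ≤ d ∧ d < i.val) (by omega), add_zero]
    · rw [← neg_sq, neg_sub]
      refine le_trans (le_of_eq ?_) (sum_gap_sq_le hb D (i := j.val) (j := i.val)
        (fun d hd hi => hlo d hd j hi) (fun d hd hj => hhi d hd i hj))
      refine Finset.sum_congr rfl fun d _ => ?_
      rw [if_neg (c := i.val ≤ d ∧ d < j.val) (by omega), zero_add]
  rw [sq_sum_sub_sq_mulVec hM.mem]
  calc ζ / 2 * ∑ d ∈ D, (b (d + 1) - b d) ^ 2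
      ≤ ∑ d ∈ D, (∑ i, ∑ j, (∑ k, M k i * M k j) * (if i.val ≤ d ∧ d < j.val then 1 else 0)) *
          (b (d + 1) - b d) ^ 2 := by
        rw [Finset.mul_sum]
        exact Finset.sum_le_sum fun d hd =>
          mul_le_mul_of_nonneg_right ((hD d hd).half_le hζ hM) (sq_nonneg _)
    _ = 1 / 2 * ∑ d ∈ D, (∑ i, ∑ j, (∑ k, M k i * M k j) *
          ((if i.val ≤ d ∧ d < j.val then 1 else 0) +
            (if j.val ≤ d ∧ d < i.val then 1 else 0))) * (b (d + 1) - b d) ^ 2 := by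
        rw [Finset.mul_sum]
        refine Finset.sum_congr rfl fun d _ => ?_
        have : ∑ i, ∑ j, (∑ k, M k i * M k j) *
            (if (j : Fin N).val ≤ d ∧ d < (i : Fin N).val then (1 : ℝ) else 0)
            = ∑ i, ∑ j, (∑ k, M k i * M k j) *
              (if (i : Fin N).val ≤ d ∧ d < (j : Fin N).val then (1 : ℝ) else 0) := by
          rw [Finset.sum_comm]
          exact Finset.sum_congr rfl fun i _ => Finset.sum_congr rfl fun j _ => by rw [hwc]
        simp only [mul_add, Finset.sum_add_distrib, this]
        ring
    _ = 1 / 2 * ∑ i, ∑ j, (∑ k, M k i * M k j) *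
          ∑ d ∈ D, ((if i.val ≤ d ∧ d < j.val then 1 else 0) +
            (if j.val ≤ d ∧ d < i.val then 1 else 0)) * (b (d + 1) - b d) ^ 2 := by
        congr 1
        simp only [Finset.sum_mul]
        rw [Finset.sum_comm]
        refine Finset.sum_congr rfl fun i _ => ?_
        rw [Finset.sum_comm]
        refine Finset.sum_congr rfl fun j _ => ?_
        rw [← Finset.sum_mul, Finset.mul_sum]
        exact Finset.sum_congr rfl fun d _ => by
          rw [← mul_assoc, Finset.sum_mul, Finset.sum_mul]
    _ ≤ 1 / 2 * ∑ i, ∑ j, (∑ k, M k i * M k j) * (y j - y i) ^ 2 := by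
        gcongr with i _ j _
        · exact hw i j
        · exact pair i j

/-- As long as no entry joins the two sides of the cut, each side averages only its own values, so
its extremes cannot move past their initial bounds. -/
theorem bounds_of_not_crosses {N : ℕ} {ζ : ℝ} {W : ℕ → Matrix (Fin N) (Fin N) ℝ}
    (hW : ∀ s, IsFloorStochastic ζ (W s)) {Y : ℕ → Fin N → ℝ}
    (hY : ∀ s, Y (s + 1) = (W s).mulVec (Y s)) {d : ℕ} {p q : ℝ}
    (hp : ∀ i : Fin N, i.val ≤ d → Y 0 i ≤ p) (hq : ∀ i : Fin N, d < i.val → q ≤ Y 0 i)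
    (t : ℕ) (hnc : ∀ s < t, ¬ Crosses (W s) d) :
    (∀ i : Fin N, i.val ≤ d → Y t i ≤ p) ∧ (∀ i : Fin N, d < i.val → q ≤ Y t i) := by
  induction t with
  | zero => exact ⟨hp, hq⟩
  | succ t ih =>
    obtain ⟨ih1, ih2⟩ := ih fun s hs => hnc s (hs.trans t.lt_succ_self)
    obtain ⟨h0, h1, -⟩ := mem_doublyStochastic_iff_sum.1 (hW t).mem
    have hn := hnc t t.lt_succ_self
    simp only [Crosses, not_exists, not_and, not_or, not_not] at hn
    rw [hY]
    constructor
    · intro i hi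
      calc (W t).mulVec (Y t) i = ∑ j, W t i j * Y t j := rfl
        _ ≤ ∑ j, W t i j * p := by
          refine Finset.sum_le_sum fun j _ => ?_
          rcases le_or_gt j.val d with hj | hj
          · exact mul_le_mul_of_nonneg_left (ih1 j hj) (h0 _ _)
          · rw [(hn i j hi hj).1]; simp
        _ = p := by rw [← Finset.sum_mul, h1, one_mul]
    · intro i hi
      calc q = ∑ j, W t i j * q := by rw [← Finset.sum_mul, h1, one_mul]
        _ ≤ ∑ j, W t i j * Y t j := by
          refine Finset.sum_le_sum fun j _ => ?_
          rcases le_or_gt j.val d with hj | hj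
          · rw [(hn j i hj hi).2]; simp
          · exact mul_le_mul_of_nonneg_left (ih2 j hj) (h0 _ _)
        _ = _ := rfl

/-- Each cut is charged to the first time at which it is crossed. Until then its initial gap still
separates the two sides, so the energy drop at that time pays for the squared gap. Summing over
times covers every cut once, and the squared gaps control the whole energy up to `N²`. -/
theorem energy_window_of_monotone {N : ℕ} {ζ : ℝ} (hζ : 0 ≤ ζ)
    {W : ℕ → Matrix (Fin N) (Fin N) ℝ}
    (hW : ∀ s, IsFloorStochastic ζ (W s)) {Y : ℕ → Fin N → ℝ}
    (hY : ∀ s, Y (s + 1) = (W s).mulVec (Y s)) (hmono : Monotone (Y 0)) (hsum : ∑ i, Y 0 i = 0)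
    {B : ℕ} (hcross : ∀ d, d + 1 < N → ∃ s < B, Crosses (W s) d) :
    ∑ i, Y B i ^ 2 ≤ (1 - ζ / (2 * (N : ℝ) ^ 2)) * ∑ i, Y 0 i ^ 2 := by
  classical
  rcases Nat.eq_zero_or_pos N with rfl | hN
  · simp
  have hN' : (0 : ℝ) < N := by exact_mod_cast hN
  -- The sorted values, continued as a constant beyond the last index so that `b` is monotone on all
  -- of `ℕ`.
  set b : ℕ → ℝ := fun k => Y 0 ⟨min k (N - 1), by omega⟩ with hbdef
  have hb : Monotone b := fun k l hkl => hmono (by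
    rw [Fin.mk_le_mk]; exact min_le_min_right _ hkl)
  have hbi : ∀ i : Fin N, b i.val = Y 0 i := fun i => by
    simp only [hbdef]; congr 1; ext; simp; omega
  have hfirst : ∀ d, d + 1 < N →
      ∃ s, s < B ∧ Crosses (W s) d ∧ ∀ s' < s, ¬ Crosses (W s') d := by
    intro d hd
    have hex : ∃ s, Crosses (W s) d := (hcross d hd).imp fun s h => h.2
    obtain ⟨s, hs, hsc⟩ := hcross d hd
    exact ⟨Nat.find hex, (Nat.find_min' hex hsc).trans_lt hs, Nat.find_spec hex,
      fun s' h => Nat.find_min hex h⟩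
  have hchoose : ∃ f : ℕ → ℕ, ∀ d, d + 1 < N →
      f d < B ∧ Crosses (W (f d)) d ∧ ∀ s' < f d, ¬ Crosses (W s') d := by
    refine ⟨fun d => if h : d + 1 < N then (hfirst d h).choose else 0, fun d hd => ?_⟩
    simp only [hd, dif_pos]
    exact (hfirst d hd).choose_spec
  obtain ⟨f, hf⟩ := hchoose
  have hmem : ∀ d, d ∈ Finset.range (N - 1) → d + 1 < N := fun d hd => by
    have := Finset.mem_range.1 hd; omega
  have hstep : ∀ s ∈ Finset.range B,
      ζ / 2 * ∑ d ∈ Finset.range (N - 1) with f d = s, (b (d + 1) - b d) ^ 2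
        ≤ ∑ i, Y s i ^ 2 - ∑ i, Y (s + 1) i ^ 2 := by
    intro s _
    rw [hY s]
    have hbd : ∀ d ∈ (Finset.range (N - 1)).filter (fun d => f d = s),
        (∀ i : Fin N, i.val ≤ d → Y s i ≤ b d) ∧
        (∀ i : Fin N, d < i.val → b (d + 1) ≤ Y s i) := by
      intro d hd
      obtain ⟨hd1, rfl⟩ := Finset.mem_filter.1 hd
      refine bounds_of_not_crosses hW hY (fun i hi => ?_) (fun i hi => ?_) _
        (hf d (hmem d hd1)).2.2
      · rw [← hbi]; exact hb hi
      · rw [← hbi]; exact hb hi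
    refine half_gap_sq_le_energy_drop hζ (hW s) hb (Y s) _ (fun d hd => (hbd d hd).1)
      (fun d hd => (hbd d hd).2) fun d hd => ?_
    obtain ⟨hd1, rfl⟩ := Finset.mem_filter.1 hd
    exact (hf d (hmem d hd1)).2.1
  have htotal : ζ / 2 * ∑ d ∈ Finset.range (N - 1), (b (d + 1) - b d) ^ 2
      ≤ ∑ i, Y 0 i ^ 2 - ∑ i, Y B i ^ 2 := by
    have := Finset.sum_le_sum hstep
    rw [← Finset.mul_sum, Finset.sum_fiberwise_of_maps_to
      (fun d hd => Finset.mem_range.2 (hf d (hmem d hd)).1),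
      Finset.sum_range_sub' (fun s => ∑ i, Y s i ^ 2)] at this
    exact this
  have hvar : ∑ i, Y 0 i ^ 2
      ≤ (N : ℝ) ^ 2 * ∑ d ∈ Finset.range (N - 1), (b (d + 1) - b d) ^ 2 := by
    -- The mean is zero, so the energy is already the smallest sum of squares about any centre;
    -- recentring at the minimum only increases it.
    have h1 : ∑ i, Y 0 i ^ 2 ≤ ∑ i, (Y 0 i - b 0) ^ 2 := by
      have : ∑ i, (Y 0 i - b 0) ^ 2 = ∑ i, Y 0 i ^ 2 + N * b 0 ^ 2 := by
        have : ∀ i, (Y 0 i - b 0) ^ 2 = Y 0 i ^ 2 - 2 * b 0 * Y 0 i + b 0 ^ 2 := fun i => by ring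
        simp only [this, Finset.sum_add_distrib, Finset.sum_sub_distrib, ← Finset.mul_sum, hsum]
        simp
      rw [this]; nlinarith [sq_nonneg (b 0)]
    have h2 : ∀ i, (Y 0 i - b 0) ^ 2
        ≤ N * ∑ d ∈ Finset.range (N - 1), (b (d + 1) - b d) ^ 2 := by
      intro i
      have h3 : Y 0 i - b 0 ≤ ∑ d ∈ Finset.range (N - 1), (b (d + 1) - b d) := by
        rw [Finset.sum_range_sub, ← hbi]
        have : b i.val ≤ b (N - 1) := hb (by omega)
        linarith
      have h4 : 0 ≤ Y 0 i - b 0 := by rw [← hbi]; exact sub_nonneg.2 (hb (Nat.zero_le _))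
      refine (pow_le_pow_left₀ h4 h3 2).trans (sq_sum_le_card_mul_sum_sq.trans ?_)
      refine mul_le_mul_of_nonneg_right ?_ (Finset.sum_nonneg fun d _ => sq_nonneg _)
      rw [Finset.card_range]; exact_mod_cast Nat.sub_le _ _
    refine h1.trans ((Finset.sum_le_sum fun i _ => h2 i).trans (le_of_eq ?_))
    simp; ring
  set S := ∑ d ∈ Finset.range (N - 1), (b (d + 1) - b d) ^ 2
  have : ζ / (2 * (N : ℝ) ^ 2) * ∑ i, Y 0 i ^ 2 ≤ ζ / 2 * S := by
    calc ζ / (2 * (N : ℝ) ^ 2) * ∑ i, Y 0 i ^ 2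
        ≤ ζ / (2 * (N : ℝ) ^ 2) * ((N : ℝ) ^ 2 * S) := by gcongr
      _ = ζ / 2 * S := by field_simp
  linarith

/-- Relabelling the units by increasing initial value reduces this to the monotone case. -/
theorem energy_window {N : ℕ} {ζ : ℝ} (hζ : 0 ≤ ζ)
    {W : ℕ → Matrix (Fin N) (Fin N) ℝ}
    (hW : ∀ s, IsFloorStochastic ζ (W s)) {Y : ℕ → Fin N → ℝ}
    (hY : ∀ s, Y (s + 1) = (W s).mulVec (Y s)) (hsum : ∑ i, Y 0 i = 0)
    {B : ℕ} (hconn : ∀ i j, Relation.ReflTransGen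
      (fun v w => ∃ s < B, v ≠ w → W s w v ≠ 0) i j) :
    ∑ i, Y B i ^ 2 ≤ (1 - ζ / (2 * (N : ℝ) ^ 2)) * ∑ i, Y 0 i ^ 2 := by
  set σ := Tuple.sort (Y 0)
  have hYs : ∀ s, ∑ i, Y s (σ i) ^ 2 = ∑ i, Y s i ^ 2 := fun s =>
    Equiv.sum_comp σ (fun i => Y s i ^ 2)
  have main := energy_window_of_monotone hζ (W := fun s => (W s).submatrix σ σ)
    (fun s => (hW s).submatrix σ) (Y := fun s i => Y s (σ i)) (fun s => ?_)
    (Tuple.monotone_sort (Y 0)) ((Equiv.sum_comp σ (Y 0)).trans hsum) (B := B) ?_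
  · simpa only [hYs] using main
  · ext i
    simp only [hY s, Matrix.mulVec, dotProduct, Matrix.submatrix_apply]
    exact (Equiv.sum_comp σ (fun j => W s (σ i) j * Y s j)).symm
  · intro d hd
    by_contra hno
    -- An uncrossed cut would trap every walk that starts at the unit of smallest value,
    -- contradicting connectivity.
    have hinv : ∀ j, Relation.ReflTransGen (fun v w => ∃ s < B, v ≠ w → W s w v ≠ 0)
        (σ ⟨0, by omega⟩) j → (σ.symm j).val ≤ d := by
      intro j hj
      induction hj with
      | refl => simp
      | @tail v w _ hvw ih =>
        by_contra hw
        obtain ⟨s, hs, hs'⟩ := hvw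
        refine hno ⟨s, hs, σ.symm v, σ.symm w, ih, not_le.1 hw, Or.inr ?_⟩
        simpa using hs' (by rintro rfl; exact hw ih)
    have := hinv _ (hconn _ (σ ⟨d + 1, hd⟩))
    simp at this

theorem sum_mulVec_of_mem_doublyStochastic {N : ℕ} {M : Matrix (Fin N) (Fin N) ℝ}
    (hM : M ∈ doublyStochastic ℝ (Fin N)) (y : Fin N → ℝ) :
    ∑ i, M.mulVec y i = ∑ i, y i := by
  simp only [Matrix.mulVec, dotProduct]
  rw [Finset.sum_comm]
  refine Finset.sum_congr rfl fun j _ => ?_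
  rw [← Finset.sum_mul, sum_col_of_mem_doublyStochastic hM, one_mul]

/-- Contraction is available only on the aligned windows. Fewer than `B` steps are lost in reaching
the first one, so at least `L / B - 1` complete windows fit in `L` steps. -/
theorem decay_of_windows {B : ℕ} (hB : 1 ≤ B) {q : ℕ → ℝ} {ρ : ℝ} (hρ : 0 ≤ ρ) {s : ℕ}
    (hs : 1 ≤ s) (hanti : ∀ t, s ≤ t → q (t + 1) ≤ q t)
    (hwin : ∀ k, s ≤ k * B + 1 → q ((k + 1) * B + 1) ≤ ρ * q (k * B + 1)) (L : ℕ) :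
    q (s + L) ≤ ρ ^ (L / B - 1) * q s := by
  have hmono : ∀ t m, s ≤ t → q (t + m) ≤ q t := by
    intro t m ht
    induction m with
    | zero => exact le_rfl
    | succ m ih => exact (hanti (t + m) (by omega)).trans ih
  -- This is `(s - 1) / B` rounded up: the first window that starts, at time `k * B + 1`, no earlier
  -- than `s`.
  set k := (s - 1 + (B - 1)) / B with hk
  have hk1 : s ≤ k * B + 1 := by
    have := Nat.lt_div_mul_add (a := s - 1 + (B - 1)) (b := B) hB
    rw [← hk] at this
    omega
  have hk2 : k * B ≤ s - 1 + (B - 1) := Nat.div_mul_le_self _ _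
  have hpow : ∀ w, q ((k + w) * B + 1) ≤ ρ ^ w * q s := by
    intro w
    induction w with
    | zero =>
      have := hmono s (k * B + 1 - s) le_rfl
      rw [show s + (k * B + 1 - s) = k * B + 1 by omega] at this
      simpa using this
    | succ w ih =>
      have h1 : k * B ≤ (k + w) * B := Nat.mul_le_mul_right _ (by omega)
      refine (hwin (k + w) (by omega)).trans ?_
      rw [pow_succ', mul_assoc]
      exact mul_le_mul_of_nonneg_left ih hρ
  rcases Nat.eq_zero_or_pos (L / B) with h0 | h0
  · rw [h0]; simpa using hmono s L le_rfl
  · have hL : (L / B) * B ≤ L := Nat.div_mul_le_self _ _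
    have h2 : (k + (L / B - 1)) * B + 1 ≤ s + L := by
      obtain ⟨m, hm⟩ : ∃ m, L / B = m + 1 := ⟨L / B - 1, by omega⟩
      rw [hm] at hL ⊢
      simp only [Nat.add_sub_cancel]
      have e1 : (k + m) * B = k * B + m * B := by ring
      have e2 : (m + 1) * B = m * B + B := by ring
      omega
    have h3 : s ≤ (k + (L / B - 1)) * B + 1 := by
      have : k * B ≤ (k + (L / B - 1)) * B := Nat.mul_le_mul_right _ (by omega)
      omega
    have := hmono _ (s + L - ((k + (L / B - 1)) * B + 1)) h3
    rw [Nat.add_sub_cancel' h2] at this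
    exact this.trans (hpow _)

/-- The product `A(s + L - 1) ⋯ A(s)` of weight matrices. -/
def transition {N : ℕ} (A : ℕ → Matrix (Fin N) (Fin N) ℝ) (s : ℕ) : ℕ → Matrix (Fin N) (Fin N) ℝ
  | 0 => 1
  | L + 1 => A (s + L) * transition A s L

theorem psiConst_bounds {N : ℕ} (hN : 1 ≤ N) {ζ : ℝ} (hζ : 0 < ζ) (hζ1 : ζ ≤ 1) :
    0 < psiConst N ζ ∧ psiConst N ζ < 1 := by
  have : (1 : ℝ) ≤ N := by exact_mod_cast hN
  unfold psiConst
  constructor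
  · have : ζ / (4 * (N : ℝ) ^ 2) < 1 := by
      rw [div_lt_one (by positivity)]; nlinarith
    linarith
  · have : 0 < ζ / (4 * (N : ℝ) ^ 2) := by positivity
    linarith

theorem weight_floor_le_one {N : ℕ} (hN : 1 ≤ N) {ζ : ℝ} {M : Matrix (Fin N) (Fin N) ℝ}
    (hM : IsFloorStochastic ζ M) : ζ ≤ 1 := by
  obtain ⟨h0, h1, -⟩ := mem_doublyStochastic_iff_sum.1 hM.mem
  refine (hM.diag ⟨0, hN⟩).trans ?_
  rw [← h1 ⟨0, hN⟩]
  exact Finset.single_le_sum (fun j _ => h0 _ j) (Finset.mem_univ _)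

/-! ### Mixing rate of products of weight matrices. -/

section Network

variable {N B : ℕ} {ζ : ℝ} {graph : ℕ → Digraph (Fin N)} {A : ℕ → Matrix (Fin N) (Fin N) ℝ}

theorem abs_transition_sub_le (hN : 1 ≤ N) (hB : 1 ≤ B) (hζ : 0 < ζ)
    (hgraph : JointlyConnected graph B) (hA : ∀ t, 1 ≤ t → IsWeightMatrix (graph t) ζ (A t))
    {s : ℕ} (hs : 1 ≤ s) (L : ℕ) (i j : Fin N) :
    |transition A s L i j - 1 / N| ≤ psiConst N ζ ^ (L / B - 1) := by
  have hN' : (1 : ℝ) ≤ N := by exact_mod_cast hN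
  have hF : ∀ t, 1 ≤ t → IsFloorStochastic ζ (A t) := fun t ht => (hA t ht).isFloorStochastic
  have hζ1 := weight_floor_le_one hN (hF 1 le_rfl)
  obtain ⟨hψ0, hψ1⟩ := psiConst_bounds hN hζ hζ1
  -- The `j`-th basis vector minus its mean: the transition matrix maps it to its `j`-th column
  -- minus `1 / N`, so the energy decay bounds each entry.
  set e : Fin N → ℝ := fun k => (if k = j then 1 else 0) - 1 / N with he
  have hrow : ∀ L i, ∑ k, transition A s L i k = 1 := by
    intro L
    induction L with
    | zero => intro i; simp [transition, Matrix.one_apply]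
    | succ L ih =>
      intro i
      simp only [transition, Matrix.mul_apply]
      rw [Finset.sum_comm]
      simp only [← Finset.mul_sum, ih, mul_one]
      exact sum_row_of_mem_doublyStochastic (hF (s + L) (by omega)).mem i
  have hval : ∀ L i, (transition A s L).mulVec e i = transition A s L i j - 1 / N := by
    intro L i
    simp only [Matrix.mulVec, dotProduct, he, mul_sub, Finset.sum_sub_distrib, ← Finset.sum_mul,
      hrow]
    simp
  set Y : ℕ → Fin N → ℝ := fun t => (transition A s (t - s)).mulVec e with hYdef
  have hYs : ∀ t, s ≤ t → Y (t + 1) = (A t).mulVec (Y t) := by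
    intro t ht
    simp only [hYdef]
    rw [show t + 1 - s = (t - s) + 1 by omega, transition, ← Matrix.mulVec_mulVec,
      Nat.add_sub_cancel' ht]
  have hYsum : ∀ t, s ≤ t → ∑ i, Y t i = 0 := by
    intro t ht
    induction t, ht using Nat.le_induction with
    | base =>
      simp only [hYdef, Nat.sub_self, transition, Matrix.one_mulVec, he, Finset.sum_sub_distrib]
      simp; field_simp; simp
    | succ t ht ih =>
      rw [hYs t ht, sum_mulVec_of_mem_doublyStochastic (hF t (hs.trans ht)).mem, ih]
  have hdecay := decay_of_windows hB (q := fun t => ∑ i, Y t i ^ 2) (ρ := psiConst N ζ ^ 2)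
    (by positivity) hs (fun t ht => ?_) (fun k hk => ?_) L
  · have hbase : ∑ i, Y s i ^ 2 ≤ 1 := by
      simp only [hYdef, Nat.sub_self, transition, Matrix.one_mulVec, he]
      have : ∀ k : Fin N, ((if k = j then (1 : ℝ) else 0) - 1 / N) ^ 2
          = (if k = j then 1 else 0) * (1 - 2 / N) + 1 / N ^ 2 := by
        intro k; split_ifs <;> ring
      simp only [this, Finset.sum_add_distrib, ← Finset.sum_mul]
      simp
      field_simp
      linarith
    have h1 : (transition A s L i j - 1 / N) ^ 2 ≤ (psiConst N ζ ^ (L / B - 1)) ^ 2 := by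
      have h2 : (transition A s L i j - 1 / N) = Y (s + L) i := by
        simp only [hYdef, Nat.add_sub_cancel_left]; rw [hval]
      rw [h2]
      refine (Finset.single_le_sum (f := fun i => Y (s + L) i ^ 2) (fun i _ => sq_nonneg _)
        (Finset.mem_univ i)).trans (hdecay.trans ?_)
      rw [← pow_mul, ← pow_mul, mul_comm 2]
      exact mul_le_of_le_one_right (by positivity) hbase
    exact abs_le_of_sq_le_sq h1 (by positivity)
  · have := sq_sum_sub_sq_mulVec (hF t (hs.trans ht)).mem (Y t)
    have h0 := (mem_doublyStochastic_iff_sum.1 (hF t (hs.trans ht)).mem).1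
    simp only [hYs t ht]
    rw [← sub_nonneg, this]
    refine mul_nonneg (by norm_num) (Finset.sum_nonneg fun i _ => Finset.sum_nonneg fun k _ =>
      mul_nonneg (Finset.sum_nonneg fun l _ => mul_nonneg (h0 _ _) (h0 _ _)) (sq_nonneg _))
  · have hwin := energy_window hζ.le (W := fun m => A (k * B + 1 + m))
      (fun m => hF _ (by omega)) (Y := fun m => Y (k * B + 1 + m))
      (fun m => hYs _ (hk.trans (Nat.le_add_right _ _))) (hYsum _ (by omega)) (B := B) ?_
    · have e1 : (k + 1) * B + 1 = k * B + 1 + B := by ring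
      simp only [e1]
      -- The definition of `ψ` enters here: `1 - ζ/(2N²) ≤ (1 - ζ/(4N²))² = ψ²`, so the norm
      -- contracts by `ψ` per window.
      refine hwin.trans (mul_le_mul_of_nonneg_right ?_ (Finset.sum_nonneg fun i _ => sq_nonneg _))
      unfold psiConst
      have : ζ / (2 * (N : ℝ) ^ 2) = 2 * (ζ / (4 * (N : ℝ) ^ 2)) := by ring
      rw [this]
      nlinarith [sq_nonneg (ζ / (4 * (N : ℝ) ^ 2))]
    · intro v w
      refine Relation.ReflTransGen.mono ?_ _ _ (hgraph k v w)
      rintro v w ⟨t, ht, hadj⟩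
      obtain ⟨ht1, ht2⟩ := Finset.mem_Icc.1 ht
      have e1 : (k + 1) * B = k * B + B := by ring
      refine ⟨t - (k * B + 1), by omega, fun hne => ?_⟩
      rw [Nat.add_sub_cancel' ht1]
      have := (hA t (by omega)).edge w v hne.symm hadj
      linarith

/-- The summed decay rate of the network. -/
def mixingConst (N B : ℕ) (ζ : ℝ) : ℝ :=
  1 / (psiConst N ζ ^ 2 * (1 - psiConst N ζ ^ (1 / (B : ℝ))))

theorem sum_psi_pow_le (hB : 1 ≤ B) (hψ0 : 0 < psiConst N ζ) (hψ1 : psiConst N ζ < 1) (n : ℕ) :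
    ∑ L ∈ Finset.range n, psiConst N ζ ^ (L / B - 1) ≤ mixingConst N B ζ := by
  set ψ := psiConst N ζ
  set r := ψ ^ (1 / (B : ℝ)) with hr
  have hB' : (0 : ℝ) < B := by exact_mod_cast hB
  have hr0 : 0 < r := Real.rpow_pos_of_pos hψ0 _
  have hr1 : r < 1 := Real.rpow_lt_one hψ0.le hψ1 (by positivity)
  have hrB : r ^ B = ψ := by
    rw [hr, ← Real.rpow_natCast, ← Real.rpow_mul hψ0.le]
    field_simp
    simp
  -- With `r ^ B = ψ`, the floor and the lost window together cost at most two factors of `ψ`,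
  -- leaving a geometric series in `r`.
  have hterm : ∀ L, ψ ^ (L / B - 1) ≤ (ψ ^ 2)⁻¹ * r ^ L := by
    intro L
    have h1 : r ^ ((L / B + 1) * B) ≤ r ^ L :=
      pow_le_pow_of_le_one hr0.le hr1.le (by
        have := Nat.lt_div_mul_add (a := L) (b := B) hB
        have e : (L / B + 1) * B = L / B * B + B := by ring
        omega)
    rw [mul_comm, pow_mul, hrB] at h1
    rw [inv_mul_eq_div, le_div_iff₀ (by positivity), ← pow_add]
    exact (pow_le_pow_of_le_one hψ0.le hψ1.le (by omega)).trans h1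
  calc ∑ L ∈ Finset.range n, ψ ^ (L / B - 1)
      ≤ ∑ L ∈ Finset.range n, (ψ ^ 2)⁻¹ * r ^ L := Finset.sum_le_sum fun L _ => hterm L
    _ = (ψ ^ 2)⁻¹ * ∑ L ∈ Finset.range n, r ^ L := by rw [Finset.mul_sum]
    _ ≤ (ψ ^ 2)⁻¹ * (1 - r)⁻¹ := by
        gcongr
        rw [← tsum_geometric_of_lt_one hr0.le hr1]
        exact (summable_geometric_of_lt_one hr0.le hr1).sum_le_tsum _ fun _ _ => by positivity
    _ = mixingConst N B ζ := by simp only [mixingConst]; rw [one_div, mul_inv]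

/-- The extra factor `ψ ^ (1 / B) ≤ 1` in the denominator of `hatC`, its larger coefficient `6N²`
and its additive term all leave slack. The factor `4N` is what the disagreement estimate produces.
-/
theorem four_mul_mixingConst_le_hatC (hN : 1 ≤ N) (hB : 1 ≤ B) (hψ0 : 0 < psiConst N ζ)
    (hψ1 : psiConst N ζ < 1) :
    0 ≤ mixingConst N B ζ ∧ 4 * N * mixingConst N B ζ ≤ hatC N B ζ := by
  have hN' : (1 : ℝ) ≤ N := by exact_mod_cast hN
  have hB' : (0 : ℝ) < B := by exact_mod_cast hB
  unfold mixingConst hatC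
  set ψ := psiConst N ζ
  have hr0 : 0 < ψ ^ (1 / (B : ℝ)) := Real.rpow_pos_of_pos hψ0 _
  have hr1 : ψ ^ (1 / (B : ℝ)) < 1 := Real.rpow_lt_one hψ0.le hψ1 (by positivity)
  rw [Real.rpow_add hψ0, Real.rpow_two]
  set r := ψ ^ (1 / (B : ℝ))
  have h1r : 0 < 1 - r := by linarith
  have hK : 0 < 1 / (ψ ^ 2 * (1 - r)) := by positivity
  refine ⟨hK.le, ?_⟩
  have hle : 1 / (ψ ^ 2 * (1 - r)) ≤ 1 / (ψ ^ 2 * r * (1 - r)) := by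
    apply one_div_le_one_div_of_le (by positivity)
    have : 0 < ψ ^ 2 * (1 - r) := by positivity
    nlinarith
  have e : 3 * (N : ℝ) / (ψ ^ 2 * r * (1 - r)) = 3 * N * (1 / (ψ ^ 2 * r * (1 - r))) := by
    rw [mul_one_div]
  rw [e]
  set K' := 1 / (ψ ^ 2 * r * (1 - r))
  have : 4 * (N : ℝ) * (1 / (ψ ^ 2 * (1 - r))) ≤ 4 * N * K' := by gcongr
  have hK' : 0 ≤ K' := hK.le.trans hle
  have hN0 : (0 : ℝ) ≤ N := by linarith
  have hN1 : (0 : ℝ) ≤ N - 1 := by linarith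
  nlinarith [mul_nonneg hN1 hK', mul_nonneg hN0 (mul_nonneg hN1 hK'), mul_nonneg hN0 hK']

end Network

/-! ### The divergence theorem on the unit ball -/

section Divergence

open Metric Filter Topology

variable {E : Type*} [NormedAddCommGroup E] [InnerProductSpace ℝ E] [FiniteDimensional ℝ E]
  [MeasurableSpace E] [BorelSpace E] [Nontrivial E] (μ : Measure E) [μ.IsAddHaarMeasure]

/-- Polar coordinates: the origin is null, and the measure on its complement factors as surface
measure times `r ^ (dim - 1) dr`. -/
theorem integral_eq_integral_Ioi_toSphere {g : E → ℝ} (hg : Integrable g μ) :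
    ∫ v, g v ∂μ = ∫ r in Set.Ioi (0 : ℝ), r ^ (Module.finrank ℝ E - 1) *
      ∫ s : sphere (0 : E) 1, g (r • (s : E)) ∂μ.toSphere := by
  have mp := μ.measurePreserving_homeomorphUnitSphereProd
  have emb := (homeomorphUnitSphereProd E).measurableEmbedding
  set G : sphere (0 : E) 1 × Set.Ioi (0 : ℝ) → ℝ := fun p => g ((p.2 : ℝ) • (p.1 : E)) with hG
  have hcomp : ∀ v : ({0}ᶜ : Set E), G (homeomorphUnitSphereProd E v) = g v := by
    intro v
    have : ((homeomorphUnitSphereProd E).symm (homeomorphUnitSphereProd E v) : E) = v := by simp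
    rw [homeomorphUnitSphereProd_symm_apply_coe] at this
    simp only [hG, this]
  have hGint : Integrable G (μ.toSphere.prod (.volumeIoiPow (Module.finrank ℝ E - 1))) := by
    rw [← mp.integrable_comp_emb emb]
    have : (G ∘ homeomorphUnitSphereProd E) = g ∘ (Subtype.val : ({0}ᶜ : Set E) → E) :=
      funext hcomp
    rw [this]
    have hs : MeasurableEmbedding (Subtype.val : ({0}ᶜ : Set E) → E) :=
      .subtype_coe (measurableSet_singleton _).compl
    rw [← hs.integrable_map_iff, hs.map_comap]
    exact hg.mono_measure Measure.restrict_le_self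
  calc ∫ v, g v ∂μ = ∫ v : ({(0)}ᶜ : Set E), g v.1 ∂(μ.comap (↑)) := by
        rw [integral_subtype_comap (measurableSet_singleton _).compl g,
          restrict_compl_singleton]
    _ = ∫ p, G p ∂(μ.toSphere.prod (.volumeIoiPow (Module.finrank ℝ E - 1))) := by
        rw [← mp.integral_comp emb]
        exact integral_congr_ae (.of_forall fun v => (hcomp v).symm)
    _ = ∫ r, ∫ s, G (s, r) ∂μ.toSphere ∂(.volumeIoiPow (Module.finrank ℝ E - 1)) :=
        integral_prod_symm _ hGint
    _ = _ := by
        simp only [Measure.volumeIoiPow, ENNReal.ofReal]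
        rw [integral_withDensity_eq_integral_smul,
          integral_subtype_comap measurableSet_Ioi fun a : ℝ =>
            Real.toNNReal (a ^ (Module.finrank ℝ E - 1)) •
              ∫ s : sphere (0 : E) 1, g (a • (s : E)) ∂μ.toSphere,
          setIntegral_congr_fun measurableSet_Ioi fun x hx => ?_]
        · simp only [NNReal.smul_def, smul_eq_mul]
          rw [Real.coe_toNNReal _ (pow_nonneg hx.out.le _)]
        · exact (measurable_subtype_coe.pow_const _).real_toNNReal

/-- A radial cutoff: `1` for `r ≤ 1 - 1 / n`, `0` for `r ≥ 1`, affine in between. -/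
def cutoff (n : ℝ) (r : ℝ) : ℝ := max 0 (min 1 (n * (1 - r)))

theorem cutoff_nonneg (n r : ℝ) : 0 ≤ cutoff n r := le_max_left _ _

theorem cutoff_le_one (n r : ℝ) : cutoff n r ≤ 1 := max_le zero_le_one (min_le_left _ _)

theorem cutoff_of_one_le {n r : ℝ} (hn : 0 ≤ n) (hr : 1 ≤ r) : cutoff n r = 0 := by
  apply max_eq_left
  exact (min_le_right _ _).trans (mul_nonpos_of_nonneg_of_nonpos hn (by linarith))

theorem cutoff_of_le {n r : ℝ} (hr : 1 ≤ n * (1 - r)) : cutoff n r = 1 := by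
  rw [cutoff, min_eq_left hr, max_eq_right zero_le_one]

theorem cutoff_of_mem {n r : ℝ} (h0 : 0 ≤ n * (1 - r)) (h1 : n * (1 - r) ≤ 1) :
    cutoff n r = n * (1 - r) := by
  rw [cutoff, min_eq_right h1, max_eq_right h0]

theorem lipschitzWith_cutoff_norm {F : Type*} [NormedAddCommGroup F] (n : NNReal) :
    LipschitzWith n fun v : F => cutoff n ‖v‖ := by
  refine LipschitzWith.of_dist_le_mul fun v w => ?_
  have h1 : |cutoff n ‖v‖ - cutoff n ‖w‖| ≤ |n * (1 - ‖v‖) - n * (1 - ‖w‖)| := by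
    unfold cutoff
    refine (abs_max_sub_max_le_max _ _ _ _).trans ?_
    rw [sub_self, abs_zero, max_eq_right (abs_nonneg _)]
    refine (abs_min_sub_min_le_max _ _ _ _).trans ?_
    rw [sub_self, abs_zero, max_eq_right (abs_nonneg _)]
  rw [Real.dist_eq, dist_eq_norm]
  refine h1.trans ?_
  rw [show (n : ℝ) * (1 - ‖v‖) - n * (1 - ‖w‖) = n * (‖w‖ - ‖v‖) by ring, abs_mul,
    abs_of_nonneg n.coe_nonneg, norm_sub_rev]
  exact mul_le_mul_of_nonneg_left (abs_norm_sub_norm_le _ _) n.coe_nonneg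

theorem hasCompactSupport_cutoff_norm {F : Type*} [NormedAddCommGroup F] [ProperSpace F]
    {n : ℝ} (hn : 0 ≤ n) : HasCompactSupport fun v : F => cutoff n ‖v‖ := by
  refine HasCompactSupport.of_support_subset_isCompact (isCompact_closedBall (0 : F) 1) ?_
  intro v hv
  by_contra h
  rw [mem_closedBall_zero_iff, not_le] at h
  exact hv (cutoff_of_one_le hn h.le)

theorem hasLineDerivAt_norm {F : Type*} [NormedAddCommGroup F] [InnerProductSpace ℝ F]
    {v : F} (hv : v ≠ 0) (w : F) :
    HasLineDerivAt ℝ (fun v : F => ‖v‖) (inner ℝ v w / ‖v‖) v w := by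
  have h1 : HasDerivAt (fun t : ℝ => v + t • w) w 0 := by
    simpa using ((hasDerivAt_id (0 : ℝ)).smul_const w).const_add v
  have h2 := (h1.norm_sq).sqrt (by simpa using hv)
  simp only [Real.sqrt_sq (norm_nonneg _), zero_smul, add_zero] at h2
  rw [mul_div_mul_left _ _ two_ne_zero] at h2
  exact h2

theorem lineDeriv_cutoff_norm {F : Type*} [NormedAddCommGroup F] [InnerProductSpace ℝ F]
    {n : ℝ} (hn : 0 < n) {v : F} (hv : v ≠ 0) (h1 : ‖v‖ ≠ 1) (h2 : ‖v‖ ≠ 1 - 1 / n) (w : F) :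
    lineDeriv ℝ (fun v : F => cutoff n ‖v‖) v w
      = if 1 - 1 / n < ‖v‖ ∧ ‖v‖ < 1 then -n * (inner ℝ v w / ‖v‖) else 0 := by
  have hequiv : ∀ r : ℝ, 1 ≤ n * (1 - r) ↔ r ≤ 1 - 1 / n := fun r => by
    rw [← div_le_iff₀' hn]; constructor <;> intro h <;> linarith
  have hcont : Tendsto (fun v : F => ‖v‖) (𝓝 v) (𝓝 ‖v‖) := continuous_norm.continuousAt
  rcases lt_or_gt_of_ne h1 with hlt | hgt
  · rcases lt_or_gt_of_ne h2 with hlt' | hgt'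
    · rw [if_neg (fun h => absurd h.1 (not_lt.2 hlt'.le))]
      have : (fun v : F => cutoff n ‖v‖) =ᶠ[𝓝 v] fun _ => (1 : ℝ) := by
        filter_upwards [hcont.eventually (gt_mem_nhds hlt')] with u hu
        exact cutoff_of_le ((hequiv _).2 hu.le)
      rw [this.lineDeriv_eq]; simp [lineDeriv]
    · rw [if_pos ⟨hgt', hlt⟩]
      have : (fun v : F => cutoff n ‖v‖) =ᶠ[𝓝 v] fun v => n * (1 - ‖v‖) := by
        filter_upwards [hcont.eventually (gt_mem_nhds hlt), hcont.eventually (lt_mem_nhds hgt')]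
          with u hu hu'
        exact cutoff_of_mem (mul_nonneg hn.le (by linarith))
          (le_of_not_ge fun h => absurd ((hequiv _).1 h) (not_le.2 hu'))
      rw [this.lineDeriv_eq]
      have h3 := hasLineDerivAt_norm hv w
      unfold HasLineDerivAt at h3
      have h4 : HasLineDerivAt ℝ (fun v : F => n * (1 - ‖v‖)) (n * -(inner ℝ v w / ‖v‖)) v w :=
        (h3.const_sub 1).const_mul n
      rw [h4.lineDeriv]; ring
  · rw [if_neg (fun h => absurd h.2 (not_lt.2 hgt.le))]
    have : (fun v : F => cutoff n ‖v‖) =ᶠ[𝓝 v] fun _ => (0 : ℝ) := by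
      filter_upwards [hcont.eventually (lt_mem_nhds hgt)] with u hu
      exact cutoff_of_one_le hn.le (le_of_lt hu)
    rw [this.lineDeriv_eq]; simp [lineDeriv]

theorem tendsto_cutoff (r : ℝ) :
    Tendsto (fun n : ℕ => cutoff (n + 1) r) atTop (𝓝 (if r < 1 then 1 else 0)) := by
  split_ifs with h
  · refine tendsto_const_nhds.congr' ?_
    obtain ⟨m, hm⟩ := exists_nat_gt (1 / (1 - r))
    filter_upwards [eventually_ge_atTop m] with n hn
    refine (cutoff_of_le ?_).symm
    have h1 : 0 < 1 - r := by linarith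
    rw [← div_le_iff₀ h1]
    have : (m : ℝ) ≤ n := by exact_mod_cast hn
    linarith
  · refine tendsto_const_nhds.congr fun n => ?_
    exact (cutoff_of_one_le (by positivity) (not_lt.1 h)).symm

theorem continuous_integral_sphere {F : Type*} [NormedAddCommGroup F] [InnerProductSpace ℝ F]
    [FiniteDimensional ℝ F] [MeasurableSpace F] [BorelSpace F] (ν : Measure (sphere (0 : F) 1))
    [IsFiniteMeasure ν] {h : F → ℝ} (hh : Continuous h) (w : F) :
    Continuous fun r : ℝ => ∫ s : sphere (0 : F) 1, inner ℝ (s : F) w * h (r • (s : F)) ∂ν := by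
  have := continuous_parametric_integral_of_continuous (μ := ν)
    (f := fun (r : ℝ) (s : sphere (0 : F) 1) => inner ℝ (s : F) w * h (r • (s : F)))
    (by unfold Function.uncurry; fun_prop) isCompact_univ
  simpa using this

/-- Integration by parts moves the derivative to the cutoff, whose gradient lives on the thin shell
below radius `1`, is radial and has constant length. Polar coordinates then give an average of
spherical integrals over the shell. -/
theorem integral_lineDeriv_cutoff {K : NNReal} {h : E → ℝ} (hh : LipschitzWith K h) (w : E)
    (n : ℕ) :
    ∫ v, lineDeriv ℝ h v w * cutoff (n + 1) ‖v‖ ∂μ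
      = (n + 1) * ∫ r in (1 - 1 / ((n : ℝ) + 1))..1, r ^ (Module.finrank ℝ E - 1) *
        ∫ s : sphere (0 : E) 1, inner ℝ (s : E) w * h (r • (s : E)) ∂μ.toSphere := by
  set m : ℝ := (n : ℝ) + 1 with hm
  have hmpos : 0 < m := by positivity
  have hm1 : 0 ≤ 1 - 1 / m := by
    rw [sub_nonneg, div_le_one hmpos, hm]; linarith [(Nat.cast_nonneg n : (0 : ℝ) ≤ n)]
  have hm2 : 1 - 1 / m ≤ 1 := by linarith [one_div_pos.2 hmpos]
  have hlip : LipschitzWith ⟨m, hmpos.le⟩ fun v : E => cutoff m ‖v‖ :=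
    lipschitzWith_cutoff_norm ⟨m, hmpos.le⟩
  have hcs := hasCompactSupport_cutoff_norm (F := E) hmpos.le
  rw [hh.integral_lineDeriv_mul_eq hlip hcs w]
  have hzero : ∀ v : E, v ∉ closedBall (0 : E) 1 →
      lineDeriv ℝ (fun v : E => cutoff m ‖v‖) v (-w) = 0 := by
    intro v hv
    rw [mem_closedBall_zero_iff, not_le] at hv
    rw [lineDeriv_cutoff_norm hmpos (by rintro rfl; simp at hv; linarith) hv.ne' (by linarith),
      if_neg fun h => absurd h.2 (not_lt.2 hv.le)]
  have hint : Integrable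
      (fun v => lineDeriv ℝ (fun v : E => cutoff m ‖v‖) v (-w) * h v) μ := by
    have h1 : IntegrableOn
        (fun v => lineDeriv ℝ (fun v : E => cutoff m ‖v‖) v (-w) * h v) (closedBall 0 1) μ := by
      have h2 : IntegrableOn h (closedBall 0 1) μ :=
        hh.continuous.continuousOn.integrableOn_compact (isCompact_closedBall _ _)
      exact h2.bdd_mul (c := m * ‖-w‖)
        (aestronglyMeasurable_lineDeriv hlip.continuous _)
        (.of_forall fun v => norm_lineDeriv_le_of_lipschitz ℝ hlip)
    rwa [integrableOn_iff_integrable_of_support_subset] at h1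
    intro v hv
    by_contra hv'
    exact hv (by simp [hzero v hv'])
  rw [integral_eq_integral_Ioi_toSphere μ hint, intervalIntegral.integral_of_le hm2,
    ← integral_const_mul]
  have hinner : ∀ r : ℝ, 0 < r → r ≠ 1 → r ≠ 1 - 1 / m →
      (∫ s : sphere (0 : E) 1, lineDeriv ℝ (fun v : E => cutoff m ‖v‖) (r • (s : E)) (-w) *
        h (r • (s : E)) ∂μ.toSphere)
      = if 1 - 1 / m < r ∧ r < 1 then
          m * ∫ s : sphere (0 : E) 1, inner ℝ (s : E) w * h (r • (s : E)) ∂μ.toSphere else 0 := by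
    intro r hr h1 h2
    have hnorm : ∀ s : sphere (0 : E) 1, ‖r • (s : E)‖ = r := fun s => by
      rw [norm_smul, norm_eq_of_mem_sphere, mul_one, Real.norm_of_nonneg hr.le]
    have hd : ∀ s : sphere (0 : E) 1,
        lineDeriv ℝ (fun v : E => cutoff m ‖v‖) (r • (s : E)) (-w)
          = if 1 - 1 / m < r ∧ r < 1 then m * inner ℝ (s : E) w else 0 := by
      intro s
      rw [lineDeriv_cutoff_norm hmpos (by rw [← norm_pos_iff, hnorm]; exact hr)
        (by rwa [hnorm]) (by rwa [hnorm]), hnorm, inner_neg_right, real_inner_smul_left]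
      congr 1
      field_simp
    simp only [hd]
    split_ifs
    · rw [← integral_const_mul]; simp only [mul_assoc]
    · simp
  rw [← integral_indicator measurableSet_Ioi, ← integral_indicator measurableSet_Ioc]
  refine integral_congr_ae ?_
  filter_upwards [(Set.countable_singleton (1 : ℝ)).ae_notMem volume,
    (Set.countable_singleton (1 - 1 / m : ℝ)).ae_notMem volume] with r h1 h2
  by_cases hr : 0 < r
  · rw [Set.indicator_of_mem (Set.mem_Ioi.2 hr), hinner r hr h1 h2]
    by_cases hr' : 1 - 1 / m < r ∧ r < 1
    · rw [if_pos hr', Set.indicator_of_mem (Set.mem_Ioc.2 ⟨hr'.1, hr'.2.le⟩)]; ring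
    · rw [if_neg hr', Set.indicator_of_notMem, mul_zero]
      exact fun h => hr' ⟨h.1, lt_of_le_of_ne h.2 h1⟩
  · rw [Set.indicator_of_notMem (by simpa using hr), Set.indicator_of_notMem]
    exact fun h => hr (lt_of_le_of_lt hm1 h.1)

/-- The divergence theorem on the unit ball for a Lipschitz function in a fixed direction. -/
theorem setIntegral_lineDeriv_ball {K : NNReal} {h : E → ℝ} (hh : LipschitzWith K h) (w : E) :
    ∫ v in ball (0 : E) 1, lineDeriv ℝ h v w ∂μ
      = ∫ s : sphere (0 : E) 1, inner ℝ (s : E) w * h s ∂μ.toSphere := by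
  set k : ℝ → ℝ := fun r => r ^ (Module.finrank ℝ E - 1) *
    ∫ s : sphere (0 : E) 1, inner ℝ (s : E) w * h (r • (s : E)) ∂μ.toSphere with hk
  have hkc : Continuous k :=
    (continuous_pow _).mul (continuous_integral_sphere μ.toSphere hh.continuous w)
  have hk1 : k 1 = ∫ s : sphere (0 : E) 1, inner ℝ (s : E) w * h s ∂μ.toSphere := by
    simp [hk]
  have hmeas := aestronglyMeasurable_lineDeriv (v := w) hh.continuous (𝕜 := ℝ) μ
  -- The cutoffs converge to the indicator of the open ball, with domination by the Lipschitz
  -- constant on the closed ball.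
  have lim1 : Tendsto (fun n : ℕ => ∫ v, lineDeriv ℝ h v w * cutoff (n + 1) ‖v‖ ∂μ) atTop
      (𝓝 (∫ v in ball (0 : E) 1, lineDeriv ℝ h v w ∂μ)) := by
    rw [← integral_indicator measurableSet_ball]
    refine tendsto_integral_of_dominated_convergence
      ((closedBall (0 : E) 1).indicator fun _ => K * ‖w‖) (fun n => ?_) ?_ (fun n => ?_) ?_
    · refine hmeas.mul (Continuous.aestronglyMeasurable ?_)
      exact (lipschitzWith_cutoff_norm (F := E) (⟨(n : ℝ) + 1, by positivity⟩ : NNReal)).continuous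
    · exact (integrable_indicator_iff measurableSet_closedBall).2
        (integrableOn_const (isCompact_closedBall _ _).measure_lt_top.ne)
    · refine .of_forall fun v => ?_
      by_cases hv : v ∈ closedBall (0 : E) 1
      · rw [Set.indicator_of_mem hv, norm_mul, Real.norm_of_nonneg (cutoff_nonneg _ _)]
        exact (mul_le_of_le_one_right (norm_nonneg _) (cutoff_le_one _ _)).trans
          (norm_lineDeriv_le_of_lipschitz ℝ hh)
      · rw [Set.indicator_of_notMem hv]
        rw [mem_closedBall_zero_iff, not_le] at hv
        rw [cutoff_of_one_le (by positivity) hv.le]; simp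
    · refine .of_forall fun v => ?_
      have := (tendsto_cutoff ‖v‖).const_mul (lineDeriv ℝ h v w)
      convert this using 2
      by_cases hv : ‖v‖ < 1 <;> simp [Set.indicator, hv]
  -- The shell average is a left difference quotient at `1` of a primitive of the continuous
  -- function `k`.
  have lim2 : Tendsto (fun n : ℕ => ∫ v, lineDeriv ℝ h v w * cutoff (n + 1) ‖v‖ ∂μ) atTop
      (𝓝 (k 1)) := by
    simp only [integral_lineDeriv_cutoff μ hh w]
    have hder := (hkc.integral_hasStrictDerivAt 1 1).hasDerivAt.tendsto_slope
    have hseq : Tendsto (fun n : ℕ => 1 - 1 / ((n : ℝ) + 1)) atTop (𝓝[≠] 1) := by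
      refine tendsto_nhdsWithin_iff.2 ⟨?_, .of_forall fun n => ?_⟩
      · simpa using tendsto_one_div_add_atTop_nhds_zero_nat.const_sub (1 : ℝ)
      · have : 0 < 1 / ((n : ℝ) + 1) := by positivity
        simp only [Set.mem_compl_iff, Set.mem_singleton_iff]
        linarith
    refine (hder.comp hseq).congr fun n => ?_
    have hn : (n : ℝ) + 1 ≠ 0 := by positivity
    simp only [Function.comp, slope_def_field, intervalIntegral.integral_same, sub_zero]
    rw [intervalIntegral.integral_symm]
    field_simp
    simp only [hk]
    ring
  rw [tendsto_nhds_unique lim1 lim2, hk1]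

end Divergence

/-! ### The smoothed loss and the one-point estimator -/

section Smoothing

open Metric Filter Topology

theorem add_fderiv_le_of_convexOn {E : Type*} [NormedAddCommGroup E] [NormedSpace ℝ E]
    {f : E → ℝ} (hf : ConvexOn ℝ Set.univ f) {x : E} (hx : DifferentiableAt ℝ f x) (z : E) :
    f x + fderiv ℝ f x (z - x) ≤ f z := by
  set g : ℝ → ℝ := fun t => f (x + t • (z - x)) with hg
  have hgc : ConvexOn ℝ Set.univ g := by
    have := hf.comp_affineMap (AffineMap.lineMap (k := ℝ) x z)
    have e : g = f ∘ AffineMap.lineMap (k := ℝ) x z := by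
      funext t
      simp [hg, AffineMap.lineMap_apply, add_comm]
    rw [e]
    exact this
  have hgd : HasDerivAt g (fderiv ℝ f x (z - x)) 0 := by
    have h1 : HasDerivAt (fun t : ℝ => x + t • (z - x)) (z - x) 0 := by
      simpa using ((hasDerivAt_id (0 : ℝ)).smul_const (z - x)).const_add x
    have h2 : HasFDerivAt f (fderiv ℝ f x) (x + (0 : ℝ) • (z - x)) := by
      simpa using hx.hasFDerivAt
    exact h2.comp_hasDerivAt 0 h1
  have := hgc.le_slope_of_hasDerivAt (Set.mem_univ 0) (Set.mem_univ 1) one_pos hgd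
  simp only [slope_def_field, hg, one_smul, zero_smul, add_zero, sub_zero, div_one,
    add_sub_cancel] at this
  linarith

theorem continuous_of_convexOn {d : ℕ} {f : Vec d → ℝ} (hf : ConvexOn ℝ Set.univ f) :
    Continuous f := by
  rw [← continuousOn_univ]
  exact hf.continuousOn isOpen_univ

variable {d : ℕ}

theorem norm_fderiv_eq_norm_gradient (f : Vec d → ℝ) (x : Vec d) :
    ‖fderiv ℝ f x‖ = ‖gradient f x‖ := by
  rw [gradient, LinearIsometryEquiv.norm_map]

theorem abs_sub_le_of_gradient_le {f : Vec d → ℝ} {R G : ℝ}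
    (hd : ∀ x ∈ closedBall (0 : Vec d) R, DifferentiableAt ℝ f x ∧ ‖gradient f x‖ ≤ G)
    {x y : Vec d} (hx : x ∈ closedBall (0 : Vec d) R) (hy : y ∈ closedBall (0 : Vec d) R) :
    |f x - f y| ≤ G * ‖x - y‖ :=
  (convex_closedBall (0 : Vec d) R).norm_image_sub_le_of_norm_fderiv_le (𝕜 := ℝ)
    (fun z hz => (hd z hz).1) (fun z hz => (norm_fderiv_eq_norm_gradient f z).le.trans (hd z hz).2)
    hy hx

theorem add_smul_mem_closedBall {R ε : ℝ} (hε : 0 ≤ ε) {x v : Vec d}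
    (hx : x ∈ closedBall (0 : Vec d) (R - ε)) (hv : ‖v‖ ≤ 1) :
    x + ε • v ∈ closedBall (0 : Vec d) R := by
  rw [mem_closedBall_zero_iff] at *
  calc ‖x + ε • v‖ ≤ ‖x‖ + ‖ε • v‖ := norm_add_le _ _
    _ ≤ (R - ε) + ε * 1 := by
      rw [norm_smul, Real.norm_of_nonneg hε]; gcongr
    _ = R := by ring

/-- The law is defined on the closed ball and the divergence theorem is stated on the open one; the
sphere between them is null. -/
theorem uniformBall_eq (hd : 1 ≤ d) :
    uniformBall d = (volume (ball (0 : Vec d) 1))⁻¹ • volume.restrict (ball (0 : Vec d) 1) := by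
  have : Nontrivial (Vec d) := by
    have : Nonempty (Fin d) := ⟨⟨0, hd⟩⟩
    infer_instance
  have hae : (closedBall (0 : Vec d) 1 : Set (Vec d)) =ᵐ[volume] ball (0 : Vec d) 1 := by
    rw [← ball_union_sphere]
    exact union_ae_eq_left_of_ae_eq_empty
      (ae_eq_empty.2 (Measure.addHaar_sphere volume (0 : Vec d) 1))
  rw [uniformBall, ProbabilityTheory.cond, Measure.restrict_congr_set hae, measure_congr hae]

theorem integral_uniformBall (hd : 1 ≤ d) (g : Vec d → ℝ) :
    ∫ v, g v ∂(uniformBall d)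
      = (volume.real (ball (0 : Vec d) 1))⁻¹ * ∫ v in ball (0 : Vec d) 1, g v := by
  rw [uniformBall_eq hd, integral_smul_measure, ENNReal.toReal_inv, smul_eq_mul]; rfl

theorem volume_real_ball_pos : 0 < volume.real (ball (0 : Vec d) 1) :=
  ENNReal.toReal_pos (measure_ball_pos _ _ one_pos).ne' measure_ball_lt_top.ne

theorem isProbabilityMeasure_uniformBall : IsProbabilityMeasure (uniformBall d) :=
  cond_isProbabilityMeasure_of_finite (measure_closedBall_pos _ _ one_pos).ne'
    (isCompact_closedBall _ _).measure_lt_top.ne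

theorem integral_uniformSphere (g : sphere (0 : Vec d) 1 → ℝ) :
    ∫ s, g s ∂(uniformSphere d)
      = (d * volume.real (ball (0 : Vec d) 1))⁻¹ *
        ∫ s, g s ∂((volume : Measure (Vec d)).toSphere) := by
  rw [uniformSphere, integral_smul_measure, ENNReal.toReal_inv, smul_eq_mul]
  congr 2
  have := (volume : Measure (Vec d)).toSphere_real_apply_univ
  rw [finrank_euclideanSpace_fin] at this
  exact this

theorem isProbabilityMeasure_uniformSphere (hd : 1 ≤ d) :
    IsProbabilityMeasure (uniformSphere d) := by
  have : Nontrivial (Vec d) := by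
    have : Nonempty (Fin d) := ⟨⟨0, hd⟩⟩
    infer_instance
  refine ⟨?_⟩
  rw [uniformSphere, Measure.smul_apply, smul_eq_mul, ENNReal.inv_mul_cancel]
  · rw [Ne, Measure.measure_univ_eq_zero]; exact Measure.toSphere_ne_zero _
  · exact measure_ne_top _ _

theorem integrable_uniformBall {g : Vec d → ℝ} (hg : Continuous g) :
    Integrable g (uniformBall d) := by
  rw [uniformBall, ProbabilityTheory.cond]
  refine Integrable.smul_measure ?_ (ENNReal.inv_ne_top.2 (measure_closedBall_pos _ _ one_pos).ne')
  exact hg.continuousOn.integrableOn_compact (isCompact_closedBall _ _)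

theorem abs_smoothed_sub_le {f : Vec d → ℝ} (hfc : Continuous f) {R G ε : ℝ} (hε : 0 ≤ ε)
    (hd : ∀ x ∈ closedBall (0 : Vec d) R, DifferentiableAt ℝ f x ∧ ‖gradient f x‖ ≤ G)
    {x : Vec d} (hx : x ∈ closedBall (0 : Vec d) (R - ε)) :
    |smoothed f ε x - f x| ≤ G * ε := by
  have := isProbabilityMeasure_uniformBall (d := d)
  have hxR : x ∈ closedBall (0 : Vec d) R := closedBall_subset_closedBall (by linarith) hx
  have hG : 0 ≤ G := (norm_nonneg _).trans (hd x hxR).2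
  have hi : Integrable (fun v => f (x + ε • v)) (uniformBall d) :=
    integrable_uniformBall (by fun_prop)
  have e : smoothed f ε x - f x = ∫ v, (f (x + ε • v) - f x) ∂(uniformBall d) := by
    rw [integral_sub hi (integrable_const _)]; simp [smoothed]
  rw [e, ← Real.norm_eq_abs]
  have hsupp : ∀ᵐ v ∂(uniformBall d), v ∈ closedBall (0 : Vec d) 1 :=
    ae_cond_mem measurableSet_closedBall
  refine (norm_integral_le_of_norm_le_const (C := G * ε) ?_).trans (by simp)
  filter_upwards [hsupp] with v hv
  rw [mem_closedBall_zero_iff] at hv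
  refine (abs_sub_le_of_gradient_le hd (add_smul_mem_closedBall hε hx hv) hxR).trans ?_
  rw [add_sub_cancel_left, norm_smul, Real.norm_of_nonneg hε]
  exact mul_le_mul_of_nonneg_left (mul_le_of_le_one_right hε hv) hG

theorem continuous_smoothed {f : Vec d → ℝ} (hfc : Continuous f) (ε : ℝ) :
    Continuous (smoothed f ε) := by
  have : Continuous fun x : Vec d => ∫ v in closedBall (0 : Vec d) 1, f (x + ε • v) :=
    continuous_parametric_integral_of_continuous
      (f := fun (x v : Vec d) => f (x + ε • v)) (by unfold Function.uncurry; fun_prop)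
      (isCompact_closedBall _ _)
  have e : smoothed f ε = fun x => ((volume (closedBall (0 : Vec d) 1))⁻¹).toReal *
      ∫ v in closedBall (0 : Vec d) 1, f (x + ε • v) := by
    funext x
    rw [smoothed, uniformBall, ProbabilityTheory.cond, integral_smul_measure, smul_eq_mul]
  rw [e]
  exact continuous_const.mul this

/-- On average, the one-point estimator is a subgradient of the smoothed loss. -/
theorem smoothed_sub_le_integral_onePointEstimator (hd : 1 ≤ d) {f : Vec d → ℝ}
    (hf : ConvexOn ℝ Set.univ f) {R G ε : ℝ} (hε : 0 < ε)
    (hgrad : ∀ x ∈ closedBall (0 : Vec d) R, DifferentiableAt ℝ f x ∧ ‖gradient f x‖ ≤ G)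
    {x : Vec d} (hx : x ∈ closedBall (0 : Vec d) (R - ε)) (z : Vec d) :
    smoothed f ε x - smoothed f ε z
      ≤ ∫ s : sphere (0 : Vec d) 1, inner ℝ (onePointEstimator f ε x s) (x - z)
        ∂(uniformSphere d) := by
  have : Nontrivial (Vec d) := by
    have : Nonempty (Fin d) := ⟨⟨0, hd⟩⟩
    infer_instance
  have hfc := continuous_of_convexOn hf
  have hd' : (0 : ℝ) < d := by exact_mod_cast hd
  have hV := volume_real_ball_pos (d := d)
  set V := volume.real (ball (0 : Vec d) 1)
  have hflip : LipschitzOnWith G.toNNReal f (closedBall (0 : Vec d) R) := by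
    refine LipschitzOnWith.of_dist_le_mul fun u hu v hv => ?_
    rw [Real.dist_eq, dist_eq_norm]
    exact (abs_sub_le_of_gradient_le hgrad hu hv).trans
      (mul_le_mul_of_nonneg_right (Real.le_coe_toNNReal G) (norm_nonneg _))
  -- The loss is known to be Lipschitz only on the ball of radius `R`. A global Lipschitz extension
  -- makes the divergence theorem applicable, and agrees with the loss at every `x + ε • v` with
  -- `‖v‖ ≤ 1`.
  obtain ⟨g, hg, hgf⟩ := hflip.extend_real
  set h : Vec d → ℝ := fun v => g (x + ε • v) with hh
  have hhlip : LipschitzWith (G.toNNReal * ‖ε‖₊) h := by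
    refine hg.comp ?_
    refine LipschitzWith.of_dist_le_mul fun u v => ?_
    rw [dist_add_left, dist_smul₀]; rfl
  have hmain := setIntegral_lineDeriv_ball volume hhlip (z - x)
  -- The gradient inequality between the translates `x + ε • v` and `z + ε • v`. Integrating it
  -- avoids differentiating the smoothed loss.
  have hline : ∀ v ∈ ball (0 : Vec d) 1,
      lineDeriv ℝ h v (z - x) ≤ ε * (f (z + ε • v) - f (x + ε • v)) := by
    intro v hv
    rw [mem_ball_zero_iff] at hv
    have hpt : x + ε • v ∈ closedBall (0 : Vec d) R := add_smul_mem_closedBall hε.le hx hv.le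
    have heq : h =ᶠ[𝓝 v] fun v => f (x + ε • v) := by
      filter_upwards [isOpen_ball.mem_nhds (mem_ball_zero_iff.2 hv)] with u hu
      rw [mem_ball_zero_iff] at hu
      exact (hgf (add_smul_mem_closedBall hε.le hx hu.le)).symm
    have hdiff := (hgrad _ hpt).1
    have hld : HasLineDerivAt ℝ (fun v => f (x + ε • v))
        (fderiv ℝ f (x + ε • v) (ε • (z - x))) v (z - x) := by
      have h1 : HasDerivAt (fun t : ℝ => x + ε • (v + t • (z - x))) (ε • (z - x)) 0 := by
        simpa using ((((hasDerivAt_id (0 : ℝ)).smul_const (z - x)).const_add v).const_smul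
          ε).const_add x
      have h2 : HasFDerivAt f (fderiv ℝ f (x + ε • v)) (x + ε • (v + (0 : ℝ) • (z - x))) := by
        simpa using hdiff.hasFDerivAt
      exact h2.comp_hasDerivAt 0 h1
    rw [heq.lineDeriv_eq, hld.lineDeriv, map_smul, smul_eq_mul]
    refine mul_le_mul_of_nonneg_left ?_ hε.le
    have := add_fderiv_le_of_convexOn hf hdiff (z + ε • v)
    rw [add_sub_add_right_eq_sub] at this
    linarith
  have hcf : ∀ y : Vec d, IntegrableOn (fun v => f (y + ε • v)) (ball (0 : Vec d) 1) := fun y =>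
    (Continuous.continuousOn (by fun_prop)).integrableOn_compact (isCompact_closedBall _ _)
      |>.mono_set ball_subset_closedBall
  have hle : ∫ v in ball (0 : Vec d) 1, lineDeriv ℝ h v (z - x)
      ≤ ε * ((∫ v in ball (0 : Vec d) 1, f (z + ε • v)) -
        ∫ v in ball (0 : Vec d) 1, f (x + ε • v)) := by
    rw [← integral_sub (hcf z) (hcf x), ← integral_const_mul]
    refine setIntegral_mono_on ?_ (((hcf z).sub (hcf x)).const_mul ε) measurableSet_ball hline
    refine Measure.integrableOn_of_bounded (M := (G.toNNReal * ‖ε‖₊ : NNReal) * ‖z - x‖)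
      measure_ball_lt_top.ne (aestronglyMeasurable_lineDeriv hhlip.continuous _)
      (.of_forall fun v => norm_lineDeriv_le_of_lipschitz ℝ hhlip)
  rw [hmain] at hle
  have hest : ∀ s : sphere (0 : Vec d) 1, inner ℝ (onePointEstimator f ε x s) (x - z)
      = -(d / ε) * (inner ℝ (s : Vec d) (z - x) * h s) := by
    intro s
    have : h s = f (x + ε • (s : Vec d)) :=
      (hgf (add_smul_mem_closedBall hε.le hx (norm_eq_of_mem_sphere s).le)).symm
    rw [onePointEstimator, real_inner_smul_left, this, ← neg_sub z x, inner_neg_right]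
    ring
  simp only [hest]
  rw [integral_const_mul, integral_uniformSphere, smoothed, smoothed, integral_uniformBall hd,
    integral_uniformBall hd]
  set I := ∫ s : sphere (0 : Vec d) 1, inner ℝ (s : Vec d) (z - x) * h s
    ∂((volume : Measure (Vec d)).toSphere)
  set J := ∫ v in ball (0 : Vec d) 1, f (z + ε • v)
  set J' := ∫ v in ball (0 : Vec d) 1, f (x + ε • v)
  -- The total surface measure is `d * V`, which is why the estimator carries the factor `d`.
  have : V⁻¹ * J' - V⁻¹ * J - (-(d / ε) * ((d * V)⁻¹ * I)) = (ε * V)⁻¹ * (I - ε * (J - J')) := by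
    field_simp; ring
  have h2 : (ε * V)⁻¹ * (I - ε * (J - J')) ≤ 0 :=
    mul_nonpos_of_nonneg_of_nonpos (by positivity) (by linarith)
  linarith

end Smoothing

/-! ### Projections and the dual update -/

section Projection

variable {d : ℕ} {S : Set (Vec d)}

theorem IsProjection.inner_le_zero (hS : Convex ℝ S) {q z : Vec d} (h : IsProjection S q z)
    {w : Vec d} (hw : w ∈ S) : inner ℝ (q - z) (w - z) ≤ 0 := by
  refine (norm_eq_iInf_iff_real_inner_le_zero hS h.1).1 ?_ w hw
  have : Nonempty S := ⟨⟨z, h.1⟩⟩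
  refine le_antisymm (le_ciInf fun w => ?_) (ciInf_le ⟨0, ?_⟩ (⟨z, h.1⟩ : S))
  · simpa [dist_eq_norm] using h.2 w.2
  · rintro _ ⟨w, rfl⟩; exact norm_nonneg _

theorem IsProjection.norm_sub_sq_le (hS : Convex ℝ S) {q z : Vec d} (h : IsProjection S q z)
    {w : Vec d} (hw : w ∈ S) : ‖z - w‖ ^ 2 ≤ ‖q - w‖ ^ 2 := by
  have h1 := h.inner_le_zero hS hw
  have e : ‖q - w‖ ^ 2 = ‖q - z‖ ^ 2 - 2 * inner ℝ (q - z) (w - z) + ‖z - w‖ ^ 2 := by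
    rw [norm_sub_rev z w, ← norm_sub_sq_real]; congr 2; abel
  nlinarith [sq_nonneg ‖q - z‖]

theorem IsProjection.norm_sub_le (hS : Convex ℝ S) {q z q' z' : Vec d} (h : IsProjection S q z)
    (h' : IsProjection S q' z') : ‖z - z'‖ ≤ ‖q - q'‖ := by
  have h1 := h.inner_le_zero hS h'.1
  have h2 := h'.inner_le_zero hS h.1
  have e : ‖z - z'‖ ^ 2
      = inner ℝ (q - z) (z' - z) + inner ℝ (q' - z') (z - z') + inner ℝ (q - q') (z - z') := by
    rw [← neg_sub z z', inner_neg_right, ← sub_eq_neg_add, ← inner_sub_left, ← inner_add_left,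
      ← real_inner_self_eq_norm_sq]
    congr 1; abel
  have h3 : ‖z - z'‖ ^ 2 ≤ ‖q - q'‖ * ‖z - z'‖ := by
    rw [e]; linarith [real_inner_le_norm (q - q') (z - z')]
  rcases (norm_nonneg (z - z')).eq_or_lt with h0 | h0
  · rw [← h0]; exact norm_nonneg _
  · exact le_of_mul_le_mul_right (by linarith [sq (‖z - z'‖)]) h0

theorem exists_isProjection (hS : Convex ℝ S) (hc : IsClosed S) (hne : S.Nonempty) (q : Vec d) :
    ∃ z, IsProjection S q z := by
  obtain ⟨z, hz, he⟩ := exists_norm_eq_iInf_of_complete_convex hne hc.isComplete hS q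
  refine ⟨z, hz, fun w hw => ?_⟩
  simp only [dist_eq_norm, Set.mem_ofPred_eq]
  rw [he]
  exact ciInf_le ⟨0, by rintro _ ⟨w, rfl⟩; exact norm_nonneg _⟩ (⟨w, hw⟩ : S)

end Projection

/-- The smoothed loss does not involve the dual variable, and completing the square shows that the
remainder is maximized only at `[c_s(x)]_+ / η`, which is nonnegative and hence admissible. -/
theorem eq_div_of_isMaxOn_smoothedLagrangian {d p : ℕ} {f : Vec d → ℝ} {con : Fin p → Vec d → ℝ}
    {ε η : ℝ} (hη : 0 < η) {x : Vec d} {lam : Vec p}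
    (hmax : IsMaxOn (fun l : Vec p => smoothedLagrangian f con ε η x l)
      {l : Vec p | ∀ s, 0 ≤ l s} lam) (s : Fin p) :
    lam s = max 0 (con s x) / η := by
  set l : Vec p := WithLp.toLp 2 fun s => max 0 (con s x) / η with hl
  have hls : ∀ s, l s = max 0 (con s x) / η := fun s => rfl
  have h1 : smoothedLagrangian f con ε η x l ≤ smoothedLagrangian f con ε η x lam :=
    hmax (fun s => div_nonneg (le_max_left _ _) hη.le)
  have key : ∀ m : Vec p, (∑ s, m s * max 0 (con s x)) - η / 2 * ‖m‖ ^ 2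
      = η / 2 * ‖l‖ ^ 2 - η / 2 * ∑ s, (m s - l s) ^ 2 := by
    intro m
    simp only [EuclideanSpace.norm_sq_eq, Real.norm_eq_abs, sq_abs, Finset.mul_sum,
      ← Finset.sum_sub_distrib]
    refine Finset.sum_congr rfl fun s _ => ?_
    rw [hls]; field_simp; ring
  unfold smoothedLagrangian at h1
  have h2 := key l
  have h3 := key lam
  simp only [sub_self] at h2
  have h4 : ∑ s, (lam s - l s) ^ 2 ≤ 0 := by
    by_contra hcon
    have : 0 < η / 2 * ∑ s, (lam s - l s) ^ 2 := mul_pos (by positivity) (not_le.1 hcon)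
    simp at h2
    linarith
  have h5 := (Finset.sum_eq_zero_iff_of_nonneg fun s _ => sq_nonneg (lam s - l s)).1
    (le_antisymm h4 (Finset.sum_nonneg fun s _ => sq_nonneg _)) s (Finset.mem_univ s)
  rw [← hls]
  exact sub_eq_zero.1 (pow_eq_zero_iff two_ne_zero |>.1 h5)

theorem sum_Icc_one_eq_sum_range {M : Type*} [AddCommMonoid M] (f : ℕ → M) (T : ℕ) :
    ∑ t ∈ Finset.Icc 1 T, f t = ∑ n ∈ Finset.range T, f (n + 1) := by
  induction T with
  | zero => simp
  | succ T ih => rw [Finset.sum_Icc_succ_top (by omega), ih, Finset.sum_range_succ]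

/-! ### Projected averaging dynamics -/

section Dynamics

variable {d N B T : ℕ} {ζ β : ℝ} {graph : ℕ → Digraph (Fin N)}
  {A : ℕ → Matrix (Fin N) (Fin N) ℝ} {S : Set (Vec d)} {x g : Fin N → ℕ → Vec d}

/-- The plain average of the decisions lies in `S` by convexity, so the projection is at least as
close to the perturbed average; the triangle inequality gives the factor `2`. Unit column sums
remove the weights. -/
theorem sum_norm_defect_le (hS : Convex ℝ S) (hβ : 0 ≤ β) {t : ℕ}
    (hA : A t ∈ doublyStochastic ℝ (Fin N)) (hxS : ∀ i, x i t ∈ S)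
    (hstep : ∀ i, IsProjection S (∑ j, A t i j • (x j t - β • g j t)) (x i (t + 1))) :
    ∑ i, ‖x i (t + 1) - ∑ j, A t i j • x j t‖ ≤ 2 * β * ∑ j, ‖g j t‖ := by
  obtain ⟨h0, h1, h2⟩ := mem_doublyStochastic_iff_sum.1 hA
  have hi : ∀ i, ‖x i (t + 1) - ∑ j, A t i j • x j t‖ ≤ 2 * β * ∑ j, A t i j * ‖g j t‖ := by
    intro i
    set q := ∑ j, A t i j • (x j t - β • g j t) with hq
    set m := ∑ j, A t i j • x j t with hm
    have hmS : m ∈ S := hS.sum_mem (fun j _ => h0 i j) (h1 i) fun j _ => hxS j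
    have hqm : ‖q - m‖ ≤ β * ∑ j, A t i j * ‖g j t‖ := by
      have : q - m = -(β • ∑ j, A t i j • g j t) := by
        rw [hq, hm, ← Finset.sum_sub_distrib, Finset.smul_sum, ← Finset.sum_neg_distrib]
        refine Finset.sum_congr rfl fun j _ => ?_
        rw [smul_sub, sub_sub_cancel_left, smul_comm]
      rw [this, norm_neg, norm_smul, Real.norm_of_nonneg hβ]
      refine mul_le_mul_of_nonneg_left
        ((norm_sum_le _ _).trans (Finset.sum_le_sum fun j _ => ?_)) hβ
      rw [norm_smul, Real.norm_of_nonneg (h0 i j)]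
    have hp : ‖q - x i (t + 1)‖ ≤ ‖q - m‖ := by
      simpa [dist_eq_norm] using (hstep i).2 hmS
    calc ‖x i (t + 1) - m‖ ≤ ‖x i (t + 1) - q‖ + ‖q - m‖ := norm_sub_le_norm_sub_add_norm_sub _ _ _
      _ ≤ 2 * β * ∑ j, A t i j * ‖g j t‖ := by rw [norm_sub_rev]; linarith
  refine (Finset.sum_le_sum fun i _ => hi i).trans (le_of_eq ?_)
  rw [← Finset.mul_sum, Finset.sum_comm]
  congr 1
  refine Finset.sum_congr rfl fun j _ => ?_
  rw [← Finset.sum_mul, h2, one_mul]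

/-- The dynamics are linear averaging driven by the defects. The defect of step `k + 1` enters at
time `k + 2` and is then propagated by `A (k + 2), …, A n`. -/
theorem eq_sum_transition_smul (hx1 : ∀ i, x i 1 = 0) (n : ℕ) (i : Fin N) :
    x i (n + 1) = ∑ k ∈ Finset.range n, ∑ j, transition A (k + 2) (n - 1 - k) i j •
      (x j (k + 1 + 1) - ∑ l, A (k + 1) j l • x l (k + 1)) := by
  induction n generalizing i with
  | zero => simp [hx1]
  | succ n ih =>
    rw [Finset.sum_range_succ]
    have hlast : ∑ j, transition A (n + 2) (n + 1 - 1 - n) i j •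
        (x j (n + 1 + 1) - ∑ l, A (n + 1) j l • x l (n + 1))
        = x i (n + 1 + 1) - ∑ l, A (n + 1) i l • x l (n + 1) := by
      simp [transition, Matrix.one_apply]
    have hprev : ∑ k ∈ Finset.range n, ∑ j, transition A (k + 2) (n + 1 - 1 - k) i j •
        (x j (k + 1 + 1) - ∑ l, A (k + 1) j l • x l (k + 1))
        = ∑ l, A (n + 1) i l • x l (n + 1) := by
      have : ∑ l, A (n + 1) i l • x l (n + 1)
          = ∑ l, A (n + 1) i l • ∑ k ∈ Finset.range n, ∑ j,
            transition A (k + 2) (n - 1 - k) l j •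
              (x j (k + 1 + 1) - ∑ l, A (k + 1) j l • x l (k + 1)) :=
        Finset.sum_congr rfl fun l _ => by rw [← ih]
      rw [this]
      simp only [Finset.smul_sum (r := A (n + 1) i _)]
      conv_rhs => rw [Finset.sum_comm]
      refine Finset.sum_congr rfl fun k hk => ?_
      have hk' := Finset.mem_range.1 hk
      conv_rhs => rw [Finset.sum_comm]
      refine Finset.sum_congr rfl fun j _ => ?_
      rw [show n + 1 - 1 - k = (n - 1 - k) + 1 by omega, transition,
        show k + 2 + (n - 1 - k) = n + 1 by omega, Matrix.mul_apply, Finset.sum_smul]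
      simp only [smul_smul]
    rw [hlast, hprev]; abel

theorem sum_convolution_le {p D : ℕ → ℝ} {K : ℝ} (hp : ∀ n, ∑ L ∈ Finset.range n, p L ≤ K)
    (hD : ∀ k, 0 ≤ D k) (T : ℕ) :
    ∑ n ∈ Finset.range T, ∑ k ∈ Finset.range n, p (n - 1 - k) * D k
      ≤ K * ∑ k ∈ Finset.range T, D k := by
  rw [Finset.sum_comm' (t' := Finset.range T) (s' := fun k => Finset.Ico (k + 1) T)
    (by intro n k; simp only [Finset.mem_range, Finset.mem_Ico]; omega), Finset.mul_sum]
  refine Finset.sum_le_sum fun k _ => ?_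
  rw [← Finset.sum_mul]
  refine mul_le_mul_of_nonneg_right ?_ (hD k)
  rw [Finset.sum_Ico_eq_sum_range]
  refine le_trans (le_of_eq (Finset.sum_congr rfl fun m _ => ?_)) (hp (T - (k + 1)))
  congr 1; omega

/-- The accumulated disagreement is controlled by the accumulated size of the steps. -/
theorem sum_norm_sub_le_hatC (hN : 1 ≤ N) (hB : 1 ≤ B) (hζ : 0 < ζ)
    (hgraph : JointlyConnected graph B) (hA : ∀ t, 1 ≤ t → IsWeightMatrix (graph t) ζ (A t))
    (hS : Convex ℝ S) (hβ : 0 ≤ β) (hx1 : ∀ i, x i 1 = 0)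
    (hxS : ∀ t ∈ Finset.Icc 1 T, ∀ i, x i t ∈ S)
    (hstep : ∀ t ∈ Finset.Icc 1 T, ∀ i,
      IsProjection S (∑ j, A t i j • (x j t - β • g j t)) (x i (t + 1))) (i : Fin N) :
    ∑ t ∈ Finset.Icc 1 T, ∑ j, ‖x i t - x j t‖
      ≤ hatC N B ζ * (β * ∑ t ∈ Finset.Icc 1 T, ∑ j, ‖g j t‖) := by
  have hN' : (1 : ℝ) ≤ N := by exact_mod_cast hN
  obtain ⟨hψ0, hψ1⟩ := psiConst_bounds hN hζ
    (weight_floor_le_one hN (hA 1 le_rfl).isFloorStochastic)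
  obtain ⟨hK0, hK⟩ := four_mul_mixingConst_le_hatC (N := N) hN hB hψ0 hψ1
  set δ : Fin N → ℕ → Vec d := fun j k => x j (k + 1 + 1) - ∑ l, A (k + 1) j l • x l (k + 1)
    with hδ
  set D : ℕ → ℝ := fun k => ∑ j, ‖δ j k‖ with hDdef
  have hDnn : ∀ k, 0 ≤ D k := fun k => Finset.sum_nonneg fun j _ => norm_nonneg _
  have hDle : ∀ k ∈ Finset.range T, D k ≤ 2 * β * ∑ j, ‖g j (k + 1)‖ := by
    intro k hk
    have ht : k + 1 ∈ Finset.Icc 1 T := by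
      have := Finset.mem_range.1 hk
      exact Finset.mem_Icc.2 ⟨by omega, by omega⟩
    exact sum_norm_defect_le hS hβ (hA _ (by omega)).doubly_stochastic (hxS _ ht) (hstep _ ht)
  set p : ℕ → ℝ := fun L => psiConst N ζ ^ (L / B - 1) with hp
  -- A reference point common to all units: the unrolled dynamics with every transition entry
  -- replaced by its limit `1 / N`.
  set mean : ℕ → Vec d := fun n => ∑ k ∈ Finset.range n, ∑ j, (1 / (N : ℝ)) • δ j k with hmean
  have hdev : ∀ n i, ‖x i (n + 1) - mean n‖ ≤ ∑ k ∈ Finset.range n, p (n - 1 - k) * D k := by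
    intro n i
    rw [eq_sum_transition_smul (A := A) hx1 n i, hmean, ← Finset.sum_sub_distrib]
    refine (norm_sum_le _ _).trans (Finset.sum_le_sum fun k _ => ?_)
    rw [← Finset.sum_sub_distrib, hDdef, Finset.mul_sum]
    refine (norm_sum_le _ _).trans (Finset.sum_le_sum fun j _ => ?_)
    rw [← sub_smul, norm_smul, Real.norm_eq_abs]
    exact mul_le_mul_of_nonneg_right
      (abs_transition_sub_le hN hB hζ hgraph hA (by omega) _ i j) (norm_nonneg _)
  rw [sum_Icc_one_eq_sum_range, sum_Icc_one_eq_sum_range]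
  have hpair : ∀ n, ∑ j, ‖x i (n + 1) - x j (n + 1)‖
      ≤ 2 * N * ∑ k ∈ Finset.range n, p (n - 1 - k) * D k := by
    intro n
    have : ∀ j, ‖x i (n + 1) - x j (n + 1)‖
        ≤ 2 * ∑ k ∈ Finset.range n, p (n - 1 - k) * D k := fun j =>
      calc ‖x i (n + 1) - x j (n + 1)‖
          ≤ ‖x i (n + 1) - mean n‖ + ‖mean n - x j (n + 1)‖ :=
            norm_sub_le_norm_sub_add_norm_sub _ _ _
        _ ≤ _ := by rw [norm_sub_rev (mean n)]; linarith [hdev n i, hdev n j]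
    refine (Finset.sum_le_sum fun j _ => this j).trans (le_of_eq ?_)
    simp; ring
  calc ∑ n ∈ Finset.range T, ∑ j, ‖x i (n + 1) - x j (n + 1)‖
      ≤ 2 * N * ∑ n ∈ Finset.range T, ∑ k ∈ Finset.range n, p (n - 1 - k) * D k := by
        rw [Finset.mul_sum]; exact Finset.sum_le_sum fun n _ => hpair n
    _ ≤ 2 * N * (mixingConst N B ζ * ∑ k ∈ Finset.range T, D k) := by
        gcongr
        exact sum_convolution_le (fun n => sum_psi_pow_le hB hψ0 hψ1 n) hDnn T
    _ ≤ 2 * N * (mixingConst N B ζ *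
          ∑ k ∈ Finset.range T, 2 * β * ∑ j, ‖g j (k + 1)‖) := by
        gcongr with k hk
        exact hDle k hk
    _ = 4 * N * mixingConst N B ζ * (β * ∑ k ∈ Finset.range T, ∑ j, ‖g j (k + 1)‖) := by
        rw [← Finset.mul_sum]; ring
    _ ≤ hatC N B ζ * (β * ∑ k ∈ Finset.range T, ∑ j, ‖g j (k + 1)‖) := by
        refine mul_le_mul_of_nonneg_right hK (mul_nonneg hβ ?_)
        exact Finset.sum_nonneg fun k _ => Finset.sum_nonneg fun j _ => norm_nonneg _

theorem norm_sum_smul_sq_le {n : ℕ} {w : Fin n → ℝ} (hw : ∀ j, 0 ≤ w j) (hw1 : ∑ j, w j = 1)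
    (v : Fin n → Vec d) : ‖∑ j, w j • v j‖ ^ 2 ≤ ∑ j, w j * ‖v j‖ ^ 2 := by
  have h1 : ‖∑ j, w j • v j‖ ≤ ∑ j, w j * ‖v j‖ := by
    refine (norm_sum_le _ _).trans (le_of_eq (Finset.sum_congr rfl fun j _ => ?_))
    rw [norm_smul, Real.norm_of_nonneg (hw j)]
  exact (pow_le_pow_left₀ (norm_nonneg _) h1 2).trans
    (Real.pow_arith_mean_le_arith_mean_pow _ _ _ (fun j _ => hw j) hw1
      (fun j _ => norm_nonneg _) 2)

/-- Summed descent inequality of the projected averaging dynamics. -/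
theorem sum_inner_le (hA : ∀ t, 1 ≤ t → A t ∈ doublyStochastic ℝ (Fin N))
    (hS : Convex ℝ S) (hβ : 0 < β) (hx1 : ∀ i, x i 1 = 0)
    (hstep : ∀ t ∈ Finset.Icc 1 T, ∀ i,
      IsProjection S (∑ j, A t i j • (x j t - β • g j t)) (x i (t + 1)))
    {z : Vec d} (hz : z ∈ S) :
    ∑ t ∈ Finset.Icc 1 T, ∑ j, inner ℝ (g j t) (x j t - z)
      ≤ N * ‖z‖ ^ 2 / (2 * β) + β / 2 * ∑ t ∈ Finset.Icc 1 T, ∑ j, ‖g j t‖ ^ 2 := by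
  set V : ℕ → ℝ := fun t => ∑ j, ‖x j t - z‖ ^ 2 with hV
  have hone : ∀ t ∈ Finset.Icc 1 T, V (t + 1) ≤ V t - 2 * β * ∑ j, inner ℝ (g j t) (x j t - z)
      + β ^ 2 * ∑ j, ‖g j t‖ ^ 2 := by
    intro t ht
    obtain ⟨h0, h1, h2⟩ := mem_doublyStochastic_iff_sum.1 (hA t (Finset.mem_Icc.1 ht).1)
    -- Projection does not increase the distance to `z`, and the squared norm is convex along the
    -- row weights; the column sums then remove the network from the estimate.
    calc V (t + 1) ≤ ∑ i, ∑ j, A t i j * ‖x j t - β • g j t - z‖ ^ 2 := by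
          refine Finset.sum_le_sum fun i _ => ((hstep t ht i).norm_sub_sq_le hS hz).trans ?_
          refine le_trans (le_of_eq ?_) (norm_sum_smul_sq_le (h0 i) (h1 i) _)
          congr 2
          simp only [smul_sub _ _ z, Finset.sum_sub_distrib, ← Finset.sum_smul, h1, one_smul]
      _ = ∑ j, ‖x j t - β • g j t - z‖ ^ 2 := by
          rw [Finset.sum_comm]
          refine Finset.sum_congr rfl fun j _ => ?_
          rw [← Finset.sum_mul, h2, one_mul]
      _ = _ := by
          rw [hV, Finset.mul_sum, Finset.mul_sum, ← Finset.sum_sub_distrib,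
            ← Finset.sum_add_distrib]
          refine Finset.sum_congr rfl fun j _ => ?_
          rw [show x j t - β • g j t - z = (x j t - z) - β • g j t by abel, norm_sub_sq_real,
            real_inner_smul_right, real_inner_comm, norm_smul, mul_pow, Real.norm_eq_abs, sq_abs]
          ring
  have htel : ∑ t ∈ Finset.Icc 1 T, (V t - V (t + 1)) ≤ N * ‖z‖ ^ 2 := by
    rw [sum_Icc_one_eq_sum_range, Finset.sum_range_sub' (fun n => V (n + 1))]
    have h1 : V (0 + 1) = N * ‖z‖ ^ 2 := by simp [hV, hx1]
    have h2 : 0 ≤ V (T + 1) := Finset.sum_nonneg fun j _ => sq_nonneg _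
    linarith
  have hsum := Finset.sum_le_sum fun t ht => (show 2 * β * ∑ j, inner ℝ (g j t) (x j t - z)
    ≤ (V t - V (t + 1)) + β ^ 2 * ∑ j, ‖g j t‖ ^ 2 by linarith [hone t ht])
  rw [Finset.sum_add_distrib, ← Finset.mul_sum, ← Finset.mul_sum] at hsum
  set X := ∑ t ∈ Finset.Icc 1 T, ∑ j, inner ℝ (g j t) (x j t - z)
  set Q := ∑ t ∈ Finset.Icc 1 T, ∑ j, ‖g j t‖ ^ 2
  have e : N * ‖z‖ ^ 2 / (2 * β) + β / 2 * Q = (N * ‖z‖ ^ 2 + β ^ 2 * Q) / (2 * β) := by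
    field_simp
  rw [e, le_div_iff₀ (by positivity)]
  linarith

end Dynamics

/-! ### Pathwise estimates for a run of the algorithm -/

section Pathwise

open Metric

variable {d N p B T : ℕ} {R G C ζ K β ε shrink : ℝ} {loss : Fin N → ℕ → Vec d → ℝ}
  {con : Fin p → Vec d → ℝ} {graph : ℕ → Digraph (Fin N)} {A : ℕ → Matrix (Fin N) (Fin N) ℝ}
  {u x : Fin N → ℕ → Vec d} {lam : Fin N → ℕ → Vec p}

theorem norm_onePointEstimator_le {f : Vec d → ℝ} (hε : 0 < ε)
    (hf : ∀ y ∈ closedBall (0 : Vec d) R, |f y| ≤ C) {y v : Vec d}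
    (hy : y ∈ closedBall (0 : Vec d) (R - ε)) (hv : ‖v‖ = 1) :
    ‖onePointEstimator f ε y v‖ ≤ d * C / ε := by
  rw [onePointEstimator, norm_smul, hv, mul_one, Real.norm_eq_abs, abs_mul,
    abs_of_nonneg (by positivity), mul_div_right_comm]
  exact mul_le_mul_of_nonneg_left (hf _ (add_smul_mem_closedBall hε.le hy hv.le)) (by positivity)

theorem norm_posPartGrad_le {f : Vec d → ℝ} {y : Vec d} (hf : ‖gradient f y‖ ≤ G) :
    ‖posPartGrad f y‖ ≤ G := by
  unfold posPartGrad
  split_ifs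
  · exact hf
  · simpa using (norm_nonneg _).trans hf

/-- Multiplied by `K [c_s]_+`, this turns the dual part of the step into the quadratic gain `K
[c_s]_+²`. -/
theorem max_zero_le_inner_posPartGrad {f : Vec d → ℝ} (hf : ConvexOn ℝ Set.univ f) {y z : Vec d}
    (hy : DifferentiableAt ℝ f y) (hz : f z ≤ 0) :
    max 0 (f y) ≤ inner ℝ (posPartGrad f y) (y - z) := by
  unfold posPartGrad
  split_ifs with h
  · rw [max_eq_right h.le, inner_gradient_left]
    have := add_fderiv_le_of_convexOn hf hy z
    rw [← neg_sub y z, map_neg] at this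
    linarith
  · rw [max_eq_left (not_lt.1 h), inner_zero_left]

/-- The step direction used by a unit. -/
def stepDirection (f : Vec d → ℝ) (con : Fin p → Vec d → ℝ) (ε : ℝ) (y : Vec d) (l : Vec p)
    (v : Vec d) : Vec d :=
  onePointEstimator f ε y v + ∑ s, l s • posPartGrad (con s) y

theorem norm_stepDirection_le {f : Vec d → ℝ} (hε : 0 < ε) (hK : 0 ≤ K)
    (hf : ∀ y ∈ closedBall (0 : Vec d) R, |f y| ≤ C) {y v : Vec d} {l : Vec p}
    (hcon : ∀ s, ‖gradient (con s) y‖ ≤ G)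
    (hy : y ∈ closedBall (0 : Vec d) (R - ε)) (hv : ‖v‖ = 1)
    (hl : ∀ s, l s = K * max 0 (con s y)) :
    ‖stepDirection f con ε y l v‖ ≤ d * C / ε + G * K * ∑ s, max 0 (con s y) := by
  refine (norm_add_le _ _).trans (add_le_add (norm_onePointEstimator_le hε hf hy hv) ?_)
  rw [Finset.mul_sum]
  refine (norm_sum_le _ _).trans (Finset.sum_le_sum fun s _ => ?_)
  have hl0 : 0 ≤ K * max 0 (con s y) := mul_nonneg hK (le_max_left _ _)
  rw [norm_smul, hl, Real.norm_of_nonneg hl0]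
  calc K * max 0 (con s y) * ‖posPartGrad (con s) y‖ ≤ K * max 0 (con s y) * G :=
        mul_le_mul_of_nonneg_left (norm_posPartGrad_le (hcon s)) hl0
    _ = _ := by ring

theorem norm_stepDirection_sq_le {f : Vec d → ℝ} (hε : 0 < ε) (hK : 0 ≤ K)
    (hf : ∀ y ∈ closedBall (0 : Vec d) R, |f y| ≤ C) {y v : Vec d} {l : Vec p}
    (hcon : ∀ s, ‖gradient (con s) y‖ ≤ G)
    (hy : y ∈ closedBall (0 : Vec d) (R - ε)) (hv : ‖v‖ = 1)
    (hl : ∀ s, l s = K * max 0 (con s y)) :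
    ‖stepDirection f con ε y l v‖ ^ 2
      ≤ 2 * (d * C / ε) ^ 2 + 2 * (G * K) ^ 2 * p * ∑ s, max 0 (con s y) ^ 2 := by
  have h1 := pow_le_pow_left₀ (norm_nonneg _) (norm_stepDirection_le hε hK hf hcon hy hv hl) 2
  have h2 : (∑ s, max 0 (con s y)) ^ 2 ≤ p * ∑ s, max 0 (con s y) ^ 2 := by
    simpa using sq_sum_le_card_mul_sum_sq (s := Finset.univ) (f := fun s => max 0 (con s y))
  refine h1.trans ((add_sq_le).trans ?_)
  rw [mul_add, mul_pow (G * K)]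
  have h3 := mul_le_mul_of_nonneg_left h2 (by positivity : 0 ≤ 2 * (G * K) ^ 2)
  linarith

theorem le_inner_stepDirection {f : Vec d → ℝ} (hK : 0 ≤ K) {y v z : Vec d} {l : Vec p}
    (hconv : ∀ s, ConvexOn ℝ Set.univ (con s)) (hcon : ∀ s, DifferentiableAt ℝ (con s) y)
    (hl : ∀ s, l s = K * max 0 (con s y)) (hz : ∀ s, con s z ≤ 0) :
    inner ℝ (onePointEstimator f ε y v) (y - z) + K * ∑ s, max 0 (con s y) ^ 2
      ≤ inner ℝ (stepDirection f con ε y l v) (y - z) := by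
  rw [stepDirection, inner_add_left, sum_inner, Finset.mul_sum]
  refine add_le_add_right (Finset.sum_le_sum fun s _ => ?_) _
  rw [real_inner_smul_left, hl, sq, ← mul_assoc]
  exact mul_le_mul_of_nonneg_left (max_zero_le_inner_posPartGrad (hconv s) (hcon s) (hz s))
    (mul_nonneg hK (le_max_left _ _))

theorem IsBanditRun.mem_closedBall
    {η β' ε' : ℕ → ℝ} (h : IsBanditRun T loss con R A η β' ε' shrink u x lam)
    (hr : 0 ≤ (1 - shrink) * R) {t : ℕ} (ht : t ∈ Finset.Icc 1 T) (i : Fin N) :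
    x i t ∈ closedBall (0 : Vec d) ((1 - shrink) * R) := by
  obtain ⟨h1, h2⟩ := Finset.mem_Icc.1 ht
  rcases eq_or_lt_of_le h1 with rfl | h1
  · rw [h.init_x]; exact mem_closedBall_self hr
  · obtain ⟨t, rfl⟩ : ∃ m, t = m + 1 := ⟨t - 1, by omega⟩
    exact (h.update_x t (Finset.mem_Icc.2 ⟨by omega, by omega⟩) i).1

/-- At `t = 1` the zero initialization agrees with the formula because the initial decision `0` is
feasible; later times use the closed form of the dual maximizer. -/
theorem IsBanditRun.lam_eq
    {β' ε' : ℕ → ℝ} (h : IsBanditRun T loss con R A (fun _ => 1 / K) β' ε' shrink u x lam)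
    (hK : 0 < K) (hzero : (0 : Vec d) ∈ feasible con) {t : ℕ} (ht : t ∈ Finset.Icc 1 T)
    (i : Fin N) (s : Fin p) : lam i t s = K * max 0 (con s (x i t)) := by
  obtain ⟨h1, h2⟩ := Finset.mem_Icc.1 ht
  rcases eq_or_lt_of_le h1 with rfl | h1
  · rw [h.init_x, h.init_lam, max_eq_left (hzero s)]; simp
  · obtain ⟨t, rfl⟩ : ∃ m, t = m + 1 := ⟨t - 1, by omega⟩
    rw [eq_div_of_isMaxOn_smoothedLagrangian (one_div_pos.2 hK)
      (h.update_lam t (Finset.mem_Icc.2 ⟨by omega, by omega⟩) i).2 s]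
    field_simp

theorem IsBanditRun.sum_norm_sub_le
    (hrun : IsBanditRun T loss con R A (fun _ => 1 / K) (fun _ => β) (fun _ => ε) shrink u x lam)
    (hr : (1 - shrink) * R = R - ε) (hεR : ε ≤ R) (hε : 0 < ε) (hK : 0 < K) (hβ : 0 < β)
    (hzero : (0 : Vec d) ∈ feasible con) (hu : ∀ i t, ‖u i t‖ = 1)
    (hcon : ∀ s, ∀ y ∈ closedBall (0 : Vec d) R,
      DifferentiableAt ℝ (con s) y ∧ ‖gradient (con s) y‖ ≤ G)
    (hloss : ∀ i, ∀ t ∈ Finset.Icc 1 T, ∀ y ∈ closedBall (0 : Vec d) R, |loss i t y| ≤ C)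
    (hA : ∀ t, 1 ≤ t → IsWeightMatrix (graph t) ζ (A t)) (hN : 1 ≤ N) (hB : 1 ≤ B) (hζ : 0 < ζ)
    (hgraph : JointlyConnected graph B) (i : Fin N) :
    ∑ t ∈ Finset.Icc 1 T, ∑ j, ‖x i t - x j t‖
      ≤ hatC N B ζ * (β * ∑ t ∈ Finset.Icc 1 T, ∑ j,
          (d * C / ε + G * K * ∑ s, max 0 (con s (x j t)))) := by
  have hr0 : 0 ≤ (1 - shrink) * R := by rw [hr]; linarith
  have hmem := fun t ht j => hrun.mem_closedBall hr0 (t := t) ht j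
  have hmain := sum_norm_sub_le_hatC (T := T)
    (g := fun j t => stepDirection (loss j t) con ε (x j t) (lam j t) (u j t))
    hN hB hζ hgraph hA (convex_closedBall (0 : Vec d) ((1 - shrink) * R)) hβ.le hrun.init_x hmem
    hrun.update_x i
  obtain ⟨hψ0, hψ1⟩ := psiConst_bounds hN hζ
    (weight_floor_le_one hN (hA 1 le_rfl).isFloorStochastic)
  obtain ⟨hK0, hKc⟩ := four_mul_mixingConst_le_hatC (N := N) hN hB hψ0 hψ1
  refine hmain.trans (mul_le_mul_of_nonneg_left (mul_le_mul_of_nonneg_left ?_ hβ.le)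
    (le_trans (by positivity) hKc))
  refine Finset.sum_le_sum fun t ht => Finset.sum_le_sum fun j _ => ?_
  have hm := hmem t ht j
  rw [hr] at hm
  exact norm_stepDirection_le hε hK.le (hloss j t ht)
    (fun s => (hcon s _ (closedBall_subset_closedBall (by linarith) hm)).2) hm (hu j t)
    (hrun.lam_eq hK hzero ht j)

theorem IsBanditRun.sum_inner_add_le
    (hrun : IsBanditRun T loss con R A (fun _ => 1 / K) (fun _ => β) (fun _ => ε) shrink u x lam)
    (hr : (1 - shrink) * R = R - ε) (hεR : ε ≤ R) (hε : 0 < ε) (hK : 0 < K) (hβ : 0 < β)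
    (hzero : (0 : Vec d) ∈ feasible con) (hu : ∀ i t, ‖u i t‖ = 1)
    (hcon : ∀ s, ∀ y ∈ closedBall (0 : Vec d) R,
      DifferentiableAt ℝ (con s) y ∧ ‖gradient (con s) y‖ ≤ G)
    (hloss : ∀ i, ∀ t ∈ Finset.Icc 1 T, ∀ y ∈ closedBall (0 : Vec d) R, |loss i t y| ≤ C)
    (hA : ∀ t, 1 ≤ t → IsWeightMatrix (graph t) ζ (A t)) (hconv : ∀ s, ConvexOn ℝ Set.univ (con s))
    {z : Vec d} (hz : z ∈ closedBall (0 : Vec d) (R - ε)) (hzc : z ∈ feasible con) :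
    ∑ t ∈ Finset.Icc 1 T, ∑ j, inner ℝ (onePointEstimator (loss j t) ε (x j t) (u j t)) (x j t - z)
      + K * ∑ t ∈ Finset.Icc 1 T, ∑ j, ∑ s, max 0 (con s (x j t)) ^ 2
      ≤ N * R ^ 2 / (2 * β) + β * (T * (N * (d * C / ε) ^ 2) + (G * K) ^ 2 * p *
        ∑ t ∈ Finset.Icc 1 T, ∑ j, ∑ s, max 0 (con s (x j t)) ^ 2) := by
  have hr0 : 0 ≤ (1 - shrink) * R := by rw [hr]; linarith
  have hmem : ∀ t ∈ Finset.Icc 1 T, ∀ j, x j t ∈ closedBall (0 : Vec d) (R - ε) :=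
    fun t ht j => hr ▸ hrun.mem_closedBall hr0 ht j
  have hmem' : ∀ t ∈ Finset.Icc 1 T, ∀ j, x j t ∈ closedBall (0 : Vec d) R :=
    fun t ht j => closedBall_subset_closedBall (by linarith) (hmem t ht j)
  have hmain := sum_inner_le (T := T)
    (g := fun j t => stepDirection (loss j t) con ε (x j t) (lam j t) (u j t))
    (fun t ht => (hA t ht).doubly_stochastic) (convex_closedBall (0 : Vec d) ((1 - shrink) * R))
    hβ hrun.init_x hrun.update_x (z := z) (by rwa [hr])
  have h1 : ∑ t ∈ Finset.Icc 1 T, ∑ j,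
      (inner ℝ (onePointEstimator (loss j t) ε (x j t) (u j t)) (x j t - z)
        + K * ∑ s, max 0 (con s (x j t)) ^ 2)
      ≤ ∑ t ∈ Finset.Icc 1 T, ∑ j,
        inner ℝ (stepDirection (loss j t) con ε (x j t) (lam j t) (u j t)) (x j t - z) :=
    Finset.sum_le_sum fun t ht => Finset.sum_le_sum fun j _ =>
      le_inner_stepDirection hK.le hconv (fun s => (hcon s _ (hmem' t ht j)).1)
        (hrun.lam_eq hK hzero ht j) hzc
  have h2 : ∑ t ∈ Finset.Icc 1 T, ∑ j,
      ‖stepDirection (loss j t) con ε (x j t) (lam j t) (u j t)‖ ^ 2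
      ≤ ∑ t ∈ Finset.Icc 1 T, ∑ j : Fin N, (2 * (d * C / ε) ^ 2 +
        2 * (G * K) ^ 2 * p * ∑ s, max 0 (con s (x j t)) ^ 2) :=
    Finset.sum_le_sum fun t ht => Finset.sum_le_sum fun j _ =>
      norm_stepDirection_sq_le hε hK.le (hloss j t ht) (fun s => (hcon s _ (hmem' t ht j)).2)
        (hmem t ht j) (hu j t) (hrun.lam_eq hK hzero ht j)
  simp only [Finset.sum_add_distrib, ← Finset.mul_sum, Finset.sum_const, Finset.card_univ,
    Fintype.card_fin, Nat.card_Icc, Nat.add_sub_cancel, nsmul_eq_mul] at h1 h2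
  have hzR : ‖z‖ ^ 2 ≤ R ^ 2 := by
    rw [mem_closedBall_zero_iff] at hz
    exact pow_le_pow_left₀ (norm_nonneg _) (by linarith) 2
  have h3 : N * ‖z‖ ^ 2 / (2 * β) ≤ N * R ^ 2 / (2 * β) := by gcongr
  have h4 := mul_le_mul_of_nonneg_left h2 (by positivity : 0 ≤ β / 2)
  set V := ∑ t ∈ Finset.Icc 1 T, ∑ j, ∑ s, max 0 (con s (x j t)) ^ 2
  have e : β / 2 * (T * (N * (2 * (d * C / ε) ^ 2)) + 2 * (G * K) ^ 2 * p * V)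
      = β * (T * (N * (d * C / ε) ^ 2) + (G * K) ^ 2 * p * V) := by ring
  linarith

end Pathwise

/-! ### Measurability, independence and expectations -/

section Probability

open Metric

theorem measurable_gradient {d : ℕ} (f : Vec d → ℝ) : Measurable (gradient f) := by
  unfold gradient
  exact (InnerProductSpace.toDual ℝ (Vec d)).symm.continuous.measurable.comp
    (measurable_fderiv ℝ f)

theorem measurable_posPartGrad {d : ℕ} {f : Vec d → ℝ} (hf : Continuous f) :
    Measurable (posPartGrad f) := by
  unfold posPartGrad
  exact Measurable.ite (measurableSet_lt measurable_const hf.measurable) (measurable_gradient f)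
    measurable_const

theorem continuous_onePointEstimator {d : ℕ} {f : Vec d → ℝ} (hf : Continuous f) (ε : ℝ) :
    Continuous fun q : Vec d × sphere (0 : Vec d) 1 => onePointEstimator f ε q.1 q.2 := by
  unfold onePointEstimator
  fun_prop

/-- The sent vector as a function of the decision and the exploration direction, when the dual
variable is the scaled constraint violation. -/
def primalStepOfViolation {d p : ℕ} (f : Vec d → ℝ) (con : Fin p → Vec d → ℝ) (β ε K : ℝ)
    (q : Vec d × sphere (0 : Vec d) 1) : Vec d :=
  primalStep f con β ε q.1 (WithLp.toLp 2 fun s => K * max 0 (con s q.1)) q.2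

theorem measurable_primalStepOfViolation {d p : ℕ} {f : Vec d → ℝ} {con : Fin p → Vec d → ℝ}
    (hf : Continuous f) (hcon : ∀ s, Continuous (con s)) (β ε K : ℝ) :
    Measurable (primalStepOfViolation f con β ε K) := by
  unfold primalStepOfViolation primalStep
  refine measurable_fst.sub (Measurable.const_smul
    ((continuous_onePointEstimator hf ε).measurable.add (Finset.measurable_sum _ fun s _ => ?_)) β)
  have h1 : Measurable fun q : Vec d × sphere (0 : Vec d) 1 => K * max 0 (con s q.1) := by
    have := hcon s
    exact Continuous.measurable (by fun_prop)
  exact h1.smul ((measurable_posPartGrad (hcon s)).comp measurable_fst)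

/-- A run only states that each decision is some nearest point. Uniqueness and nonexpansiveness turn
this into a continuous function, from which measurability can be deduced. -/
theorem exists_continuous_projection {d : ℕ} {S : Set (Vec d)} (hS : Convex ℝ S)
    (hc : IsClosed S) (hne : S.Nonempty) :
    ∃ P : Vec d → Vec d, Continuous P ∧ ∀ q z, IsProjection S q z → z = P q := by
  choose P hP using exists_isProjection hS hc hne
  refine ⟨P, ?_, fun q z h => ?_⟩
  · refine LipschitzWith.continuous (K := 1) (LipschitzWith.of_dist_le_mul fun q q' => ?_)
    simpa [dist_eq_norm] using (hP q).norm_sub_le hS (hP q')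
  · have := h.norm_sub_le hS (hP q)
    rw [sub_self, norm_zero] at this
    exact sub_eq_zero.1 (norm_le_zero_iff.1 this)

variable {Ω : Type*} {N d : ℕ} {u : Fin N → ℕ → Ω → sphere (0 : Vec d) 1}

/-- The information generated by the exploration directions before time `t`. -/
@[reducible] def pastInfo (u : Fin N → ℕ → Ω → sphere (0 : Vec d) 1) (t : ℕ) : MeasurableSpace Ω :=
  ⨆ q ∈ {q : Fin N × ℕ | q.2 < t}, MeasurableSpace.comap (u q.1 q.2) inferInstance

theorem comap_le_pastInfo {t s : ℕ} (hst : s < t) (i : Fin N) :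
    MeasurableSpace.comap (u i s) inferInstance ≤ pastInfo u t :=
  le_biSup (fun q : Fin N × ℕ => MeasurableSpace.comap (u q.1 q.2) inferInstance)
    (i := (i, s)) hst

theorem pastInfo_mono {t t' : ℕ} (h : t ≤ t') : pastInfo u t ≤ pastInfo u t' :=
  biSup_mono fun _ hq => lt_of_lt_of_le hq h

variable {p T : ℕ} {R G C K β ε shrink : ℝ} {loss : Fin N → ℕ → Vec d → ℝ}
  {con : Fin p → Vec d → ℝ} {A : ℕ → Matrix (Fin N) (Fin N) ℝ}
  {x : Fin N → ℕ → Ω → Vec d} {lam : Fin N → ℕ → Ω → Vec p}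

theorem mem_closedBall_of_isBanditRun
    (hrun : ∀ ω, IsBanditRun T loss con R A (fun _ => 1 / K) (fun _ => β) (fun _ => ε) shrink
      (fun i t => (u i t ω : Vec d)) (fun i t => x i t ω) (fun i t => lam i t ω))
    (hr : (1 - shrink) * R = R - ε) (hεR : ε ≤ R) {t : ℕ} (ht : t ∈ Finset.Icc 1 T) (i : Fin N)
    (ω : Ω) :
    x i t ω ∈ closedBall (0 : Vec d) (R - ε) :=
  hr ▸ (hrun ω).mem_closedBall (by linarith) ht i

/-- Measurability of the decisions is derived, not assumed: the dual variable is a function of the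
decision, so each decision is a measurable function of the previous decisions and directions. -/
theorem measurable_pastInfo
    (hrun : ∀ ω, IsBanditRun T loss con R A (fun _ => 1 / K) (fun _ => β) (fun _ => ε) shrink
      (fun i t => (u i t ω : Vec d)) (fun i t => x i t ω) (fun i t => lam i t ω))
    (hr : 0 ≤ (1 - shrink) * R) (hK : 0 < K) (hzero : (0 : Vec d) ∈ feasible con)
    (hloss : ∀ i, ∀ t ∈ Finset.Icc 1 T, Continuous (loss i t)) (hcon : ∀ s, Continuous (con s))
    {t : ℕ} (ht : t ∈ Finset.Icc 1 T) (i : Fin N) : Measurable[pastInfo u t] (x i t) := by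
  obtain ⟨P, hPc, hP⟩ := exists_continuous_projection
    (convex_closedBall (0 : Vec d) ((1 - shrink) * R)) isClosed_closedBall
    ⟨0, mem_closedBall_self hr⟩
  induction t generalizing i with
  | zero => simp at ht
  | succ t ih =>
    obtain ⟨h1, h2⟩ := Finset.mem_Icc.1 ht
    rcases Nat.eq_zero_or_pos t with rfl | htpos
    · have : x i (0 + 1) = fun _ => 0 := funext fun ω => (hrun ω).init_x i
      rw [this]; exact measurable_const
    · have ht' : t ∈ Finset.Icc 1 T := Finset.mem_Icc.2 ⟨htpos, by omega⟩
      have hx : x i (t + 1) = fun ω => P (∑ j, A t i j •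
          primalStepOfViolation (loss j t) con β ε K (x j t ω, u j t ω)) := by
        funext ω
        have h3 := hP _ _ ((hrun ω).update_x t ht' i)
        refine h3.trans ?_
        congr 1
        refine Finset.sum_congr rfl fun j _ => ?_
        have hlam : lam j t ω = WithLp.toLp 2 fun s => K * max 0 (con s (x j t ω)) := by
          ext s
          exact (hrun ω).lam_eq hK hzero ht' j s
        rw [primalStepOfViolation, hlam]
      rw [hx]
      refine hPc.measurable.comp (Finset.measurable_sum _ fun j _ => ?_)
      refine (continuous_const_smul (A t i j)).measurable.comp
        ((measurable_primalStepOfViolation (hloss j t ht') hcon β ε K).comp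
        (Measurable.prodMk ((ih ht' j).mono (pastInfo_mono t.le_succ) le_rfl) ?_))
      exact (comap_measurable (u j t)).mono (comap_le_pastInfo t.lt_succ_self j) le_rfl

variable [MeasurableSpace Ω] {μ : Measure Ω}

theorem pastInfo_le (hu : ∀ i t, Measurable (u i t)) (t : ℕ) :
    pastInfo u t ≤ (inferInstance : MeasurableSpace Ω) :=
  iSup₂_le fun q _ => (hu q.1 q.2).comap_le

theorem indepFun_of_measurable_pastInfo (hu : ∀ i t, Measurable (u i t))
    (hind : iIndepFun (fun q : Fin N × ℕ => u q.1 q.2) μ) {t : ℕ} {X : Ω → Vec d}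
    (hX : Measurable[pastInfo u t] X) (i : Fin N) : IndepFun X (u i t) μ := by
  have h := indep_iSup_of_disjoint (fun q : Fin N × ℕ => (hu q.1 q.2).comap_le)
    hind.iIndep (S := {q : Fin N × ℕ | q.2 < t}) (T := {(i, t)})
    (by rw [Set.disjoint_singleton_right]; simp)
  simp only [Set.mem_singleton_iff, iSup_iSup_eq_left] at h
  rw [IndepFun_iff_Indep]
  exact indep_of_indep_of_le_left h hX.comap_le

variable [IsProbabilityMeasure μ]

theorem integrable_comp_of_mem_closedBall {r : ℝ} {X : Ω → Vec d} (hX : Measurable X)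
    (hXr : ∀ ω, X ω ∈ closedBall (0 : Vec d) r) {h : Vec d → ℝ} (hh : Continuous h) :
    Integrable (fun ω => h (X ω)) μ := by
  obtain ⟨M, hM⟩ :=
    (isCompact_closedBall (0 : Vec d) r).exists_bound_of_continuousOn hh.continuousOn
  exact Integrable.of_bound (hh.measurable.comp hX).aestronglyMeasurable M
    (.of_forall fun ω => hM _ (hXr ω))

theorem integrable_inner_onePointEstimator {r : ℝ} {X : Ω → Vec d} (hX : Measurable X)
    {U : Ω → sphere (0 : Vec d) 1} (hU : Measurable U)
    (hXr : ∀ ω, X ω ∈ closedBall (0 : Vec d) r) {f : Vec d → ℝ} (hf : Continuous f)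
    (z : Vec d) :
    Integrable (fun ω => inner ℝ (onePointEstimator f ε (X ω) (U ω)) (X ω - z)) μ := by
  have hc : Continuous fun q : Vec d × sphere (0 : Vec d) 1 =>
      inner ℝ (onePointEstimator f ε q.1 q.2) (q.1 - z) :=
    (continuous_onePointEstimator hf ε).inner (continuous_fst.sub continuous_const)
  obtain ⟨M, hM⟩ := ((isCompact_closedBall (0 : Vec d) r).prod
    (isCompact_univ (X := sphere (0 : Vec d) 1))).exists_bound_of_continuousOn hc.continuousOn
  exact Integrable.of_bound (hc.measurable.comp (hX.prodMk hU)).aestronglyMeasurable M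
    (.of_forall fun ω => hM (X ω, U ω) ⟨hXr ω, Set.mem_univ _⟩)

/-- By independence the joint law is a product, so Fubini allows averaging over the direction at
each fixed decision. This takes the place of conditional expectation. -/
theorem integral_smoothed_sub_le (hd : 1 ≤ d) {X : Ω → Vec d} (hX : Measurable X)
    {U : Ω → sphere (0 : Vec d) 1} (hU : Measurable U) (hUlaw : μ.map U = uniformSphere d)
    (hind : IndepFun X U μ) (hXr : ∀ ω, X ω ∈ closedBall (0 : Vec d) (R - ε)) (hε : 0 < ε)
    {f : Vec d → ℝ} (hf : ConvexOn ℝ Set.univ f)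
    (hgrad : ∀ y ∈ closedBall (0 : Vec d) R, DifferentiableAt ℝ f y ∧ ‖gradient f y‖ ≤ G)
    (z : Vec d) :
    ∫ ω, (smoothed f ε (X ω) - smoothed f ε z) ∂μ
      ≤ ∫ ω, inner ℝ (onePointEstimator f ε (X ω) (U ω)) (X ω - z) ∂μ := by
  have hfc := continuous_of_convexOn hf
  have := isProbabilityMeasure_uniformSphere hd
  have hsm := continuous_smoothed hfc ε
  set Φ : Vec d × sphere (0 : Vec d) 1 → ℝ := fun q =>
      inner ℝ (onePointEstimator f ε q.1 q.2) (q.1 - z) with hΦ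
  have hc : Continuous Φ :=
    (continuous_onePointEstimator hfc ε).inner (continuous_fst.sub continuous_const)
  have hint := integrable_inner_onePointEstimator (μ := μ) (ε := ε) hX hU hXr hfc z
  have hmap : μ.map (fun ω => (X ω, U ω)) = (μ.map X).prod (uniformSphere d) := by
    rw [(indepFun_iff_map_prod_eq_prod_map_map hX.aemeasurable hU.aemeasurable).1 hind, hUlaw]
  have hprob : IsProbabilityMeasure (μ.map X) := Measure.isProbabilityMeasure_map hX.aemeasurable
  have hintΦ : Integrable Φ ((μ.map X).prod (uniformSphere d)) := by
    rw [← hmap, integrable_map_measure hc.measurable.aestronglyMeasurable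
      (hX.prodMk hU).aemeasurable]
    exact hint
  have e1 : ∫ ω, inner ℝ (onePointEstimator f ε (X ω) (U ω)) (X ω - z) ∂μ
      = ∫ y, ∫ s, Φ (y, s) ∂(uniformSphere d) ∂(μ.map X) := by
    rw [← integral_prod _ hintΦ, ← hmap, integral_map (hX.prodMk hU).aemeasurable
      hc.measurable.aestronglyMeasurable]
  have hsmm : AEStronglyMeasurable (fun y => smoothed f ε y - smoothed f ε z) (μ.map X) :=
    (hsm.sub continuous_const).measurable.aestronglyMeasurable
  have e2 : ∫ ω, (smoothed f ε (X ω) - smoothed f ε z) ∂μ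
      = ∫ y, (smoothed f ε y - smoothed f ε z) ∂(μ.map X) := by
    rw [integral_map hX.aemeasurable hsmm]
  rw [e1, e2]
  refine integral_mono_ae ?_ hintΦ.integral_prod_left ?_
  · rw [integrable_map_measure hsmm hX.aemeasurable]
    exact integrable_comp_of_mem_closedBall hX hXr (hsm.sub continuous_const)
  · have : ∀ᵐ y ∂(μ.map X), y ∈ closedBall (0 : Vec d) (R - ε) :=
      (ae_map_iff hX.aemeasurable measurableSet_closedBall).2 (.of_forall hXr)
    filter_upwards [this] with y hy
    exact smoothed_sub_le_integral_onePointEstimator hd hf hε hgrad hy z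

theorem sq_integral_le_of_sq_le {V W : Ω → ℝ} (hV : Integrable V μ) (hW : Integrable W μ)
    (h : ∀ ω, V ω ^ 2 ≤ W ω) : (∫ ω, V ω ∂μ) ^ 2 ≤ ∫ ω, W ω ∂μ := by
  set m := ∫ ω, V ω ∂μ with hm
  have h1 : 0 ≤ ∫ ω, (W ω - 2 * m * V ω + m ^ 2) ∂μ :=
    integral_nonneg fun ω => by
      simp only [Pi.zero_apply]; nlinarith [h ω, sq_nonneg (V ω - m)]
  have e1 : ∫ ω, (W ω - 2 * m * V ω + m ^ 2) ∂μ = (∫ ω, (W ω - 2 * m * V ω) ∂μ) + m ^ 2 := by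
    rw [integral_add (f := fun ω => W ω - 2 * m * V ω) (hW.sub (hV.const_mul _))
      (integrable_const _)]
    simp
  have e2 : ∫ ω, (W ω - 2 * m * V ω) ∂μ = (∫ ω, W ω ∂μ) - 2 * m * m := by
    rw [integral_sub hW (hV.const_mul _), integral_const_mul]
  rw [e1, e2] at h1
  nlinarith

end Probability

/-! ### Expected regret and expected violation -/

section Expectation

open Metric

variable {Ω : Type*} [MeasurableSpace Ω] {μ : Measure Ω} [IsProbabilityMeasure μ]
  {d N p T B : ℕ} {R G C ζ a K β ε shrink : ℝ} {loss : Fin N → ℕ → Vec d → ℝ}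
  {con : Fin p → Vec d → ℝ} {graph : ℕ → Digraph (Fin N)} {A : ℕ → Matrix (Fin N) (Fin N) ℝ}
  {u : Fin N → ℕ → Ω → sphere (0 : Vec d) 1}
  {x : Fin N → ℕ → Ω → Vec d} {lam : Fin N → ℕ → Ω → Vec p}

theorem smul_mem_feasible (hconv : ∀ s, ConvexOn ℝ Set.univ (con s))
    (hzero : (0 : Vec d) ∈ feasible con) {y : Vec d} (hy : y ∈ feasible con) {r : ℝ} (h0 : 0 ≤ r)
    (h1 : r ≤ 1) : r • y ∈ feasible con := by
  intro s
  have := (hconv s).2 (Set.mem_univ y) (Set.mem_univ 0) h0 (sub_nonneg.2 h1) (by ring)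
  simp only [smul_zero, add_zero, smul_eq_mul] at this
  nlinarith [hy s, hzero s]

/-- The factor `3` counts errors of size `G ε`: smoothing at `y j t`, smoothing at `z`, and moving
from `z` to `w`. -/
theorem regret_le_of_smoothed {loss : Fin N → ℕ → Vec d → ℝ} (hε : 0 ≤ ε)
    (hlossc : ∀ i, ∀ t ∈ Finset.Icc 1 T, Continuous (loss i t))
    (hlossg : ∀ i, ∀ t ∈ Finset.Icc 1 T, ∀ y ∈ closedBall (0 : Vec d) R,
      DifferentiableAt ℝ (loss i t) y ∧ ‖gradient (loss i t) y‖ ≤ G)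
    {y : Fin N → ℕ → Vec d} (hy : ∀ t ∈ Finset.Icc 1 T, ∀ i, y i t ∈ closedBall 0 (R - ε))
    {z w : Vec d} (hz : z ∈ closedBall (0 : Vec d) (R - ε)) (hw : w ∈ closedBall (0 : Vec d) R)
    (hzw : ‖z - w‖ ≤ ε) (hG : 0 ≤ G) (i : Fin N) :
    regret T loss w (y i) ≤ G * ∑ t ∈ Finset.Icc 1 T, ∑ j, ‖y i t - y j t‖
      + 3 * N * G * (ε * T)
      + ∑ t ∈ Finset.Icc 1 T, ∑ j, (smoothed (loss j t) ε (y j t) - smoothed (loss j t) ε z) := by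
  have hsub : closedBall (0 : Vec d) (R - ε) ⊆ closedBall 0 R :=
    closedBall_subset_closedBall (by linarith)
  have e : G * ∑ t ∈ Finset.Icc 1 T, ∑ j, ‖y i t - y j t‖ + 3 * N * G * (ε * T)
      + ∑ t ∈ Finset.Icc 1 T, ∑ j, (smoothed (loss j t) ε (y j t) - smoothed (loss j t) ε z)
      = ∑ t ∈ Finset.Icc 1 T, ∑ j, (G * ‖y i t - y j t‖ + 3 * G * ε
        + (smoothed (loss j t) ε (y j t) - smoothed (loss j t) ε z)) := by
    simp only [Finset.sum_add_distrib, ← Finset.mul_sum, Finset.sum_const, Finset.card_univ,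
      Fintype.card_fin, Nat.card_Icc, Nat.add_sub_cancel, nsmul_eq_mul]
    ring
  rw [e, regret, totalLoss, ← Finset.sum_sub_distrib]
  refine Finset.sum_le_sum fun t ht => ?_
  rw [← Finset.sum_sub_distrib]
  refine Finset.sum_le_sum fun j _ => ?_
  have b1 := (abs_le.1 (abs_sub_le_of_gradient_le (hlossg j t ht) (hsub (hy t ht i))
    (hsub (hy t ht j)))).2
  have b2 := (abs_le.1 (abs_smoothed_sub_le (hlossc j t ht) hε (hlossg j t ht) (hy t ht j))).1
  have b3 := (abs_le.1 (abs_smoothed_sub_le (hlossc j t ht) hε (hlossg j t ht) hz)).2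
  have b4 := (abs_le.1 (abs_sub_le_of_gradient_le (hlossg j t ht) (hsub hz) hw)).2
  have b5 := mul_le_mul_of_nonneg_left hzw hG
  linarith

theorem neg_le_sum_smoothed_sub {loss : Fin N → ℕ → Vec d → ℝ} (hε : 0 ≤ ε)
    (hlossc : ∀ i, ∀ t ∈ Finset.Icc 1 T, Continuous (loss i t))
    (hlossg : ∀ i, ∀ t ∈ Finset.Icc 1 T, ∀ y ∈ closedBall (0 : Vec d) R,
      DifferentiableAt ℝ (loss i t) y ∧ ‖gradient (loss i t) y‖ ≤ G)
    {y : Fin N → ℕ → Vec d} (hy : ∀ t ∈ Finset.Icc 1 T, ∀ i, y i t ∈ closedBall 0 (R - ε))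
    {z : Vec d} (hz : z ∈ closedBall (0 : Vec d) (R - ε)) (hG : 0 ≤ G) :
    -(T * (N * (2 * G * R)))
      ≤ ∑ t ∈ Finset.Icc 1 T, ∑ j, (smoothed (loss j t) ε (y j t) - smoothed (loss j t) ε z) := by
  have hsub : closedBall (0 : Vec d) (R - ε) ⊆ closedBall 0 R :=
    closedBall_subset_closedBall (by linarith)
  have e : -(T * (N * (2 * G * R))) = ∑ t ∈ Finset.Icc 1 T, ∑ j : Fin N, -(2 * G * R) := by
    simp
  rw [e]
  refine Finset.sum_le_sum fun t ht => Finset.sum_le_sum fun j _ => ?_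
  have hyt := hy t ht j
  have b1 := (abs_le.1 (abs_sub_le_of_gradient_le (hlossg j t ht) (hsub hyt) (hsub hz))).1
  have b2 := (abs_le.1 (abs_smoothed_sub_le (hlossc j t ht) hε (hlossg j t ht) hyt)).1
  have b3 := (abs_le.1 (abs_smoothed_sub_le (hlossc j t ht) hε (hlossg j t ht) hz)).2
  -- Both points lie in the shrunken ball, so the distance term `2G(R - ε)` and the two smoothing
  -- errors add up to exactly `2GR`.
  have b4 : ‖y j t - z‖ ≤ 2 * (R - ε) := by
    rw [mem_closedBall_zero_iff] at hyt hz
    linarith [norm_sub_le (y j t) z]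
  have b5 := mul_le_mul_of_nonneg_left b4 hG
  linarith

theorem measurable_of_isBanditRun
    (hrun : ∀ ω, IsBanditRun T loss con R A (fun _ => 1 / K) (fun _ => β) (fun _ => ε) shrink
      (fun i t => (u i t ω : Vec d)) (fun i t => x i t ω) (fun i t => lam i t ω))
    (hr : (1 - shrink) * R = R - ε) (hεR : ε ≤ R) (hK : 0 < K) (hzero : (0 : Vec d) ∈ feasible con)
    (hlossc : ∀ i, ∀ t ∈ Finset.Icc 1 T, ConvexOn ℝ Set.univ (loss i t))
    (hconc : ∀ s, ConvexOn ℝ Set.univ (con s)) (hu : ∀ i t, Measurable (u i t)) {t : ℕ}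
    (ht : t ∈ Finset.Icc 1 T) (i : Fin N) :
    Measurable (x i t) :=
  (measurable_pastInfo hrun (by linarith) hK hzero
    (fun i t ht => continuous_of_convexOn (hlossc i t ht))
    (fun s => continuous_of_convexOn (hconc s)) ht i).mono (pastInfo_le hu t) le_rfl

theorem integrable_violation_pow
    (hrun : ∀ ω, IsBanditRun T loss con R A (fun _ => 1 / K) (fun _ => β) (fun _ => ε) shrink
      (fun i t => (u i t ω : Vec d)) (fun i t => x i t ω) (fun i t => lam i t ω))
    (hr : (1 - shrink) * R = R - ε) (hεR : ε ≤ R) (hK : 0 < K) (hzero : (0 : Vec d) ∈ feasible con)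
    (hlossc : ∀ i, ∀ t ∈ Finset.Icc 1 T, ConvexOn ℝ Set.univ (loss i t))
    (hconc : ∀ s, ConvexOn ℝ Set.univ (con s)) (hu : ∀ i t, Measurable (u i t)) {t : ℕ}
    (ht : t ∈ Finset.Icc 1 T) (i : Fin N) (s : Fin p) (n : ℕ) :
    Integrable (fun ω => max 0 (con s (x i t ω)) ^ n) μ := by
  have hc := continuous_of_convexOn (hconc s)
  exact integrable_comp_of_mem_closedBall (h := fun y => max 0 (con s y) ^ n)
    (measurable_of_isBanditRun hrun hr hεR hK hzero hlossc hconc hu ht i)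
    (mem_closedBall_of_isBanditRun hrun hr hεR ht i)
    (by fun_prop)

theorem integrable_regret
    (hrun : ∀ ω, IsBanditRun T loss con R A (fun _ => 1 / K) (fun _ => β) (fun _ => ε) shrink
      (fun i t => (u i t ω : Vec d)) (fun i t => x i t ω) (fun i t => lam i t ω))
    (hr : (1 - shrink) * R = R - ε) (hεR : ε ≤ R) (hK : 0 < K) (hzero : (0 : Vec d) ∈ feasible con)
    (hlossc : ∀ i, ∀ t ∈ Finset.Icc 1 T, ConvexOn ℝ Set.univ (loss i t))
    (hconc : ∀ s, ConvexOn ℝ Set.univ (con s)) (hu : ∀ i t, Measurable (u i t)) (w : Vec d)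
    (i : Fin N) :
    Integrable (fun ω => regret T loss w (fun t => x i t ω)) μ := by
  unfold regret
  refine Integrable.sub (integrable_finsetSum _ fun t ht => integrable_finsetSum _ fun j _ => ?_)
    (integrable_const _)
  exact integrable_comp_of_mem_closedBall
    (measurable_of_isBanditRun hrun hr hεR hK hzero hlossc hconc hu ht i)
    (mem_closedBall_of_isBanditRun hrun hr hεR ht i)
    (continuous_of_convexOn (hlossc j t ht))

theorem integrable_sum_violation_pow
    (hrun : ∀ ω, IsBanditRun T loss con R A (fun _ => 1 / K) (fun _ => β) (fun _ => ε) shrink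
      (fun i t => (u i t ω : Vec d)) (fun i t => x i t ω) (fun i t => lam i t ω))
    (hr : (1 - shrink) * R = R - ε) (hεR : ε ≤ R) (hK : 0 < K) (hzero : (0 : Vec d) ∈ feasible con)
    (hlossc : ∀ i, ∀ t ∈ Finset.Icc 1 T, ConvexOn ℝ Set.univ (loss i t))
    (hconc : ∀ s, ConvexOn ℝ Set.univ (con s)) (hu : ∀ i t, Measurable (u i t)) (n : ℕ) :
    Integrable (fun ω => ∑ t ∈ Finset.Icc 1 T, ∑ j, ∑ s, max 0 (con s (x j t ω)) ^ n) μ :=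
  integrable_finsetSum _ fun _ ht => integrable_finsetSum _ fun j _ =>
    integrable_finsetSum _ fun s _ =>
      integrable_violation_pow hrun hr hεR hK hzero hlossc hconc hu ht j s n

theorem integrable_sum_smoothed_sub
    (hrun : ∀ ω, IsBanditRun T loss con R A (fun _ => 1 / K) (fun _ => β) (fun _ => ε) shrink
      (fun i t => (u i t ω : Vec d)) (fun i t => x i t ω) (fun i t => lam i t ω))
    (hr : (1 - shrink) * R = R - ε) (hεR : ε ≤ R) (hK : 0 < K) (hzero : (0 : Vec d) ∈ feasible con)
    (hlossc : ∀ i, ∀ t ∈ Finset.Icc 1 T, ConvexOn ℝ Set.univ (loss i t))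
    (hconc : ∀ s, ConvexOn ℝ Set.univ (con s)) (hu : ∀ i t, Measurable (u i t)) (z : Vec d) :
    Integrable (fun ω => ∑ t ∈ Finset.Icc 1 T, ∑ j,
      (smoothed (loss j t) ε (x j t ω) - smoothed (loss j t) ε z)) μ :=
  integrable_finsetSum _ fun t ht => integrable_finsetSum _ fun j _ =>
    integrable_comp_of_mem_closedBall
      (h := fun y => smoothed (loss j t) ε y - smoothed (loss j t) ε z)
      (measurable_of_isBanditRun hrun hr hεR hK hzero hlossc hconc hu ht j)
      (mem_closedBall_of_isBanditRun hrun hr hεR ht j)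
      ((continuous_smoothed (continuous_of_convexOn (hlossc j t ht)) ε).sub continuous_const)

/-- Cauchy-Schwarz over the `T N p` terms for each outcome, then Jensen's inequality for the square.
-/
theorem sq_expectedViolation_le
    (hrun : ∀ ω, IsBanditRun T loss con R A (fun _ => 1 / K) (fun _ => β) (fun _ => ε) shrink
      (fun i t => (u i t ω : Vec d)) (fun i t => x i t ω) (fun i t => lam i t ω))
    (hr : (1 - shrink) * R = R - ε) (hεR : ε ≤ R) (hK : 0 < K) (hzero : (0 : Vec d) ∈ feasible con)
    (hlossc : ∀ i, ∀ t ∈ Finset.Icc 1 T, ConvexOn ℝ Set.univ (loss i t))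
    (hconc : ∀ s, ConvexOn ℝ Set.univ (con s)) (hu : ∀ i t, Measurable (u i t)) :
    expectedViolation μ T con x ^ 2 ≤ T * (N * p) *
      ∫ ω, ∑ t ∈ Finset.Icc 1 T, ∑ j, ∑ s, max 0 (con s (x j t ω)) ^ 2 ∂μ := by
  have hi1 : ∀ t ∈ Finset.Icc 1 T, ∀ j s, Integrable (fun ω => max 0 (con s (x j t ω))) μ :=
    fun t ht j s => by
      simpa using integrable_violation_pow hrun hr hεR hK hzero hlossc hconc hu ht j s 1
  have hV2 := integrable_sum_violation_pow (μ := μ) hrun hr hεR hK hzero hlossc hconc hu 2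
  have e : expectedViolation μ T con x
      = ∫ ω, ∑ t ∈ Finset.Icc 1 T, ∑ j, ∑ s, max 0 (con s (x j t ω)) ∂μ := by
    rw [expectedViolation, integral_finsetSum _ fun t ht => integrable_finsetSum _ fun j _ =>
      integrable_finsetSum _ fun s _ => hi1 t ht j s]
    refine Finset.sum_congr rfl fun t ht => ?_
    rw [integral_finsetSum _ fun j _ => integrable_finsetSum _ fun s _ => hi1 t ht j s]
    refine Finset.sum_congr rfl fun j _ => ?_
    rw [integral_finsetSum _ fun s _ => hi1 t ht j s]
  rw [e, ← integral_const_mul]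
  refine sq_integral_le_of_sq_le (integrable_finsetSum _ fun t ht =>
    integrable_finsetSum _ fun j _ => integrable_finsetSum _ fun s _ => hi1 t ht j s)
    (hV2.const_mul _) fun ω => ?_
  have h1 := sq_sum_le_card_mul_sum_sq
    (s := (Finset.Icc 1 T) ×ˢ ((Finset.univ : Finset (Fin N)) ×ˢ (Finset.univ : Finset (Fin p))))
    (f := fun q => max 0 (con q.2.2 (x q.2.1 q.1 ω)))
  simp only [Finset.sum_product, Finset.card_product, Nat.card_Icc, Finset.card_univ,
    Fintype.card_fin, Nat.add_sub_cancel, Nat.cast_mul] at h1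
  exact h1

theorem integral_sum_smoothed_sub_add_le
    (hrun : ∀ ω, IsBanditRun T loss con R A (fun _ => 1 / K) (fun _ => β) (fun _ => ε) shrink
      (fun i t => (u i t ω : Vec d)) (fun i t => x i t ω) (fun i t => lam i t ω))
    (hr : (1 - shrink) * R = R - ε) (hεR : ε ≤ R) (hε : 0 < ε) (hK : 0 < K)
    (hzero : (0 : Vec d) ∈ feasible con)
    (hlossc : ∀ i, ∀ t ∈ Finset.Icc 1 T, ConvexOn ℝ Set.univ (loss i t))
    (hconc : ∀ s, ConvexOn ℝ Set.univ (con s)) (hu : ∀ i t, Measurable (u i t))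
    (hgradl : ∀ i, ∀ t ∈ Finset.Icc 1 T, ∀ y ∈ closedBall (0 : Vec d) R,
      DifferentiableAt ℝ (loss i t) y ∧ ‖gradient (loss i t) y‖ ≤ G)
    (hgradc : ∀ s, ∀ y ∈ closedBall (0 : Vec d) R,
      DifferentiableAt ℝ (con s) y ∧ ‖gradient (con s) y‖ ≤ G)
    (hbdd : ∀ i, ∀ t ∈ Finset.Icc 1 T, ∀ y ∈ closedBall (0 : Vec d) R, |loss i t y| ≤ C)
    (hA : ∀ t, 1 ≤ t → IsWeightMatrix (graph t) ζ (A t)) (hd : 1 ≤ d)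
    (hulaw : ∀ i t, μ.map (u i t) = uniformSphere d)
    (huind : iIndepFun (fun q : Fin N × ℕ => u q.1 q.2) μ) (hG : 0 < G) (ha : 1 < a) (hp : 1 ≤ p)
    (hβ : β = 1 / (a * p * G ^ 2 * K)) {z : Vec d} (hz : z ∈ closedBall (0 : Vec d) (R - ε))
    (hzc : z ∈ feasible con) :
    ∫ ω, ∑ t ∈ Finset.Icc 1 T, ∑ j,
        (smoothed (loss j t) ε (x j t ω) - smoothed (loss j t) ε z) ∂μ
      + (a - 1) / a * K * ∫ ω, ∑ t ∈ Finset.Icc 1 T, ∑ j, ∑ s, max 0 (con s (x j t ω)) ^ 2 ∂μ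
      ≤ N * R ^ 2 / (2 * β) + β * (T * (N * (d * C / ε) ^ 2)) := by
  have hp' : (0 : ℝ) < p := by exact_mod_cast hp
  have ha0 : 0 < a := by linarith
  have hβ0 : 0 < β := by rw [hβ]; positivity
  have hmeas := fun t ht i =>
    measurable_of_isBanditRun hrun hr hεR hK hzero hlossc hconc hu (t := t) ht i
  have hball := fun t ht i =>
    mem_closedBall_of_isBanditRun hrun hr hεR (t := t) ht i
  have hV2 := integrable_sum_violation_pow (μ := μ) hrun hr hεR hK hzero hlossc hconc hu 2
  have hint : ∀ t ∈ Finset.Icc 1 T, ∀ j, Integrable (fun ω =>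
      inner ℝ (onePointEstimator (loss j t) ε (x j t ω) (u j t ω)) (x j t ω - z)) μ :=
    fun t ht j => integrable_inner_onePointEstimator (hmeas t ht j) (hu j t) (hball t ht j)
      (continuous_of_convexOn (hlossc j t ht)) z
  have hsm : ∀ t ∈ Finset.Icc 1 T, ∀ j, Integrable (fun ω =>
      smoothed (loss j t) ε (x j t ω) - smoothed (loss j t) ε z) μ :=
    fun t ht j => integrable_comp_of_mem_closedBall
      (h := fun y => smoothed (loss j t) ε y - smoothed (loss j t) ε z)
      (hmeas t ht j) (hball t ht j)
      ((continuous_smoothed (continuous_of_convexOn (hlossc j t ht)) ε).sub continuous_const)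
  have hIN : Integrable (fun ω => ∑ t ∈ Finset.Icc 1 T, ∑ j,
      inner ℝ (onePointEstimator (loss j t) ε (x j t ω) (u j t ω)) (x j t ω - z)) μ :=
    integrable_finsetSum _ fun t ht => integrable_finsetSum _ fun j _ => hint t ht j
  have hstep1 : ∫ ω, ∑ t ∈ Finset.Icc 1 T, ∑ j,
        (smoothed (loss j t) ε (x j t ω) - smoothed (loss j t) ε z) ∂μ
      ≤ ∫ ω, ∑ t ∈ Finset.Icc 1 T, ∑ j,
        inner ℝ (onePointEstimator (loss j t) ε (x j t ω) (u j t ω)) (x j t ω - z) ∂μ := by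
    rw [integral_finsetSum _ fun t ht => integrable_finsetSum _ fun j _ => hsm t ht j,
      integral_finsetSum _ fun t ht => integrable_finsetSum _ fun j _ => hint t ht j]
    refine Finset.sum_le_sum fun t ht => ?_
    rw [integral_finsetSum _ fun j _ => hsm t ht j, integral_finsetSum _ fun j _ => hint t ht j]
    refine Finset.sum_le_sum fun j _ => ?_
    have hind := indepFun_of_measurable_pastInfo hu huind (measurable_pastInfo hrun (by linarith)
      hK hzero (fun i t ht => continuous_of_convexOn (hlossc i t ht))
      (fun s => continuous_of_convexOn (hconc s)) ht j) j
    exact integral_smoothed_sub_le hd (hmeas t ht j) (hu j t) (hulaw j t) hind (hball t ht j) hε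
      (hlossc j t ht) (hgradl j t ht) z
  have hpath : ∀ ω, ∑ t ∈ Finset.Icc 1 T, ∑ j,
        inner ℝ (onePointEstimator (loss j t) ε (x j t ω) (u j t ω)) (x j t ω - z)
      ≤ (N * R ^ 2 / (2 * β) + β * (T * (N * (d * C / ε) ^ 2))) -
        (a - 1) / a * K * ∑ t ∈ Finset.Icc 1 T, ∑ j, ∑ s, max 0 (con s (x j t ω)) ^ 2 := by
    intro ω
    have h := (hrun ω).sum_inner_add_le hr hεR hε hK hβ0 hzero
      (fun i t => norm_eq_of_mem_sphere (u i t ω)) hgradc hbdd hA hconc hz hzc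
    -- The step size is tuned for this: the squared dual steps use up only the fraction `1 / a` of
    -- the gain `K Σ [c_s]_+²`.
    have e1 : β * ((G * K) ^ 2 * p) = K / a := by rw [hβ]; field_simp
    have e2 : (a - 1) / a * K = K - K / a := by field_simp
    rw [e2, ← e1]
    linarith
  have hstep2 := integral_mono hIN ((integrable_const _).sub (hV2.const_mul _)) hpath
  simp only [Pi.sub_apply] at hstep2
  rw [integral_sub (integrable_const _) (hV2.const_mul _), integral_const_mul] at hstep2
  simp only [integral_const, probReal_univ, one_smul] at hstep2
  linarith

theorem integral_regret_le
    (hrun : ∀ ω, IsBanditRun T loss con R A (fun _ => 1 / K) (fun _ => β) (fun _ => ε) shrink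
      (fun i t => (u i t ω : Vec d)) (fun i t => x i t ω) (fun i t => lam i t ω))
    (hr : (1 - shrink) * R = R - ε) (hεR : ε ≤ R) (hε : 0 < ε) (hK : 0 < K)
    (hzero : (0 : Vec d) ∈ feasible con)
    (hlossc : ∀ i, ∀ t ∈ Finset.Icc 1 T, ConvexOn ℝ Set.univ (loss i t))
    (hconc : ∀ s, ConvexOn ℝ Set.univ (con s)) (hu : ∀ i t, Measurable (u i t))
    (hgradl : ∀ i, ∀ t ∈ Finset.Icc 1 T, ∀ y ∈ closedBall (0 : Vec d) R,
      DifferentiableAt ℝ (loss i t) y ∧ ‖gradient (loss i t) y‖ ≤ G)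
    (hgradc : ∀ s, ∀ y ∈ closedBall (0 : Vec d) R,
      DifferentiableAt ℝ (con s) y ∧ ‖gradient (con s) y‖ ≤ G)
    (hbdd : ∀ i, ∀ t ∈ Finset.Icc 1 T, ∀ y ∈ closedBall (0 : Vec d) R, |loss i t y| ≤ C)
    (hA : ∀ t, 1 ≤ t → IsWeightMatrix (graph t) ζ (A t)) (hd : 1 ≤ d)
    (hulaw : ∀ i t, μ.map (u i t) = uniformSphere d)
    (huind : iIndepFun (fun q : Fin N × ℕ => u q.1 q.2) μ) (hG : 0 < G) (ha : 1 < a) (hp : 1 ≤ p)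
    (hβ : β = 1 / (a * p * G ^ 2 * K)) (hN : 1 ≤ N) (hB : 1 ≤ B) (hζ : 0 < ζ)
    (hgraph : JointlyConnected graph B) {z w : Vec d} (hz : z ∈ closedBall (0 : Vec d) (R - ε))
    (hzc : z ∈ feasible con) (hw : w ∈ closedBall (0 : Vec d) R) (hzw : ‖z - w‖ ≤ ε) (i : Fin N) :
    ∫ ω, regret T loss w (fun t => x i t ω) ∂μ
      ≤ 3 * N * G * (ε * T) + G * (hatC N B ζ * (β * (T * (N * (d * C / ε)))))
        + (N * R ^ 2 / (2 * β) + β * (T * (N * (d * C / ε) ^ 2)))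
        + T * (N * (p * (hatC N B ζ ^ 2 / (4 * a * (a - 1) * p ^ 2 * K)))) := by
  have hp' : (0 : ℝ) < p := by exact_mod_cast hp
  have ha0 : 0 < a := by linarith
  have ha1 : 0 < a - 1 := by linarith
  have hβ0 : 0 < β := by rw [hβ]; positivity
  have hball := fun t ht i =>
    mem_closedBall_of_isBanditRun hrun hr hεR (t := t) ht i
  have hV1 := integrable_sum_violation_pow (μ := μ) hrun hr hεR hK hzero hlossc hconc hu 1
  have hV2 := integrable_sum_violation_pow (μ := μ) hrun hr hεR hK hzero hlossc hconc hu 2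
  have hSM := integrable_sum_smoothed_sub (μ := μ) hrun hr hεR hK hzero hlossc hconc hu z
  have hReg := integrable_regret (μ := μ) hrun hr hεR hK hzero hlossc hconc hu w i
  simp only [pow_one] at hV1
  have hE := integral_sum_smoothed_sub_add_le (μ := μ) hrun hr hεR hε hK hzero hlossc hconc hu
    hgradl hgradc hbdd hA hd hulaw huind hG ha hp hβ hz hzc
  set H := hatC N B ζ
  -- The disagreement contributes `H / (a p)` times each violation, because `β G² K = 1 / (a p)`.
  -- Its maximum against the surviving quadratic gain is the last term of the regret constant.
  have hquad : ∀ v : ℝ, H / (a * p) * v - (a - 1) / a * K * v ^ 2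
      ≤ H ^ 2 / (4 * a * (a - 1) * p ^ 2 * K) := by
    intro v
    have : H ^ 2 / (4 * a * (a - 1) * p ^ 2 * K) - (H / (a * p) * v - (a - 1) / a * K * v ^ 2)
        = (a - 1) * K / a * (v - H / (2 * p * (a - 1) * K)) ^ 2 := by
      field_simp; ring
    have h2 : 0 ≤ (a - 1) * K / a * (v - H / (2 * p * (a - 1) * K)) ^ 2 := by positivity
    linarith
  have hpath : ∀ ω, regret T loss w (fun t => x i t ω)
      ≤ (3 * N * G * (ε * T) + G * (H * (β * (T * (N * (d * C / ε)))))
          + T * (N * (p * (H ^ 2 / (4 * a * (a - 1) * p ^ 2 * K)))))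
        + ((∑ t ∈ Finset.Icc 1 T, ∑ j,
          (smoothed (loss j t) ε (x j t ω) - smoothed (loss j t) ε z))
        + (a - 1) / a * K * ∑ t ∈ Finset.Icc 1 T, ∑ j, ∑ s, max 0 (con s (x j t ω)) ^ 2) := by
    intro ω
    have h1 := regret_le_of_smoothed (y := fun i t => x i t ω) hε.le
      (fun i t ht => continuous_of_convexOn (hlossc i t ht)) hgradl
      (fun t ht j => hball t ht j ω) hz hw hzw hG.le i
    have h2 := mul_le_mul_of_nonneg_left ((hrun ω).sum_norm_sub_le hr hεR hε hK hβ0 hzero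
      (fun i t => norm_eq_of_mem_sphere (u i t ω)) hgradc hbdd hA hN hB hζ hgraph i) hG.le
    have h3 : ∑ t ∈ Finset.Icc 1 T, ∑ j, ∑ s, (H / (a * p) * max 0 (con s (x j t ω))
        - (a - 1) / a * K * max 0 (con s (x j t ω)) ^ 2)
        ≤ ∑ t ∈ Finset.Icc 1 T, ∑ j : Fin N, ∑ s : Fin p,
          H ^ 2 / (4 * a * (a - 1) * p ^ 2 * K) :=
      Finset.sum_le_sum fun t _ => Finset.sum_le_sum fun j _ => Finset.sum_le_sum fun s _ =>
        hquad _
    simp only [Finset.sum_add_distrib, Finset.sum_sub_distrib, ← Finset.mul_sum, Finset.sum_const,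
      Finset.card_univ, Fintype.card_fin, Nat.card_Icc, Nat.add_sub_cancel, nsmul_eq_mul] at h2 h3
    have e1 : G * (hatC N B ζ * (β * (N * (T * (d * C / ε)) + G * K *
        ∑ t ∈ Finset.Icc 1 T, ∑ j, ∑ s, max 0 (con s (x j t ω)))))
        = G * (H * (β * (T * (N * (d * C / ε))))) + H / (a * p) *
          ∑ t ∈ Finset.Icc 1 T, ∑ j, ∑ s, max 0 (con s (x j t ω)) := by
      rw [show hatC N B ζ = H from rfl, hβ]; field_simp
    rw [e1] at h2
    simp only [Finset.sum_sub_distrib] at h1 ⊢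
    linarith
  have hsum : Integrable (fun ω => (∑ t ∈ Finset.Icc 1 T, ∑ j,
      (smoothed (loss j t) ε (x j t ω) - smoothed (loss j t) ε z))
      + (a - 1) / a * K * ∑ t ∈ Finset.Icc 1 T, ∑ j, ∑ s, max 0 (con s (x j t ω)) ^ 2) μ :=
    hSM.add (hV2.const_mul _)
  have hmono := integral_mono hReg ((integrable_const _).add hsum) hpath
  simp only [Pi.add_apply] at hmono
  rw [integral_add (integrable_const _) hsum,
    integral_add hSM (hV2.const_mul _), integral_const_mul] at hmono
  simp only [integral_const, probReal_univ, one_smul] at hmono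
  linarith

/-- The smoothed losses are bounded below by the diameter bound, so the central inequality becomes
an upper bound for the expected sum of squared violations. -/
theorem sq_expectedViolation_le_of_bounds
    (hrun : ∀ ω, IsBanditRun T loss con R A (fun _ => 1 / K) (fun _ => β) (fun _ => ε) shrink
      (fun i t => (u i t ω : Vec d)) (fun i t => x i t ω) (fun i t => lam i t ω))
    (hr : (1 - shrink) * R = R - ε) (hεR : ε ≤ R) (hε : 0 < ε) (hK : 0 < K)
    (hzero : (0 : Vec d) ∈ feasible con)
    (hlossc : ∀ i, ∀ t ∈ Finset.Icc 1 T, ConvexOn ℝ Set.univ (loss i t))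
    (hconc : ∀ s, ConvexOn ℝ Set.univ (con s)) (hu : ∀ i t, Measurable (u i t))
    (hgradl : ∀ i, ∀ t ∈ Finset.Icc 1 T, ∀ y ∈ closedBall (0 : Vec d) R,
      DifferentiableAt ℝ (loss i t) y ∧ ‖gradient (loss i t) y‖ ≤ G)
    (hgradc : ∀ s, ∀ y ∈ closedBall (0 : Vec d) R,
      DifferentiableAt ℝ (con s) y ∧ ‖gradient (con s) y‖ ≤ G)
    (hbdd : ∀ i, ∀ t ∈ Finset.Icc 1 T, ∀ y ∈ closedBall (0 : Vec d) R, |loss i t y| ≤ C)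
    (hA : ∀ t, 1 ≤ t → IsWeightMatrix (graph t) ζ (A t)) (hd : 1 ≤ d)
    (hulaw : ∀ i t, μ.map (u i t) = uniformSphere d)
    (huind : iIndepFun (fun q : Fin N × ℕ => u q.1 q.2) μ) (hG : 0 < G) (ha : 1 < a) (hp : 1 ≤ p)
    (hβ : β = 1 / (a * p * G ^ 2 * K)) {z : Vec d} (hz : z ∈ closedBall (0 : Vec d) (R - ε))
    (hzc : z ∈ feasible con) :
    expectedViolation μ T con x ^ 2 ≤ T * (N * p) * (a / ((a - 1) * K) *
      (N * R ^ 2 / (2 * β) + β * (T * (N * (d * C / ε) ^ 2)) + T * (N * (2 * G * R)))) := by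
  have ha0 : 0 < a := by linarith
  have ha1 : 0 < a - 1 := by linarith
  have hball := fun t ht i =>
    mem_closedBall_of_isBanditRun hrun hr hεR (t := t) ht i
  have hSM := integrable_sum_smoothed_sub (μ := μ) hrun hr hεR hK hzero hlossc hconc hu z
  have hE := integral_sum_smoothed_sub_add_le (μ := μ) hrun hr hεR hε hK hzero hlossc hconc hu
    hgradl hgradc hbdd hA hd hulaw huind hG ha hp hβ hz hzc
  refine (sq_expectedViolation_le hrun hr hεR hK hzero hlossc hconc hu).trans
    (mul_le_mul_of_nonneg_left ?_ (by positivity))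
  have hlow := integral_mono (integrable_const _) hSM fun ω =>
    neg_le_sum_smoothed_sub (y := fun i t => x i t ω) hε.le
      (fun i t ht => continuous_of_convexOn (hlossc i t ht)) hgradl
      (fun t ht j => hball t ht j ω) hz hG.le
  simp only [integral_const, probReal_univ, one_smul] at hlow
  set V := ∫ ω, ∑ t ∈ Finset.Icc 1 T, ∑ j, ∑ s, max 0 (con s (x j t ω)) ^ 2 ∂μ
  have e : V = a / ((a - 1) * K) * ((a - 1) / a * K * V) := by field_simp
  rw [e]
  refine mul_le_mul_of_nonneg_left ?_ (by positivity)
  linarith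

end Expectation

/-! ### Evaluation of the bounds at the chosen parameters. -/

section Rates

variable {N d p B T : ℕ} {R G C ζ a Q M : ℝ}

/-- Here `Q = T^(c/3)`. The five terms scale as `T/Q`, `T/Q²`, `Q³`, `T/Q` and `T/Q³`, so only `T/Q`
and `Q³` determine the rate. -/
theorem regret_rate_le (hp : 1 ≤ p) (hG : 0 < G) (ha : 1 < a) (hC : 0 ≤ C)
    (hH : 0 ≤ hatC N B ζ) (hQ : 1 ≤ Q) (hM1 : T / Q ≤ M) (hM2 : Q ^ 3 ≤ M) :
    3 * N * G * (1 / Q * T)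
      + G * (hatC N B ζ * (1 / (a * p * G ^ 2 * Q ^ 3) * (T * (N * (d * C / (1 / Q))))))
      + (N * R ^ 2 / (2 * (1 / (a * p * G ^ 2 * Q ^ 3)))
        + 1 / (a * p * G ^ 2 * Q ^ 3) * (T * (N * (d * C / (1 / Q)) ^ 2)))
      + T * (N * (p * (hatC N B ζ ^ 2 / (4 * a * (a - 1) * p ^ 2 * Q ^ 3))))
      ≤ regretConst d N p B R G C a ζ * M := by
  have hp' : (0 : ℝ) < p := by exact_mod_cast hp
  have ha0 : 0 < a := by linarith
  have ha1 : 0 < a - 1 := by linarith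
  have hQ0 : 0 < Q := by linarith
  have hT : (0 : ℝ) ≤ T := Nat.cast_nonneg T
  have hM3 : T / Q ^ 2 ≤ M := le_trans (div_le_div_of_nonneg_left hT hQ0 (by nlinarith)) hM1
  have hM4 : T / Q ^ 3 ≤ M :=
    le_trans (div_le_div_of_nonneg_left hT hQ0 (by nlinarith [mul_pos hQ0 hQ0])) hM1
  unfold regretConst
  set H := hatC N B ζ
  have t1 : 3 * N * G * (1 / Q * T) = 3 * N * G * (T / Q) := by ring
  have t2 : G * (H * (1 / (a * p * G ^ 2 * Q ^ 3) * (T * (N * (d * C / (1 / Q))))))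
      = N * C * H * d / (a * p * G) * (T / Q ^ 2) := by field_simp
  have t3 : N * R ^ 2 / (2 * (1 / (a * p * G ^ 2 * Q ^ 3)))
      = 1 / 2 * a * p * N * G ^ 2 * R ^ 2 * Q ^ 3 := by field_simp
  have t4 : 1 / (a * p * G ^ 2 * Q ^ 3) * (T * (N * (d * C / (1 / Q)) ^ 2))
      = N * C ^ 2 * (d : ℝ) ^ 2 / (a * p * G ^ 2) * (T / Q) := by field_simp
  have t5 : T * (N * (p * (H ^ 2 / (4 * a * (a - 1) * p ^ 2 * Q ^ 3))))
      = N * H ^ 2 / (4 * a * (a - 1) * p) * (T / Q ^ 3) := by field_simp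
  rw [t1, t2, t3, t4, t5]
  have b1 := mul_le_mul_of_nonneg_left hM1 (by positivity : 0 ≤ 3 * N * G)
  have b2 := mul_le_mul_of_nonneg_left hM3 (by positivity : 0 ≤ N * C * H * d / (a * p * G))
  have b3 := mul_le_mul_of_nonneg_left hM2
    (by positivity : 0 ≤ 1 / 2 * a * p * N * G ^ 2 * R ^ 2)
  have b4 := mul_le_mul_of_nonneg_left hM1
    (by positivity : 0 ≤ N * C ^ 2 * (d : ℝ) ^ 2 / (a * p * G ^ 2))
  have b5 := mul_le_mul_of_nonneg_left hM4 (by positivity : 0 ≤ N * H ^ 2 / (4 * a * (a - 1) * p))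
  linarith

theorem violation_rate_le (hp : 1 ≤ p) (hG : 0 < G) (ha : 1 < a) (hQ : 1 ≤ Q)
    (hQT : Q ^ 3 ≤ T) :
    T * (N * p) * (a / ((a - 1) * Q ^ 3) *
      (N * R ^ 2 / (2 * (1 / (a * p * G ^ 2 * Q ^ 3)))
        + 1 / (a * p * G ^ 2 * Q ^ 3) * (T * (N * (d * C / (1 / Q)) ^ 2))
        + T * (N * (2 * G * R))))
      ≤ (N : ℝ) ^ 2 / (a - 1) * (C ^ 2 * (d : ℝ) ^ 2 / G ^ 2 + 2 * a * p * G * R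
        + 1 / 2 * a ^ 2 * (p : ℝ) ^ 2 * G ^ 2 * R ^ 2) * (T ^ 2 / Q ^ 3) := by
  have hp' : (0 : ℝ) < p := by exact_mod_cast hp
  have ha0 : 0 < a := by linarith
  have ha1 : 0 < a - 1 := by linarith
  have hQ0 : 0 < Q := by linarith
  have hT : (0 : ℝ) ≤ T := Nat.cast_nonneg T
  have e : T * (N * p) * (a / ((a - 1) * Q ^ 3) *
      (N * R ^ 2 / (2 * (1 / (a * p * G ^ 2 * Q ^ 3)))
        + 1 / (a * p * G ^ 2 * Q ^ 3) * (T * (N * (d * C / (1 / Q)) ^ 2))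
        + T * (N * (2 * G * R))))
      = (N : ℝ) ^ 2 / (a - 1) * (C ^ 2 * (d : ℝ) ^ 2 / G ^ 2 * (T ^ 2 / Q ^ 4)
        + 2 * a * p * G * R * (T ^ 2 / Q ^ 3)
        + 1 / 2 * a ^ 2 * (p : ℝ) ^ 2 * G ^ 2 * R ^ 2 * T) := by
    field_simp; ring
  have h34 : Q ^ 3 ≤ Q ^ 4 := pow_le_pow_right₀ hQ (by norm_num)
  have hQ3 : 0 < Q ^ 3 := by positivity
  have h1 : (T : ℝ) ^ 2 / Q ^ 4 ≤ T ^ 2 / Q ^ 3 :=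
    div_le_div_of_nonneg_left (sq_nonneg _) hQ3 h34
  have h2 : (T : ℝ) ≤ T ^ 2 / Q ^ 3 := by
    rw [le_div_iff₀ (by positivity), sq]
    exact mul_le_mul_of_nonneg_left hQT hT
  rw [e, mul_assoc ((N : ℝ) ^ 2 / (a - 1)) (_ + _) (T ^ 2 / Q ^ 3 : ℝ)]
  refine mul_le_mul_of_nonneg_left ?_ (by positivity)
  have b1 := mul_le_mul_of_nonneg_left h1 (by positivity : 0 ≤ C ^ 2 * (d : ℝ) ^ 2 / G ^ 2)
  have b2 := mul_le_mul_of_nonneg_left h2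
    (by positivity : 0 ≤ 1 / 2 * a ^ 2 * (p : ℝ) ^ 2 * G ^ 2 * R ^ 2)
  linarith

end Rates

end DOCO

end

/-! ### Choice of the comparator and conclusion. -/

theorem theorem3 {Ω : Type*} [MeasurableSpace Ω] (μ : Measure Ω) [IsProbabilityMeasure μ]
    (d N p T B : ℕ) (hd : 1 ≤ d) (hN : 1 ≤ N) (hp : 1 ≤ p) (hT : 1 ≤ T) (hB : 1 ≤ B)
    (R G Gl Gc C ζ a c : ℝ) (hR : 0 < R) (hG : G = max Gl Gc) (hG_pos : 0 < G) (hζ : 0 < ζ)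
    (ha : 1 < a) (hc : c ∈ Set.Ioo (0 : ℝ) 1)
    -- the shrinkage parameter is at most 1
    (hshrink : 1 / (R * (T : ℝ) ^ (c / 3)) ≤ 1)
    -- losses and constraint functions
    (loss : Fin N → ℕ → DOCO.Vec d → ℝ) (con : Fin p → DOCO.Vec d → ℝ)
    (hball : DOCO.feasible con ⊆ Metric.closedBall 0 R)
    (hzero : (0 : DOCO.Vec d) ∈ DOCO.feasible con)
    (hloss_convex : ∀ i, ∀ t ∈ Finset.Icc 1 T, ConvexOn ℝ Set.univ (loss i t))
    (hcon_convex : ∀ s, ConvexOn ℝ Set.univ (con s))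
    (hloss_grad : ∀ i, ∀ t ∈ Finset.Icc 1 T, ∀ x ∈ Metric.closedBall (0 : DOCO.Vec d) R,
      DifferentiableAt ℝ (loss i t) x ∧ ‖gradient (loss i t) x‖ ≤ Gl)
    (hcon_grad : ∀ s, ∀ x ∈ Metric.closedBall (0 : DOCO.Vec d) R,
      DifferentiableAt ℝ (con s) x ∧ ‖gradient (con s) x‖ ≤ Gc)
    (hloss_bdd : ∀ i, ∀ t ∈ Finset.Icc 1 T, ∀ x ∈ Metric.closedBall (0 : DOCO.Vec d) R,
      |loss i t x| ≤ C)
    -- the network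
    (graph : ℕ → Digraph (Fin N)) (A : ℕ → Matrix (Fin N) (Fin N) ℝ)
    (hgraph : DOCO.JointlyConnected graph B)
    (hA : ∀ t, 1 ≤ t → DOCO.IsWeightMatrix (graph t) ζ (A t))
    -- independent exploration directions, uniform on the unit sphere
    (u : Fin N → ℕ → Ω → Metric.sphere (0 : DOCO.Vec d) 1)
    (hu_meas : ∀ i t, Measurable (u i t))
    (hu_law : ∀ i t, μ.map (u i t) = DOCO.uniformSphere d)
    (hu_indep : iIndepFun (fun q : Fin N × ℕ => u q.1 q.2) μ)
    -- the run of the algorithm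
    (x : Fin N → ℕ → Ω → DOCO.Vec d) (lam : Fin N → ℕ → Ω → DOCO.Vec p)
    (hrun : ∀ ω, DOCO.IsBanditRun T loss con R A
      (fun _ => 1 / (T : ℝ) ^ c)
      (fun _ => 1 / (a * p * G ^ 2 * (T : ℝ) ^ c))
      (fun _ => 1 / (T : ℝ) ^ (c / 3))
      (1 / (R * (T : ℝ) ^ (c / 3)))
      (fun i t => (u i t ω : DOCO.Vec d)) (fun i t => x i t ω) (fun i t => lam i t ω))
    -- a best fixed feasible decision in hindsight
    (xstar : DOCO.Vec d) (hxstar : xstar ∈ DOCO.feasible con)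
    (hxstar_min : IsMinOn (DOCO.totalLoss T loss) (DOCO.feasible con) xstar) :
    (∀ i, Integrable (fun ω => DOCO.regret T loss xstar (fun t => x i t ω)) μ) ∧
    DOCO.expectedSystemRegret μ T loss xstar x
      ≤ DOCO.regretConst d N p B R G C a ζ * (T : ℝ) ^ (max (1 - c / 3) c) ∧
    (∀ t ∈ Finset.Icc 1 T, ∀ i s, Integrable (fun ω => max 0 (con s (x i t ω))) μ) ∧
    DOCO.expectedViolation μ T con x
      ≤ DOCO.violationConst d N p R G C a * (T : ℝ) ^ (1 - c / 2) := by
  have hT1 : (1 : ℝ) ≤ T := by exact_mod_cast hT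
  have hT0 : (0 : ℝ) < T := by linarith
  have hGl : Gl ≤ G := hG ▸ le_max_left _ _
  have hGc : Gc ≤ G := hG ▸ le_max_right _ _
  -- All parameters become rational in `Q`: `T^c = Q³`, `ε = 1/Q` and `π = 1/(RQ)`. In particular
  -- `πR = ε`, so the shrunken ball has radius `R - ε`.
  set Q : ℝ := (T : ℝ) ^ (c / 3) with hQdef
  have hQ1 : 1 ≤ Q := Real.one_le_rpow hT1 (by linarith [hc.1])
  have hQ0 : 0 < Q := by linarith
  have hK : (T : ℝ) ^ c = Q ^ 3 := by
    rw [hQdef, ← Real.rpow_natCast, ← Real.rpow_mul hT0.le]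
    congr 1; push_cast; ring
  have hTQ : (T : ℝ) / Q = (T : ℝ) ^ (1 - c / 3) := by
    rw [hQdef, Real.rpow_sub hT0, Real.rpow_one]
  simp only [hK] at hrun
  have hεR : 1 / Q ≤ R := by
    rw [div_le_one (by positivity)] at hshrink
    rw [div_le_iff₀ hQ0]; exact hshrink
  have hr : (1 - 1 / (R * Q)) * R = R - 1 / Q := by field_simp
  have hε : 0 < 1 / Q := by positivity
  have hK0 : 0 < Q ^ 3 := by positivity
  have hgradl : ∀ i, ∀ t ∈ Finset.Icc 1 T, ∀ y ∈ Metric.closedBall (0 : DOCO.Vec d) R,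
      DifferentiableAt ℝ (loss i t) y ∧ ‖gradient (loss i t) y‖ ≤ G := fun i t ht y hy =>
    ⟨(hloss_grad i t ht y hy).1, (hloss_grad i t ht y hy).2.trans hGl⟩
  have hgradc : ∀ s, ∀ y ∈ Metric.closedBall (0 : DOCO.Vec d) R,
      DifferentiableAt ℝ (con s) y ∧ ‖gradient (con s) y‖ ≤ G := fun s y hy =>
    ⟨(hcon_grad s y hy).1, (hcon_grad s y hy).2.trans hGc⟩
  have hC : 0 ≤ C := (abs_nonneg _).trans
    (hloss_bdd ⟨0, hN⟩ 1 (Finset.mem_Icc.2 ⟨le_rfl, hT⟩) 0 (Metric.mem_closedBall_self hR.le))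
  have hw := hball hxstar
  have hwn : ‖xstar‖ ≤ R := mem_closedBall_zero_iff.1 hw
  have hs0 : 0 ≤ 1 - 1 / (R * Q) := sub_nonneg.2 hshrink
  have hs1 : 1 - 1 / (R * Q) ≤ 1 := by
    have : 0 < 1 / (R * Q) := by positivity
    linarith
  -- The comparator is `(1 - π) x⋆`: it lies in the shrunken ball, is feasible by convexity since
  -- `0` is, and is within `πR = ε` of `x⋆`.
  have hzball : (1 - 1 / (R * Q)) • xstar ∈ Metric.closedBall (0 : DOCO.Vec d) (R - 1 / Q) := by
    rw [mem_closedBall_zero_iff, norm_smul, Real.norm_of_nonneg hs0, ← hr]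
    exact mul_le_mul_of_nonneg_left hwn hs0
  have hzfeas := DOCO.smul_mem_feasible hcon_convex hzero hxstar hs0 hs1
  have hzw : ‖(1 - 1 / (R * Q)) • xstar - xstar‖ ≤ 1 / Q := by
    have : (1 - 1 / (R * Q)) • xstar - xstar = -((1 / (R * Q)) • xstar) := by
      rw [sub_smul, one_smul]; abel
    rw [this, norm_neg, norm_smul, Real.norm_of_nonneg (by positivity)]
    calc 1 / (R * Q) * ‖xstar‖ ≤ 1 / (R * Q) * R := by gcongr
      _ = 1 / Q := by field_simp
  obtain ⟨hψ0, hψ1⟩ := DOCO.psiConst_bounds hN hζ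
    (DOCO.weight_floor_le_one hN (hA 1 le_rfl).isFloorStochastic)
  obtain ⟨hm0, hm⟩ := DOCO.four_mul_mixingConst_le_hatC (N := N) hN hB hψ0 hψ1
  have hH : 0 ≤ DOCO.hatC N B ζ := le_trans (by positivity) hm
  refine ⟨fun i => DOCO.integrable_regret hrun hr hεR hK0 hzero hloss_convex hcon_convex hu_meas
    xstar i, ?_, fun t ht i s => ?_, ?_⟩
  · have : Nonempty (Fin N) := ⟨⟨0, hN⟩⟩
    refine ciSup_le fun i => (DOCO.integral_regret_le hrun hr hεR hε hK0 hzero hloss_convex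
      hcon_convex hu_meas hgradl hgradc hloss_bdd hA hd hu_law hu_indep hG_pos ha hp rfl hN hB hζ
      hgraph hzball hzfeas hw hzw i).trans ?_
    refine DOCO.regret_rate_le hp hG_pos ha hC hH hQ1 ?_ ?_
    · rw [hTQ]; exact Real.rpow_le_rpow_of_exponent_le hT1 (le_max_left _ _)
    · rw [← hK]; exact Real.rpow_le_rpow_of_exponent_le hT1 (le_max_right _ _)
  · simpa using DOCO.integrable_violation_pow (μ := μ) hrun hr hεR hK0 hzero hloss_convex
      hcon_convex hu_meas ht i s 1
  · have hsq := (DOCO.sq_expectedViolation_le_of_bounds hrun hr hεR hε hK0 hzero hloss_convex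
      hcon_convex hu_meas hgradl hgradc hloss_bdd hA hd hu_law hu_indep hG_pos ha hp rfl hzball
      hzfeas).trans (DOCO.violation_rate_le hp hG_pos ha hQ1 (by
        rw [← hK]
        exact (Real.rpow_le_rpow_of_exponent_le hT1 hc.2.le).trans_eq (Real.rpow_one _)))
    have hY : (T : ℝ) ^ 2 / Q ^ 3 = ((T : ℝ) ^ (1 - c / 2)) ^ 2 := by
      rw [← hK, ← Real.rpow_natCast ((T : ℝ) ^ (1 - c / 2)), ← Real.rpow_mul hT0.le,
        ← Real.rpow_natCast (T : ℝ) 2, ← Real.rpow_sub hT0]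
      congr 1; push_cast; ring
    have ha1 : 0 < a - 1 := by linarith
    rw [hY] at hsq
    refine (Real.le_sqrt_of_sq_le hsq).trans (le_of_eq ?_)
    rw [Real.sqrt_mul (by positivity), Real.sqrt_sq (by positivity), DOCO.violationConst]
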